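/- Let $\Delta\subset\mathbb{R}^2$ be a reflexive lattice polygon (a lattice polygon with the origin in its interior whose polar dual $\{u : u\cdot v\ge -1\ \forall v\in\Delta\}$ is again a lattice polygon; up to $GL(2,\mathbb{Z})$ there are 16 of them), with set of extremal vertices $V$. Let $\sigma\subset\mathbb{R}^3$ be the cone generated by the vectors $(v,1)$, $v\in V$, and let $\mathcal{X}=\operatorname{Spec}\mathbb{C}[S]$, $S=\sigma^\vee\cap\mathbb{Z}^3$, be the toric Calabi–Yau 3-fold with toric diagram $\Delta$. Let $x_1,\dots,x_k$ be the minimal generators of the coordinate ring, i.e. the nonzero elements $m_1,\dots,m_k$ of $S$ which are not the sum of two nonzero elements of $S$, and write $\mathbb{C}[S]=\mathbb{C}[x_1,\dots,x_k]/I$. For $b\in\mathbb{R}^V$ let $x_h$ have weight $\sum_{v}b_v\langle m_h,(v,1)\rangle$ (the GLSM field $p_v$ has weight $b_v$, and $x_h=\prod_v p_v^{\langle m_h,(v,1)\rangle}$). For a grading $\zeta$ giving $x_i$ the weight $q_i$, define $A_0(\zeta),A_1(\zeta)$ by the expansion $g(t=e^{-s};\mathcal{X},\zeta)=\frac{2A_0(\zeta)}{s^3}+\frac{A_1(\zeta)}{s^2}+O(\tfrac1s)$,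 $s\to0^+$, of the Hilbert series. Let $\eta_h$ be the test symmetry with weight $1$ on $x_h$ and $0$ on the other generators. Let $A_i(\zeta+\epsilon\eta_h)$ be the same coefficients for the Hilbert series of the central fibre $\mathbb{C}[x_1,\dots,x_k]/I_0$, where $I_0$ is generated by the lowest-$\eta_h$-weight parts of the elements of $I$ and $x_i$ has weight $q_i+\epsilon\delta_{ih}$. The Futaki invariant is $$F(\mathcal{X};\zeta,\eta_h)=\frac{A_0(\zeta)}{2}\,\frac{d}{d\epsilon}\left[\frac{A_1(\zeta+\epsilon\eta_h)}{A_0(\zeta+\epsilon\eta_h)}\right]_{\epsilon=0}+\frac{A_1(\zeta)}{6A_0(\zeta)}\,\frac{d}{d\epsilon}A_0(\zeta+\epsilon\eta_h)\Big|_{\epsilon=0}.$$ Let $\zeta_p$ be the grading by GLSM-field degree, $b_v=1$ for all $v\in V$. Let $\zeta_R$ be the $R$-charge grading, $b=r$, where $r$ minimizes the volume $V(b)=\frac{8}{27}\lim_{s\to0^+}s^3 g(e^{-s};\mathcal{X},b)$ among all $b\in\mathbb{R}^V$ with $\sum_v b_v=2$ that give every generator positive weight. Then such a minimizer $r$ exists.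 For every such $r$ and every generator $x_h$, both Futaki invariants are well defined and $$F(\mathcal{X};\zeta_p,\eta_h)\le\frac{8}{27}\,F(\mathcal{X};\zeta_R,\eta_h),$$ with equality for every generator if $\Delta$ is a triangle. -/

import Mathlib

open Filter Topology Asymptotics

noncomputable section

namespace ToricFutaki

/-! ### Reflexive polygons -/

/-- The inclusion of the lattice `ℤ²` into the plane. -/
def toPlane (v : Fin 2 → ℤ) : Fin 2 → ℝ := fun i => (v i : ℝ)

/-- The convex hull in the plane of a finite set of lattice points. -/
def polygon (V : Finset (Fin 2 → ℤ)) : Set (Fin 2 → ℝ) :=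
  convexHull ℝ (toPlane '' (V : Set (Fin 2 → ℤ)))

/-- The polar dual `{u | u · v ≥ -1 for all v ∈ P}`. -/
def polarDual (P : Set (Fin 2 → ℝ)) : Set (Fin 2 → ℝ) :=
  {u | ∀ v ∈ P, -1 ≤ u ⬝ᵥ v}

/-- `V` is the set of extremal vertices of a reflexive lattice polygon: every element of `V` is an
extreme point of the polygon, the origin is an interior point, and the polar dual is again a
lattice polygon. -/
structure IsReflexivePolygon (V : Finset (Fin 2 → ℤ)) : Prop where
  extremePoints_eq : (polygon V).extremePoints ℝ = toPlane '' (V : Set (Fin 2 → ℤ))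
  zero_mem_interior : (0 : Fin 2 → ℝ) ∈ interior (polygon V)
  dual_isLattice : ∃ W : Finset (Fin 2 → ℤ), polarDual (polygon V) = polygon W

/-! ### The toric Calabi-Yau 3-fold of a polygon -/

/-- The lattice vector `(v, 1)` spanning a ray of the cone over the polygon. -/
def ray (v : Fin 2 → ℤ) : Fin 3 → ℤ := ![v 0, v 1, 1]

/-- The lattice points of the dual of the cone generated by the vectors `(v, 1)`, `v ∈ V`. -/
def dualMonoid (V : Finset (Fin 2 → ℤ)) : AddSubmonoid (Fin 3 → ℤ) where
  carrier := {m | ∀ v ∈ V, 0 ≤ m ⬝ᵥ ray v}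
  zero_mem' := by
    intro v _
    simp
  add_mem' := by
    intro a b ha hb v hv
    rw [add_dotProduct]
    exact add_nonneg (ha v hv) (hb v hv)

/-- The minimal generators of the coordinate ring: the nonzero lattice points of the dual cone that
are not a sum of two nonzero lattice points of the dual cone. -/
def Generator (V : Finset (Fin 2 → ℤ)) : Type :=
  {m : dualMonoid V // m ≠ 0 ∧ ∀ a b : dualMonoid V, m = a + b → a = 0 ∨ b = 0}

/-- The ideal of relations among the generators: the kernel of the map from the polynomial ring in
the generators `x_h` to the coordinate ring `ℂ[σ^∨ ∩ N]`. -/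
def toricIdeal (V : Finset (Fin 2 → ℤ)) : Ideal (MvPolynomial (Generator V) ℂ) :=
  RingHom.ker (MvPolynomial.aeval (R := ℂ)
    (fun h : Generator V => (AddMonoidAlgebra.single h.1 1 : AddMonoidAlgebra ℂ (dualMonoid V))))

/-- The weight of a generator if the GLSM field `p_v` of the extremal vertex `v` has weight `b v`.
The generator `m` is the monomial `∏ p_v ^ ⟨m, (v, 1)⟩`. -/
def glsmWeight (V : Finset (Fin 2 → ℤ)) (b : V → ℝ) (h : Generator V) : ℝ :=
  ∑ v : V, b v * ((h.1.1 ⬝ᵥ ray v.1 : ℤ) : ℝ)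

/-! ### Hilbert series and their Laurent expansion -/

/-- The graded piece of weight `c` of `ℂ[x_i] / J`, where `x_i` has the real weight `q i`. -/
def gradedPiece {ι : Type} (J : Ideal (MvPolynomial ι ℂ)) (q : ι → ℝ) (c : ℝ) :
    Submodule ℂ (MvPolynomial ι ℂ ⧸ J) :=
  (MvPolynomial.weightedHomogeneousSubmodule ℂ q c).map (Ideal.Quotient.mkₐ ℂ J).toLinearMap

/-- The Hilbert series of `ℂ[x_i] / J` under the weights `q`, at `t = exp (-s)`. -/
def hilbertSeries {ι : Type} (J : Ideal (MvPolynomial ι ℂ)) (q : ι → ℝ) (s : ℝ) : ℝ :=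
  ∑' c : ℝ, (Module.finrank ℂ (gradedPiece J q c) : ℝ) * Real.exp (-s * c)

/-- `g(s) = 2 A₀ / s³ + A₁ / s² + O(1 / s)` as `s → 0⁺`, which is the expansion
`(n-1)! A₀ / sⁿ + (n-2)! A₁ / sⁿ⁻¹ + ⋯` for `n = 3`. -/
def HasLaurentCoeffs (g : ℝ → ℝ) (A₀ A₁ : ℝ) : Prop :=
  (fun s => g s - 2 * A₀ / s ^ 3 - A₁ / s ^ 2) =O[𝓝[>] (0 : ℝ)] fun s => 1 / s

/-! ### Test symmetries and Futaki invariants -/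

/-- The ideal of the central fibre of the test configuration of a test symmetry with weights `η`:
it is generated by the lowest weight parts of the elements of `I`. -/
def initialIdeal {ι : Type} (I : Ideal (MvPolynomial ι ℂ)) (η : ι → ℕ) :
    Ideal (MvPolynomial ι ℂ) :=
  Ideal.span {g | ∃ f ∈ I, ∃ k : ℕ,
    (∀ j < k, MvPolynomial.weightedHomogeneousComponent η j f = 0) ∧
      g = MvPolynomial.weightedHomogeneousComponent η k f}

open Classical in
/-- The test symmetry `η_h`, of weight `1` on `x_h` and `0` on the other generators. -/
def testSymmetry {ι : Type} (h : ι) : ι → ℕ := Pi.single h 1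

/-- `F` is the Futaki invariant `F(𝒳; ζ, η)`, where `𝒳` is the 3-fold with ideal `I`, the
generators have weights `q` under `ζ` and weights `η` under the test symmetry:
`F = A₀(ζ)/2 · D_ε [A₁(ζ+εη) / A₀(ζ+εη)] + A₁(ζ) / (6 A₀(ζ)) · D_ε A₀(ζ+εη)` at `ε = 0`.
The coefficients `B₀ ε = A₀(ζ+εη)`, `B₁ ε = A₁(ζ+εη)` are those of the Hilbert series of the
central fibre, in which `x_i` has weight `q i + ε η i`. -/
def HasFutakiInvariant {ι : Type} (I : Ideal (MvPolynomial ι ℂ)) (q : ι → ℝ) (η : ι → ℕ)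
    (F : ℝ) : Prop :=
  ∃ (A₀ A₁ : ℝ) (B₀ B₁ : ℝ → ℝ) (D₀ D : ℝ),
    HasLaurentCoeffs (hilbertSeries I q) A₀ A₁ ∧ A₀ ≠ 0 ∧
    (∀ᶠ ε in 𝓝 (0 : ℝ), B₀ ε ≠ 0 ∧
      HasLaurentCoeffs (hilbertSeries (initialIdeal I η) (fun i => q i + ε * (η i : ℝ)))
        (B₀ ε) (B₁ ε)) ∧
    HasDerivAt (fun ε => B₁ ε / B₀ ε) D 0 ∧
    HasDerivAt B₀ D₀ 0 ∧
    F = A₀ / 2 * D + A₁ / (6 * A₀) * D₀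

/-! ### The `U(1)_R` charges from volume minimization -/

/-- `vol` is the volume `V(b; Y) = (8/27) lim_{s → 0} s³ g(t_v = exp (-s b_v); 𝒳)`. -/
def HasVolume (V : Finset (Fin 2 → ℤ)) (b : V → ℝ) (vol : ℝ) : Prop :=
  Tendsto (fun s => 8 / 27 * (s ^ 3 * hilbertSeries (toricIdeal V) (glsmWeight V b) s))
    (𝓝[>] (0 : ℝ)) (𝓝 vol)

/-- The admissible Reeb vector components: all generators have positive weight (the Reeb vector
`∑ b_v (v, 1)` is in the interior of the cone), and `∑ b_v = 2`. -/
def IsReeb (V : Finset (Fin 2 → ℤ)) (b : V → ℝ) : Prop :=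
  (∀ h : Generator V, 0 < glsmWeight V b h) ∧ ∑ v : V, b v = 2

/-- `r` minimizes the volume function, so `t_v = t ^ r_v` is the grading by the `U(1)_R`
symmetry. -/
def IsRCharge (V : Finset (Fin 2 → ℤ)) (r : V → ℝ) : Prop :=
  IsReeb V r ∧ ∃ vmin, HasVolume V r vmin ∧
    ∀ b : V → ℝ, IsReeb V b → ∃ vol, HasVolume V b vol ∧ vmin ≤ vol

/-! ### The Futaki invariant is well defined -/

theorem HasLaurentCoeffs.unique {g : ℝ → ℝ} {A₀ A₁ A₀' A₁' : ℝ}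
    (h : HasLaurentCoeffs g A₀ A₁) (h' : HasLaurentCoeffs g A₀' A₁') : A₀ = A₀' ∧ A₁ = A₁' := by
  have pos : ∀ᶠ s in 𝓝[>] (0 : ℝ), 0 < s := self_mem_nhdsWithin
  have id0 : Tendsto (fun s : ℝ => s) (𝓝[>] (0 : ℝ)) (𝓝 0) := tendsto_nhdsWithin_of_tendsto_nhds
    tendsto_id
  have key : (fun s : ℝ => 2 * (A₀ - A₀') + (A₁ - A₁') * s) =O[𝓝[>] (0 : ℝ)] fun s => s ^ 2 := by
    have h3 := (isBigO_refl (fun s : ℝ => s ^ 3) (𝓝[>] (0 : ℝ))).mul (h'.sub h)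
    refine (h3.congr' ?_ ?_)
    · filter_upwards [pos] with s hs
      field_simp
      ring
    · filter_upwards [pos] with s hs
      field_simp
  have sq0 : Tendsto (fun s : ℝ => s ^ 2) (𝓝[>] (0 : ℝ)) (𝓝 0) := by
    simpa using id0.pow 2
  have lim0 := key.trans_tendsto sq0
  have lim0' : Tendsto (fun s : ℝ => 2 * (A₀ - A₀') + (A₁ - A₁') * s) (𝓝[>] (0 : ℝ))
      (𝓝 (2 * (A₀ - A₀') + (A₁ - A₁') * 0)) := (id0.const_mul _).const_add _
  have e0 : A₀ = A₀' := by
    have := tendsto_nhds_unique lim0 lim0'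
    linarith
  subst e0
  refine ⟨rfl, ?_⟩
  have key1 : (fun _ : ℝ => A₁ - A₁') =O[𝓝[>] (0 : ℝ)] fun s => s := by
    have h3 := (isBigO_refl (fun s : ℝ => s⁻¹) (𝓝[>] (0 : ℝ))).mul key
    refine (h3.congr' ?_ ?_)
    · filter_upwards [pos] with s hs
      field_simp
      ring
    · filter_upwards [pos] with s hs
      field_simp
  have := tendsto_nhds_unique (key1.trans_tendsto id0) tendsto_const_nhds
  linarith

theorem HasFutakiInvariant.unique {ι : Type} {I : Ideal (MvPolynomial ι ℂ)} {q : ι → ℝ}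
    {η : ι → ℕ} {F F' : ℝ} (h : HasFutakiInvariant I q η F) (h' : HasFutakiInvariant I q η F') :
    F = F' := by
  obtain ⟨A₀, A₁, B₀, B₁, D₀, D, hA, -, hB, hD, hD₀, rfl⟩ := h
  obtain ⟨A₀', A₁', B₀', B₁', D₀', D', hA', -, hB', hD', hD₀', rfl⟩ := h'
  obtain ⟨rfl, rfl⟩ := hA.unique hA'
  have e : ∀ᶠ ε in 𝓝 (0 : ℝ), B₀ ε = B₀' ε ∧ B₁ ε = B₁' ε := by
    filter_upwards [hB, hB'] with ε k k' using k.2.unique k'.2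
  have e₀ : B₀ =ᶠ[𝓝 0] B₀' := e.mono fun _ k => k.1
  have e₁ : (fun ε => B₁ ε / B₀ ε) =ᶠ[𝓝 0] fun ε => B₁' ε / B₀' ε :=
    e.mono fun _ k => by simp only [k.1, k.2]
  rw [hD₀.unique (hD₀'.congr_of_eventuallyEq e₀), hD.unique (hD'.congr_of_eventuallyEq e₁)]

end ToricFutaki

end

/-! Let `Γ` be the set of nonzero lattice points of the dual polygon. Reflexivity puts all of them
on its boundary, and consecutive points have determinant 1 (`IsPolarPair.exists_isFan`). The dual
cone is therefore a disjoint union of half-open unimodular cones, the generators of the coordinate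
ring are the points `(w, 1)` with `w = 0` or `w ∈ Γ`, and the Hilbert series is an explicit sum of
products of geometric series (`IsFan.hasSum_cone`). Write `q_w` for the weight of `(w, 1)`, `B =
q_0` for the total weight and `Φ = ∑ 1 / (q_w q_{σ w})` for `conePhi`. The expansion gives `A₀ = Φ /
(2B)` and `A₁ = Φ / 2`.

In the central fibre of `η_h`, the weight of a multidegree is the largest power of `x_h` that can be
split off. Passing from `q_h` to `q_h + ε` thus only replaces the geometric series of `x_h`. Hence
`A₀` is multiplied by `q_h / (q_h + ε)`, `A₁ / A₀` becomes `B + ε`, and `F = Φ / (4B) · (1 - B / (3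
q_h))` (`IsFan.hasFutakiInvariant`).

With `d = |V|`, `Q` and `q` the two weights of `x_h`, and `Φp`, `Φr` the two values of `Φ`, the
claim reads `Φp / (4d) · (1 - d / (3Q)) ≤ Φr / 27 · (1 - 2 / (3q))`. At the origin `Q = d` and `q =
2`, so it says `27 / (4d) · Φp ≤ Φr`. At a boundary point, minimality of the volume forces `q ≥ 4/3`
(`IsFan.le_pointWeight_of_isRCharge`), so `27 / (2d) · Φp · (1 - d / (3Q)) ≤ Φr` suffices.

Both are lower bounds for `Φr`. They come from convexity: `Φ` lies above each of its tangent planes,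
and the admissible weights form a polygon, so a tangent plane is bounded below by its values at the
vertices `v ∈ V` (`le_conePhi`). A suitable tangent plane is found for every reflexive polygon by a
finite computation. It rests on a classification up to a change of basis: either the polygon
contains two opposite lattice points and `Γ` lies in three columns, or `Γ` is the boundary of the
largest triangle (`IsPolarPair.exists_hasTangent`). For a triangle, the tangent plane at the weights
`b_v = 2/3` shows that these are the `R`-charges on the generators, whence equality. -/

noncomputable section

namespace ToricFutaki

/-! ### Quotients with a monomial basis -/

section Algebra

open MvPolynomial

variable {ι M : Type}

/-- The Hilbert series of `ℂ[x_i] / J`, if a linear map with kernel `J` sends every monomial to zero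
or to a basis vector of matching weight. -/
theorem hilbertSeries_eq_tsum {J : Ideal (MvPolynomial ι ℂ)} {q : ι → ℝ}
    (Ψ : MvPolynomial ι ℂ →ₗ[ℂ] (M →₀ ℂ)) (hker : ∀ f, f ∈ J ↔ Ψ f = 0) (L : M → ℝ)
    (hmon : ∀ α : ι →₀ ℕ, Ψ (monomial α 1) = 0 ∨
      ∃ m, Ψ (monomial α 1) = Finsupp.single m 1 ∧ L m = Finsupp.weight q α)
    (hsurj : ∀ m, ∃ α : ι →₀ ℕ, Ψ (monomial α 1) = Finsupp.single m 1 ∧ L m = Finsupp.weight q α)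
    {s : ℝ} (hs : Summable fun m => Real.exp (-s * L m)) :
    hilbertSeries J q s = ∑' m, Real.exp (-s * L m) := by
  set mk := (Ideal.Quotient.mkₐ ℂ J).toLinearMap with hmk
  have hmk0 : ∀ f, mk f = 0 ↔ f ∈ J := fun f => Ideal.Quotient.eq_zero_iff_mem
  obtain ⟨sec, hsec⟩ := LinearMap.exists_rightInverse_of_surjective mk
    (LinearMap.range_eq_top.2 Ideal.Quotient.mk_surjective)
  have hsec' : ∀ x, mk (sec x) = x := fun x => LinearMap.congr_fun hsec x
  set φ := Ψ ∘ₗ sec with hφ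
  have hφmk : φ ∘ₗ mk = Ψ := by
    refine LinearMap.ext fun f => ?_
    have : sec (mk f) - f ∈ J := by
      rw [← hmk0, map_sub, hsec', sub_self]
    rw [hker, map_sub, sub_eq_zero] at this
    exact this
  have hinj : Function.Injective φ := by
    rw [← LinearMap.ker_eq_bot, LinearMap.ker_eq_bot']
    intro x hx
    have : sec x ∈ J := (hker _).2 hx
    rw [← hsec' x, hmk0]
    exact this
  have hmap : ∀ c, (weightedHomogeneousSubmodule ℂ q c).map Ψ =
      Finsupp.supported ℂ ℂ {m | L m = c} := by
    intro c
    apply le_antisymm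
    · rintro _ ⟨f, hf, rfl⟩
      have hf' : IsWeightedHomogeneous q f c := hf
      rw [← support_sum_monomial_coeff f, map_sum]
      refine Submodule.sum_mem _ fun α hα => ?_
      have hw : Finsupp.weight q α = c := hf' (mem_support_iff.1 hα)
      have e : monomial α (coeff α f) = coeff α f • monomial α (1 : ℂ) := by
        rw [smul_monomial, smul_eq_mul, mul_one]
      rw [e, map_smul]
      refine Submodule.smul_mem _ _ ?_
      rcases hmon α with h | ⟨m, h, hm⟩
      · rw [h]; exact Submodule.zero_mem _
      · rw [h]; exact Finsupp.single_mem_supported ℂ 1 (hm.trans hw)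
    · rw [Finsupp.supported_eq_span_single, Submodule.span_le]
      rintro _ ⟨m, hm, rfl⟩
      obtain ⟨α, h, hL⟩ := hsurj m
      exact ⟨monomial α 1, isWeightedHomogeneous_monomial q α 1 (hL.symm.trans hm), h⟩
  have hrank : ∀ c, Module.finrank ℂ (gradedPiece J q c) = Nat.card {m // L m = c} := by
    intro c
    have e1 := (Submodule.equivMapOfInjective φ hinj (gradedPiece J q c)).finrank_eq
    have e2 : (gradedPiece J q c).map φ = Finsupp.supported ℂ ℂ {m | L m = c} := by
      rw [gradedPiece, ← hmk, ← Submodule.map_comp, hφmk, hmap]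
    rw [e1, e2, (Finsupp.supportedEquivFinsupp {m | L m = c}).finrank_eq,
      Module.finrank_eq_nat_card_basis (Finsupp.basisSingleOne (R := ℂ) (ι := {m | L m = c}))]
    rfl
  have hsig := (Equiv.sigmaFiberEquiv L).summable_iff.2 hs
  rw [← (Equiv.sigmaFiberEquiv L).tsum_eq]
  refine Eq.trans ?_ hsig.tsum_sigma.symm
  unfold hilbertSeries
  refine tsum_congr fun c => ?_
  have : ∀ x : {m // L m = c}, Real.exp (-s * L ((Equiv.sigmaFiberEquiv L) ⟨c, x⟩)) =
      Real.exp (-s * c) := fun x => by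
    have : L ((Equiv.sigmaFiberEquiv L) ⟨c, x⟩) = c := x.2
    rw [this]
  simp only [Function.comp_apply] at hsig ⊢
  -- Fibres of `L` need not be shown finite here: for an infinite fibre `Module.finrank`, `Nat.card`
  -- and the sum of a constant all take the default value 0.
  rw [tsum_congr this, tsum_const, hrank, nsmul_eq_mul]

variable [AddCommMonoid M]

open Classical in
/-- The linear map which sends a monomial of multidegree `m` in the grading by `gen` to the basis
vector `m` if its weight is `N m`, and to zero otherwise. -/
def gradedMap (gen : ι → M) (η : ι → ℕ) (N : M → ℕ) : MvPolynomial ι ℂ →ₗ[ℂ] (M →₀ ℂ) :=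
  (basisMonomials ι ℂ).constr ℂ fun α =>
    if Finsupp.weight η α = N (Finsupp.weight gen α) then
      Finsupp.single (Finsupp.weight gen α) 1 else 0

open Classical in
theorem gradedMap_monomial (gen : ι → M) (η : ι → ℕ) (N : M → ℕ) (α : ι →₀ ℕ) (c : ℂ) :
    gradedMap gen η N (monomial α c) = if Finsupp.weight η α = N (Finsupp.weight gen α) then
      Finsupp.single (Finsupp.weight gen α) c else 0 := by
  have e : monomial α c = c • basisMonomials ι ℂ α := by
    rw [coe_basisMonomials, smul_monomial, smul_eq_mul, mul_one]
  rw [e, map_smul, gradedMap, Module.Basis.constr_basis]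
  split_ifs <;> simp

open Classical in
theorem gradedMap_apply (gen : ι → M) (η : ι → ℕ) (N : M → ℕ) (f : MvPolynomial ι ℂ) (m : M)
    {T : Finset (ι →₀ ℕ)} (hT : f.support ⊆ T) :
    gradedMap gen η N f m =
      ∑ α ∈ T, if Finsupp.weight gen α = m ∧ Finsupp.weight η α = N m then coeff α f else 0 := by
  conv_lhs => rw [← support_sum_monomial_coeff f, map_sum, Finsupp.finsetSum_apply]
  rw [Finset.sum_subset hT]
  · refine Finset.sum_congr rfl fun α _ => ?_
    rw [gradedMap_monomial]
    by_cases h : Finsupp.weight gen α = m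
    · subst h
      by_cases h' : Finsupp.weight η α = N (Finsupp.weight gen α) <;> simp [h']
    · by_cases h' : Finsupp.weight η α = N (Finsupp.weight gen α) <;> simp [h, h']
  · intro α _ hα
    rw [notMem_support_iff.1 hα, monomial_zero, map_zero, Finsupp.zero_apply]

theorem gradedMap_zero_apply (gen : ι → M) (f : MvPolynomial ι ℂ) {I : Ideal (MvPolynomial ι ℂ)}
    (hI : ∀ f, f ∈ I ↔ gradedMap gen 0 0 f = 0) (hf : f ∈ I) (m : M) :
    open Classical in
    (∑ α ∈ f.support, if Finsupp.weight gen α = m then coeff α f else 0) = 0 := by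
  classical
  have := gradedMap_apply gen 0 0 f m subset_rfl
  rw [(hI f).1 hf, Finsupp.zero_apply] at this
  refine Eq.trans (Finset.sum_congr rfl fun α _ => ?_) this.symm
  have h0 : Finsupp.weight (0 : ι → ℕ) α = (0 : M → ℕ) m := by
    simp [Finsupp.weight_apply]
  simp only [h0, and_true]

/-- In a multidegree `m` with `N m = k`, all monomials of `f` have weight at least `k` and at most
`N m`, so `g` contains the whole degree `m` part of `f`, whose coefficients sum to zero. In any
other multidegree no monomial of `g` is kept. -/
theorem gradedMap_lowest_eq_zero {gen : ι → M} {η : ι → ℕ} {N : M → ℕ}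
    {I : Ideal (MvPolynomial ι ℂ)} (hI : ∀ f, f ∈ I ↔ gradedMap gen 0 0 f = 0)
    (hN : ∀ α : ι →₀ ℕ, Finsupp.weight η α ≤ N (Finsupp.weight gen α)) {f : MvPolynomial ι ℂ} (hf : f ∈ I)
    {k : ℕ} (hk : ∀ α : ι →₀ ℕ, Finsupp.weight η α < k → coeff α f = 0) {g : MvPolynomial ι ℂ}
    (hg : ∀ α : ι →₀ ℕ, coeff α g = if Finsupp.weight η α = k then coeff α f else 0) :
    gradedMap gen η N g = 0 := by
  classical
  ext m
  have hT : g.support ⊆ f.support := by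
    intro α hα
    rw [mem_support_iff] at hα ⊢
    rw [hg] at hα
    intro h
    rw [h, ite_self] at hα
    exact hα rfl
  rw [gradedMap_apply _ _ _ _ _ hT, Finsupp.zero_apply]
  by_cases hm : k = N m
  · refine Eq.trans (Finset.sum_congr rfl fun α _ => ?_) (gradedMap_zero_apply gen f hI hf m)
    by_cases h : Finsupp.weight gen α = m
    · have h1 : Finsupp.weight η α ≤ k := by rw [hm, ← h]; exact hN α
      rcases h1.lt_or_eq with h2 | h2
      · simp [h, hg, h2.ne, hk α h2]
      · simp [h, hg, h2, hm]
    · simp [h]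
  · refine Finset.sum_eq_zero fun α _ => ?_
    split_ifs with h
    · rw [hg, if_neg]
      rw [h.2]
      exact fun h' => hm h'.symm
    · rfl

/-- The ideal of the central fibre is the kernel of the map that keeps the monomials of maximal
weight in each multidegree. -/
theorem mem_initialIdeal_iff {gen : ι → M} {η : ι → ℕ} {N : M → ℕ}
    {I : Ideal (MvPolynomial ι ℂ)} (hI : ∀ f, f ∈ I ↔ gradedMap gen 0 0 f = 0)
    (hN : ∀ α : ι →₀ ℕ, Finsupp.weight η α ≤ N (Finsupp.weight gen α))
    (hatt : ∀ m, ∃ α : ι →₀ ℕ, Finsupp.weight gen α = m ∧ Finsupp.weight η α = N m)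
    (f : MvPolynomial ι ℂ) : f ∈ initialIdeal I η ↔ gradedMap gen η N f = 0 := by
  classical
  constructor
  · intro hf
    -- The kernel of `gradedMap` is not known to be an ideal, so the claim is strengthened to all
    -- multiples of `f`.
    suffices h : ∀ p, gradedMap gen η N (p * f) = 0 by simpa using h 1
    refine Submodule.span_induction (p := fun x _ => ∀ p, gradedMap gen η N (p * x) = 0)
      ?_ ?_ ?_ ?_ hf
    · rintro _ ⟨f, hf, k, hk, rfl⟩ p
      induction p using induction_on' with
      | add p q hp hq => rw [add_mul, map_add, hp, hq, add_zero]
      | monomial β c =>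
        refine gradedMap_lowest_eq_zero hI hN (f := monomial β c * f)
          (k := Finsupp.weight η β + k) (I.mul_mem_left _ hf) ?_ ?_
        · intro α hα
          rw [coeff_monomial_mul']
          split_ifs with h
          · obtain ⟨γ, rfl⟩ := exists_add_of_le h
            rw [map_add, add_lt_add_iff_left] at hα
            have := congrArg (coeff γ) (hk _ hα)
            rw [coeff_weightedHomogeneousComponent, if_pos rfl, coeff_zero] at this
            rw [add_tsub_cancel_left, this, mul_zero]
          · rfl
        · intro α
          rw [coeff_monomial_mul', coeff_monomial_mul']
          by_cases h : β ≤ α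
          · obtain ⟨γ, rfl⟩ := exists_add_of_le h
            rw [if_pos h, if_pos h, add_tsub_cancel_left, coeff_weightedHomogeneousComponent,
              map_add]
            by_cases h' : Finsupp.weight η γ = k <;> simp [h']
          · simp [h]
    · intro p; simp
    · intro x y _ _ hx hy p
      rw [mul_add, map_add, hx, hy, add_zero]
    · intro a x _ hx p
      rw [smul_eq_mul, ← mul_assoc, hx]
  -- Modulo the initial ideal, `f` is congruent to its image rewritten in chosen monomials `A m` of
  -- maximal weight; this is checked on monomials.
  · choose A hA hA' using hatt
    set Θ : (M →₀ ℂ) →ₗ[ℂ] MvPolynomial ι ℂ :=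
      Finsupp.linearCombination ℂ fun m => monomial (A m) (1 : ℂ) with hΘ
    suffices h : ∀ f, f - Θ (gradedMap gen η N f) ∈ initialIdeal I η by
      intro hf
      simpa [hf] using h f
    intro f
    induction f using induction_on' with
    | add p q hp hq =>
      have := Ideal.add_mem _ hp hq
      rw [map_add, map_add]
      convert this using 1
      ring
    | monomial u a =>
      set m := Finsupp.weight gen u with hm
      -- This binomial lies in `I`. If `u` has maximal weight it is homogeneous and equals its
      -- lowest part; otherwise its lowest part is `u` alone, which is mapped to zero.
      refine Ideal.subset_span ⟨monomial u a - monomial (A m) a, ?_, Finsupp.weight η u, ?_, ?_⟩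
      · have h0 : ∀ α : ι →₀ ℕ, Finsupp.weight (0 : ι → ℕ) α = 0 := by
          intro α; simp [Finsupp.weight_apply]
        rw [hI, map_sub, gradedMap_monomial, gradedMap_monomial, hA]
        simp [h0, hm]
      · intro j hj
        ext α
        have hAm : Finsupp.weight η u ≤ N m := hN u
        rw [coeff_weightedHomogeneousComponent, coeff_zero, coeff_sub, coeff_monomial,
          coeff_monomial]
        split_ifs with h1 h2 h3 h3
        · subst h2; omega
        · subst h2; omega
        · subst h3; rw [hA'] at h1; omega
        · simp
        · rfl
      · rw [gradedMap_monomial]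
        ext α
        rw [coeff_weightedHomogeneousComponent, coeff_sub, coeff_sub, coeff_monomial,
          coeff_monomial]
        have hAm := hA' m
        by_cases hc : Finsupp.weight η u = N m
        · rw [if_pos hc, hΘ, Finsupp.linearCombination_single, smul_monomial, smul_eq_mul,
            mul_one, coeff_monomial]
          split_ifs with h1 h2 h3 <;> simp_all
        · rw [if_neg hc, map_zero, coeff_zero]
          have hu : u ≠ A m := fun h => hc (by rw [← hAm, ← h])
          by_cases h1 : u = α
          · subst h1
            simp [hu.symm]
          · by_cases h2 : A m = α
            · subst h2
              simp [hu, hAm, Ne.symm hc]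
            · simp [h1, h2]

end Algebra

/-! ### First order expansions at `0⁺` -/

section Expansion

/-- `f s = α + β s + O(s²)` as `s → 0⁺`. -/
def HasExpansion (f : ℝ → ℝ) (α β : ℝ) : Prop :=
  (fun s => f s - α - β * s) =O[𝓝[>] (0 : ℝ)] fun s => s ^ 2

theorem tendsto_id_nhdsGT : Tendsto (fun s : ℝ => s) (𝓝[>] (0 : ℝ)) (𝓝 0) :=
  tendsto_nhdsWithin_of_tendsto_nhds tendsto_id

theorem eventually_pos_nhdsGT : ∀ᶠ s in 𝓝[>] (0 : ℝ), 0 < s := self_mem_nhdsWithin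

theorem isBigO_id_one : (fun s : ℝ => s) =O[𝓝[>] (0 : ℝ)] fun _ => (1 : ℝ) :=
  tendsto_id_nhdsGT.isBigO_one ℝ

theorem isBigO_sq_id : (fun s : ℝ => s ^ 2) =O[𝓝[>] (0 : ℝ)] fun s => s := by
  simpa [sq] using (isBigO_refl (fun s : ℝ => s) _).mul isBigO_id_one

namespace HasExpansion

variable {f g : ℝ → ℝ} {α β α' β' : ℝ}

theorem congr' (h : HasExpansion f α β) (e : f =ᶠ[𝓝[>] 0] g) : HasExpansion g α β :=
  IsBigO.congr' h (e.mono fun s hs => by simp only [hs]) EventuallyEq.rfl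

theorem const (α : ℝ) : HasExpansion (fun _ => α) α 0 := by
  simpa [HasExpansion] using isBigO_zero (E' := ℝ) (fun s : ℝ => s ^ 2) (𝓝[>] (0 : ℝ))

theorem id : HasExpansion (fun s => s) 0 1 := by
  simpa [HasExpansion] using isBigO_zero (E' := ℝ) (fun s : ℝ => s ^ 2) (𝓝[>] (0 : ℝ))

theorem add (hf : HasExpansion f α β) (hg : HasExpansion g α' β') :
    HasExpansion (fun s => f s + g s) (α + α') (β + β') := by
  refine (IsBigO.add hf hg).congr_left fun s => ?_
  ring

theorem sum {ι : Type*} (t : Finset ι) {f : ι → ℝ → ℝ} {α β : ι → ℝ}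
    (h : ∀ i ∈ t, HasExpansion (f i) (α i) (β i)) :
    HasExpansion (fun s => ∑ i ∈ t, f i s) (∑ i ∈ t, α i) (∑ i ∈ t, β i) := by
  refine (IsBigO.sum h).congr_left fun s => ?_
  rw [Finset.sum_apply, Finset.sum_sub_distrib, Finset.sum_sub_distrib, Finset.sum_mul]

theorem sub_isBigO_id (hf : HasExpansion f α β) :
    (fun s => f s - α) =O[𝓝[>] (0 : ℝ)] fun s => s := by
  refine ((IsBigO.trans hf isBigO_sq_id).add
    ((isBigO_refl (fun s : ℝ => s) _).const_mul_left β)).congr_left fun s => ?_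
  ring

theorem tendsto (hf : HasExpansion f α β) : Tendsto f (𝓝[>] 0) (𝓝 α) := by
  have := (hf.sub_isBigO_id.trans_tendsto tendsto_id_nhdsGT).add_const α
  simpa using this

theorem mul (hf : HasExpansion f α β) (hg : HasExpansion g α' β') :
    HasExpansion (fun s => f s * g s) (α * α') (α * β' + β * α') := by
  have h1 : (fun s => (f s - α - β * s) * g s) =O[𝓝[>] (0 : ℝ)] fun s => s ^ 2 := by
    simpa using IsBigO.mul hf (hg.tendsto.isBigO_one ℝ)
  have h2 : (fun s => (g s - α') * (β * s)) =O[𝓝[>] (0 : ℝ)] fun s => s ^ 2 := by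
    simpa [sq] using hg.sub_isBigO_id.mul ((isBigO_refl (fun s : ℝ => s) _).const_mul_left β)
  refine ((h1.add h2).add (IsBigO.const_mul_left hg α)).congr_left fun s => ?_
  ring

theorem inv (hf : HasExpansion f α β) (hα : α ≠ 0) :
    HasExpansion (fun s => (f s)⁻¹) α⁻¹ (-β / α ^ 2) := by
  have hne : ∀ᶠ s in 𝓝[>] (0 : ℝ), f s ≠ 0 := hf.tendsto.eventually_ne hα
  have h1 : (fun s => (f s - α) * (β * s)) =O[𝓝[>] (0 : ℝ)] fun s => s ^ 2 := by
    simpa [sq] using hf.sub_isBigO_id.mul ((isBigO_refl (fun s : ℝ => s) _).const_mul_left β)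
  have h2 := h1.sub (IsBigO.const_mul_left hf α)
  have h3 : (fun s => (α ^ 2 * f s)⁻¹) =O[𝓝[>] (0 : ℝ)] fun _ => (1 : ℝ) :=
    ((hf.tendsto.const_mul (α ^ 2)).inv₀ (mul_ne_zero (pow_ne_zero 2 hα) hα)).isBigO_one ℝ
  refine (h2.mul h3).congr' ?_ (Eventually.of_forall fun s => by simp)
  filter_upwards [hne] with s hs
  field_simp
  ring

theorem hasLaurentCoeffs {A₀ A₁ : ℝ} (h : HasExpansion (fun s => s ^ 3 * g s) (2 * A₀) A₁) :
    HasLaurentCoeffs g A₀ A₁ := by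
  have h3 := (isBigO_refl (fun s : ℝ => (s ^ 3)⁻¹) (𝓝[>] (0 : ℝ))).mul h
  refine h3.congr' ?_ ?_
  · filter_upwards [eventually_pos_nhdsGT] with s hs
    field_simp
  · filter_upwards [eventually_pos_nhdsGT] with s hs
    field_simp

end HasExpansion

theorem hasExpansion_one_sub_exp (a : ℝ) :
    HasExpansion (fun s => (1 - Real.exp (-s * a)) / s) a (-a ^ 2 / 2) := by
  have h := Real.exp_sub_sum_range_isBigO_pow 3
  have ht : Tendsto (fun s : ℝ => -s * a) (𝓝[>] 0) (𝓝 0) := by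
    simpa using tendsto_id_nhdsGT.neg.mul_const a
  have h1 := (h.comp_tendsto ht).mul (isBigO_refl (fun s : ℝ => s⁻¹) (𝓝[>] (0 : ℝ)))
  have h2 : (fun s : ℝ => ((fun x => x ^ 3) ∘ fun s => -s * a) s * s⁻¹)
      =O[𝓝[>] (0 : ℝ)] fun s => s ^ 2 := by
    refine ((isBigO_refl (fun s : ℝ => s ^ 2) (𝓝[>] (0 : ℝ))).const_mul_left (-a ^ 3)).congr' ?_
      EventuallyEq.rfl
    filter_upwards [eventually_pos_nhdsGT] with s hs
    simp only [Function.comp_apply]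
    field_simp
  refine ((h1.trans h2).neg_left).congr' ?_ EventuallyEq.rfl
  filter_upwards [eventually_pos_nhdsGT] with s hs
  simp only [Function.comp_apply, Finset.sum_range_succ, Finset.sum_range_zero, Nat.factorial]
  field_simp
  push_cast
  ring

/-- The expansion of the rescaled geometric series `s / (1 - exp (-s a))`. -/
theorem hasExpansion_geometric {a : ℝ} (ha : a ≠ 0) :
    HasExpansion (fun s => s * (1 - Real.exp (-s * a))⁻¹) a⁻¹ (1 / 2) := by
  have := ((hasExpansion_one_sub_exp a).inv ha).congr' (g := fun s => s * (1 - Real.exp (-s * a))⁻¹)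
    (Eventually.of_forall fun s => by simp [div_eq_mul_inv, mul_comm])
  convert this using 1
  field_simp

end Expansion

/-! ### Lattice sums -/

section Sums

theorem hasSum_mul_of_nonneg {ι κ : Type*} {f : ι → ℝ} {g : κ → ℝ} {a b : ℝ} (hf : HasSum f a)
    (hg : HasSum g b) (hf0 : ∀ i, 0 ≤ f i) (hg0 : ∀ i, 0 ≤ g i) :
    HasSum (fun p : ι × κ => f p.1 * g p.2) (a * b) :=
  hf.mul hg (hf.summable.mul_of_nonneg hg.summable hf0 hg0)

theorem hasSum_prod_fintype {ι κ : Type*} [Fintype ι] {f : ι → κ → ℝ} {a : ι → ℝ}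
    (hf : ∀ i, HasSum (f i) (a i)) (hf0 : ∀ i k, 0 ≤ f i k) :
    HasSum (fun p : ι × κ => f p.1 p.2) (∑ i, a i) := by
  have hs : Summable fun p : ι × κ => f p.1 p.2 :=
    (summable_prod_of_nonneg fun p => hf0 p.1 p.2).2
      ⟨fun i => (hf i).summable, (hasSum_fintype _).summable⟩
  have h := hs.hasSum.prod_fiberwise hf
  have h' := hs.hasSum
  rwa [h.unique (hasSum_fintype a)] at h'

theorem exp_neg_mul_lt_one {s q : ℝ} (hs : 0 < s) (hq : 0 < q) : Real.exp (-s * q) < 1 :=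
  Real.exp_lt_one_iff.2 (by rw [neg_mul, neg_lt_zero]; exact mul_pos hs hq)

theorem hasSum_exp_nsmul {s q : ℝ} (hs : 0 < s) (hq : 0 < q) :
    HasSum (fun n : ℕ => Real.exp (-s * (n * q))) (1 - Real.exp (-s * q))⁻¹ := by
  have e : (fun n : ℕ => Real.exp (-s * (n * q))) = fun n => Real.exp (-s * q) ^ n := by
    funext n
    rw [← Real.exp_nat_mul]
    ring_nf
  rw [e]
  exact hasSum_geometric_of_lt_one (Real.exp_pos _).le (exp_neg_mul_lt_one hs hq)

end Sums

/-! ### Splitting off the multiples of an element -/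

section Peel

variable {M : Type*} [AddCommMonoid M] (ht : M →+ ℕ) (h : M)

open Classical in
/-- The largest `n` such that `m = n h + m'` for some `m'` in the monoid; it is at most `ht m` if
`ht h ≠ 0`. -/
def peelCount (m : M) : ℕ := Nat.findGreatest (fun n => ∃ m', m = n • h + m') (ht m)

theorem exists_eq_peelCount (m : M) : ∃ m', m = peelCount ht h m • h + m' := by
  classical
  exact Nat.findGreatest_spec (P := fun n => ∃ m', m = n • h + m') (Nat.zero_le _)
    ⟨m, by rw [zero_nsmul, zero_add]⟩

variable {ht h} (hh : ht h ≠ 0)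
include hh

/-- Since `ht h ≥ 1`, the cutoff `ht` in the definition of `peelCount` is never smaller than an
attainable multiple. -/
theorem le_peelCount (n : ℕ) (m : M) : n ≤ peelCount ht h (n • h + m) := by
  classical
  refine Nat.le_findGreatest ?_ ⟨m, rfl⟩
  rw [map_add, map_nsmul, smul_eq_mul]
  exact le_add_right (Nat.le_mul_of_pos_right n (Nat.pos_of_ne_zero hh))

variable [IsCancelAdd M]

theorem peelCount_nsmul_add (n : ℕ) (m : M) :
    peelCount ht h (n • h + m) = n + peelCount ht h m := by
  apply le_antisymm
  · obtain ⟨m', hm'⟩ := exists_eq_peelCount ht h (n • h + m)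
    obtain ⟨k, hk⟩ := Nat.exists_eq_add_of_le (le_peelCount hh n m)
    rw [hk, add_nsmul, add_assoc] at hm'
    have := le_peelCount hh k m'
    rw [← add_left_cancel hm'] at this
    omega
  · obtain ⟨m', hm'⟩ := exists_eq_peelCount ht h m
    have := le_peelCount hh (n + peelCount ht h m) m'
    rwa [add_nsmul, add_assoc, ← hm'] at this

/-- Every element is uniquely a multiple of `h` plus an element from which `h` cannot be split
off. -/
theorem peel_bijective :
    Function.Bijective fun p : ℕ × {m : M // peelCount ht h m = 0} => p.1 • h + p.2.1 := by
  constructor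
  · rintro ⟨n, m, hm⟩ ⟨n', m', hm'⟩ e
    simp only at e
    have := congrArg (peelCount ht h) e
    rw [peelCount_nsmul_add hh, peelCount_nsmul_add hh, hm, hm', add_zero, add_zero] at this
    subst this
    have := add_left_cancel e
    subst this
    rfl
  · intro m
    obtain ⟨m', hm'⟩ := exists_eq_peelCount ht h m
    refine ⟨(peelCount ht h m, ⟨m', ?_⟩), hm'.symm⟩
    have := peelCount_nsmul_add hh (peelCount ht h m) m'
    rw [← hm'] at this
    omega

variable {ℓ : M →+ ℝ} {s G : ℝ} (hs : 0 < s) (hG : HasSum (fun m => Real.exp (-s * ℓ m)) G)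
include hs hG

/-- By `peel_bijective` the series `G` is the geometric series of `h` times the sum over elements
from which `h` cannot be split off; dividing gives the latter. -/
theorem hasSum_peel (hq : 0 < ℓ h) :
    HasSum (fun m : {m : M // peelCount ht h m = 0} => Real.exp (-s * ℓ m.1))
      (G * (1 - Real.exp (-s * ℓ h))) := by
  have h1 : Summable fun m : {m : M // peelCount ht h m = 0} => Real.exp (-s * ℓ m.1) :=
    hG.summable.comp_injective Subtype.val_injective
  have h2 := hasSum_mul_of_nonneg (hasSum_exp_nsmul hs hq) h1.hasSum
    (fun _ => (Real.exp_pos _).le) (fun _ => (Real.exp_pos _).le)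
  have h3 := (Equiv.ofBijective _ (peel_bijective hh)).hasSum_iff.2 hG
  have e : ((fun m => Real.exp (-s * ℓ m)) ∘ Equiv.ofBijective _ (peel_bijective hh)) =
      fun p : ℕ × {m : M // peelCount ht h m = 0} =>
        Real.exp (-s * (p.1 * ℓ h)) * Real.exp (-s * ℓ p.2.1) := by
    funext p
    simp only [Function.comp_apply, Equiv.ofBijective_apply]
    rw [← Real.exp_add, map_add, map_nsmul, nsmul_eq_mul]
    ring_nf
  rw [e] at h3
  have h4 := h2.unique h3
  have h5 : 1 - Real.exp (-s * ℓ h) ≠ 0 := (sub_pos.2 (exp_neg_mul_lt_one hs hq)).ne'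
  rw [← h4, mul_comm, mul_inv_cancel_left₀ h5]
  exact h1.hasSum

/-- Only the geometric series of `h` feels the shift by `ε`, so its ratio is exchanged while the
other factor stays. -/
theorem hasSum_add_peelCount (hq : 0 < ℓ h) {ε : ℝ} (hε : 0 < ℓ h + ε) :
    HasSum (fun m : M => Real.exp (-s * (ℓ m + ε * peelCount ht h m)))
      (G * (1 - Real.exp (-s * ℓ h)) * (1 - Real.exp (-s * (ℓ h + ε)))⁻¹) := by
  have h2 := hasSum_mul_of_nonneg (hasSum_exp_nsmul hs hε) (hasSum_peel hh hs hG hq)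
    (fun _ => (Real.exp_pos _).le) (fun _ => (Real.exp_pos _).le)
  rw [mul_comm] at h2
  refine (Equiv.ofBijective _ (peel_bijective hh)).hasSum_iff.1 ?_
  convert h2 using 1
  funext p
  simp only [Function.comp_apply, Equiv.ofBijective_apply]
  rw [← Real.exp_add, map_add, map_nsmul, nsmul_eq_mul, peelCount_nsmul_add hh, p.2.2, add_zero]
  ring_nf

end Peel

/-! ### The fan over the boundary of a reflexive polygon -/

section Fan

/-- The determinant of two lattice vectors. -/
def det2 (w x : Fin 2 → ℤ) : ℤ := w 0 * x 1 - w 1 * x 0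

/-- The vertex of the dual polygon which is dual to the edge from `w` to `x`, if `det2 w x = 1`. -/
def edgeDual (w x : Fin 2 → ℤ) : Fin 2 → ℤ := ![w 1 - x 1, x 0 - w 0]

/-- `Γ` is the set of nonzero lattice points of the polar dual of the reflexive polygon with vertex
set `V`, and `σ` maps each of them to the next one in counterclockwise order. -/
structure IsFan (V Γ : Finset (Fin 2 → ℤ)) (σ : (Fin 2 → ℤ) → Fin 2 → ℤ) : Prop where
  mem_iff : ∀ w, w ∈ Γ ↔ w ≠ 0 ∧ ∀ v ∈ V, -1 ≤ w ⬝ᵥ v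
  succ_mem : ∀ w ∈ Γ, σ w ∈ Γ
  det_succ : ∀ w ∈ Γ, det2 w (σ w) = 1
  edgeDual_mem : ∀ w ∈ Γ, edgeDual w (σ w) ∈ V
  exists_edge : ∀ v ∈ V, ∃ w ∈ Γ, v = edgeDual w (σ w)
  cover : ∀ u, u ≠ 0 → ∃ w ∈ Γ, ∃ a b : ℕ, u = (a + 1) • w + b • σ w

theorem dotProduct_edgeDual_left (w x : Fin 2 → ℤ) : w ⬝ᵥ edgeDual w x = -det2 w x := by
  simp [edgeDual, det2, dotProduct, Fin.sum_univ_two]; ring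

theorem dotProduct_edgeDual_right (w x : Fin 2 → ℤ) : x ⬝ᵥ edgeDual w x = -det2 w x := by
  simp [edgeDual, det2, dotProduct, Fin.sum_univ_two]; ring

namespace IsFan

variable {V Γ : Finset (Fin 2 → ℤ)} {σ : (Fin 2 → ℤ) → Fin 2 → ℤ} (F : IsFan V Γ σ)
include F

theorem le {w v : Fin 2 → ℤ} (hw : w ∈ Γ) (hv : v ∈ V) : -1 ≤ w ⬝ᵥ v := ((F.mem_iff w).1 hw).2 v hv

theorem tight {w : Fin 2 → ℤ} (hw : w ∈ Γ) :
    w ⬝ᵥ edgeDual w (σ w) = -1 ∧ σ w ⬝ᵥ edgeDual w (σ w) = -1 := by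
  rw [dotProduct_edgeDual_left, dotProduct_edgeDual_right, F.det_succ w hw]
  exact ⟨rfl, rfl⟩

/-- Pairing with the dual vector of an edge is at least `-1` on `Γ` and equals `-1` at both ends of
that edge. Comparing the two representations gives `a + b = a' + b'`, and then `w'` must lie on the
line of the edge at `w`. -/
theorem unique_cone {w w' : Fin 2 → ℤ} (hw : w ∈ Γ) (hw' : w' ∈ Γ) {a b a' b' : ℕ}
    (h : (a + 1) • w + b • σ w = (a' + 1) • w' + b' • σ w') : w = w' ∧ a = a' ∧ b = b' := by
  have hle : ∀ {w w' : Fin 2 → ℤ}, w ∈ Γ → w' ∈ Γ → ∀ {a b a' b' : ℕ},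
      (a + 1) • w + b • σ w = (a' + 1) • w' + b' • σ w' → a + b ≤ a' + b' := by
    intro w w' hw hw' a b a' b' h
    have l1 := F.le hw' (F.edgeDual_mem w hw)
    have l2 := F.le (F.succ_mem w' hw') (F.edgeDual_mem w hw)
    have h2 := congrArg (· ⬝ᵥ edgeDual w (σ w)) h
    simp only [add_dotProduct, smul_dotProduct, (F.tight hw).1, (F.tight hw).2] at h2
    simp only [nsmul_eq_mul] at h2
    push_cast at h2
    zify
    nlinarith
  have hab : a + b = a' + b' := le_antisymm (hle hw hw' h) (hle hw' hw h.symm)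
  have l1 := F.le hw' (F.edgeDual_mem w hw)
  have l2 := F.le (F.succ_mem w' hw') (F.edgeDual_mem w hw)
  have h2 := congrArg (· ⬝ᵥ edgeDual w (σ w)) h
  simp only [add_dotProduct, smul_dotProduct, (F.tight hw).1, (F.tight hw).2] at h2
  simp only [nsmul_eq_mul] at h2
  push_cast at h2
  have hab' : (a : ℤ) + b = a' + b' := by exact_mod_cast hab
  have hP : w' ⬝ᵥ edgeDual w (σ w) = -1 := by nlinarith
  have hR : b' = 0 ∨ σ w' ⬝ᵥ edgeDual w (σ w) = -1 := by
    rw [hP] at h2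
    have : (b' : ℤ) * (σ w' ⬝ᵥ edgeDual w (σ w) + 1) = 0 := by linarith
    rcases mul_eq_zero.1 this with h | h
    · left; exact_mod_cast h
    · right; linarith
  have d1 := F.det_succ w hw
  have d2 := F.det_succ w' hw'
  have h0 := congrFun h 0
  have h1 := congrFun h 1
  simp only [edgeDual, det2, dotProduct, Fin.sum_univ_two, Pi.add_apply, Pi.smul_apply,
    Matrix.cons_val_zero, Matrix.cons_val_one] at hP hR d1 d2 h0 h1
  simp only [nsmul_eq_mul, Nat.cast_add, Nat.cast_one] at h0 h1
  -- `τ = det2 w w'` is the position of `w'` on the line through `w` and `σ w`. Comparing `b` with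
  -- `b'` and using `a + b = a' + b'` leaves only `τ = 0`; the summand `+ 1` making the cones
  -- half-open is what excludes `τ = ±1`.
  set τ := w 0 * w' 1 - w 1 * w' 0 with hτ
  have e0 : w' 0 = (1 - τ) * w 0 + τ * σ w 0 := by linear_combination -w' 0 * d1 - w 0 * hP
  have e1 : w' 1 = (1 - τ) * w 1 + τ * σ w 1 := by linear_combination -w' 1 * d1 - w 1 * hP
  have hb : (b : ℤ) = (a' + 1) * τ + b' * (τ + 1) := by
    have hb1 : (b : ℤ) = (a' + 1) * τ + b' * (w 0 * σ w' 1 - w 1 * σ w' 0) := by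
      linear_combination (-b : ℤ) * d1 + w 0 * h1 - w 1 * h0
    rcases hR with h | h
    · simpa [h] using hb1
    · rw [hb1]
      linear_combination (b' : ℤ) * (d2 - σ w' 1 * e0 + σ w' 0 * e1 - τ * h)
  have hτ1 : τ < 1 := by
    by_contra hc
    push Not at hc
    nlinarith
  have hτ2 : -1 < τ := by
    by_contra hc
    push Not at hc
    nlinarith
  have hτ0 : τ = 0 := by omega
  rw [hτ0] at e0 e1 hb
  refine ⟨?_, ?_, ?_⟩
  · ext i
    fin_cases i
    · simp [e0]
    · simp [e1]
  · zify; linarith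
  · zify; linarith

end IsFan
end Fan

/-! ### The lattice points of the dual cone -/

section Cone

/-- The weight of a lattice point of the dual cone, if the GLSM field `p_v` has weight `b v`. -/
def weightHom (V : Finset (Fin 2 → ℤ)) (b : V → ℝ) : dualMonoid V →+ ℝ where
  toFun m := ∑ v : V, b v * ((m.1 ⬝ᵥ ray v.1 : ℤ) : ℝ)
  map_zero' := by simp
  map_add' x y := by
    simp [add_dotProduct, mul_add, Finset.sum_add_distrib]

/-- The degree of a lattice point of the dual cone in the GLSM fields. -/
def degreeHom (V : Finset (Fin 2 → ℤ)) : dualMonoid V →+ ℕ where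
  toFun m := ∑ v : V, (m.1 ⬝ᵥ ray v.1).toNat
  map_zero' := by simp
  map_add' x y := by
    rw [← Finset.sum_add_distrib]
    refine Finset.sum_congr rfl fun v _ => ?_
    rw [AddSubmonoid.coe_add, add_dotProduct, Int.toNat_add (x.2 v.1 v.2) (y.2 v.1 v.2)]

/-- The weight of the lattice point `(w, 1)`. -/
def pointWeight (V : Finset (Fin 2 → ℤ)) (b : V → ℝ) (w : Fin 2 → ℤ) : ℝ :=
  ∑ v : V, b v * ((w ⬝ᵥ v.1 + 1 : ℤ) : ℝ)

theorem ray_dotProduct_ray (w v : Fin 2 → ℤ) : ray w ⬝ᵥ ray v = w ⬝ᵥ v + 1 := by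
  simp [ray, dotProduct, Fin.sum_univ_three, Fin.sum_univ_two]

namespace IsFan

variable {V Γ : Finset (Fin 2 → ℤ)} {σ : (Fin 2 → ℤ) → Fin 2 → ℤ} (F : IsFan V Γ σ)
include F

theorem neg_one_le {w : Fin 2 → ℤ} (hw : w ∈ insert 0 Γ) : ∀ v ∈ V, -1 ≤ w ⬝ᵥ v := by
  intro v hv
  rcases Finset.mem_insert.1 hw with rfl | hw
  · simp
  · exact F.le hw hv

/-- The lattice point `(w, 1)` of the dual cone. -/
def point (w : (insert 0 Γ : Finset (Fin 2 → ℤ))) : dualMonoid V :=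
  ⟨ray w.1, fun v hv => by
    have := F.neg_one_le w.2 v hv
    rw [ray_dotProduct_ray]
    linarith⟩

omit F in
/-- The origin as a lattice point of the dual polygon. -/
def orig : (insert 0 Γ : Finset (Fin 2 → ℤ)) := ⟨0, Finset.mem_insert_self _ _⟩

omit F in
/-- A boundary lattice point as a lattice point of the dual polygon. -/
def bdry (w : Γ) : (insert 0 Γ : Finset (Fin 2 → ℤ)) := ⟨w.1, Finset.mem_insert_of_mem w.2⟩

/-- The next boundary lattice point. -/
def next (w : Γ) : Γ := ⟨σ w.1, F.succ_mem w.1 w.2⟩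

theorem weightHom_point (b : V → ℝ) (w : (insert 0 Γ : Finset (Fin 2 → ℤ))) :
    weightHom V b (F.point w) = pointWeight V b w.1 := by
  refine Finset.sum_congr rfl fun v _ => ?_
  change b v * ((ray w.1 ⬝ᵥ ray v.1 : ℤ) : ℝ) = _
  rw [ray_dotProduct_ray]

/-- The decomposition of the dual cone into half-open unimodular cones. -/
def coneMap (p : (Unit ⊕ Γ × (ℕ × ℕ)) × ℕ) : dualMonoid V :=
  Sum.elim (fun _ => 0)
    (fun t => (t.2.1 + 1) • F.point (bdry t.1) + t.2.2 • F.point (bdry (F.next t.1))) p.1 +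
    p.2 • F.point orig

omit F in
theorem ray_castSucc (w : Fin 2 → ℤ) (i : Fin 2) : ray w i.castSucc = w i := by
  fin_cases i <;> rfl

omit F in
theorem ray_two (w : Fin 2 → ℤ) : ray w 2 = 1 := rfl

theorem coneMap_inl (c : ℕ) : F.coneMap (Sum.inl (), c) = c • F.point orig := by
  simp [coneMap]

theorem coneMap_inr (w : Γ) (a b c : ℕ) : F.coneMap (Sum.inr (w, a, b), c) =
    (a + 1) • F.point (bdry w) + b • F.point (bdry (F.next w)) + c • F.point orig := rfl

theorem coneMap_inl_castSucc (c : ℕ) (i : Fin 2) :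
    (F.coneMap (Sum.inl (), c)).1 i.castSucc = 0 := by
  rw [coneMap_inl]
  simp [point, orig, ray_castSucc]

theorem coneMap_inr_castSucc (w : Γ) (a b c : ℕ) (i : Fin 2) :
    (F.coneMap (Sum.inr (w, a, b), c)).1 i.castSucc = ((a + 1) • w.1 + b • σ w.1) i := by
  rw [coneMap_inr]
  simp [point, orig, bdry, next, ray_castSucc]

theorem coneMap_inl_two (c : ℕ) : (F.coneMap (Sum.inl (), c)).1 2 = c := by
  rw [coneMap_inl]
  simp [point, orig, ray_two]

theorem coneMap_inr_two (w : Γ) (a b c : ℕ) :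
    (F.coneMap (Sum.inr (w, a, b), c)).1 2 = a + 1 + b + c := by
  rw [coneMap_inr]
  simp [point, orig, bdry, next, ray_two]

theorem cone_dotProduct {w : Fin 2 → ℤ} (hw : w ∈ Γ) (a b : ℕ) :
    ((a + 1) • w + b • σ w) ⬝ᵥ edgeDual w (σ w) = -(a + 1 + b) := by
  rw [add_dotProduct, smul_dotProduct, smul_dotProduct, (F.tight hw).1, (F.tight hw).2]
  simp only [nsmul_eq_mul]
  push_cast
  ring

theorem cone_ne_zero {w : Fin 2 → ℤ} (hw : w ∈ Γ) (a b : ℕ) : (a + 1) • w + b • σ w ≠ 0 := by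
  intro h
  have := F.cone_dotProduct hw a b
  rw [h, zero_dotProduct] at this
  omega

theorem exists_one_le_dotProduct {u : Fin 2 → ℤ} (hu : u ≠ 0) : ∃ v ∈ V, 1 ≤ u ⬝ᵥ v := by
  obtain ⟨w, hw, a, b, h⟩ := F.cover (-u) (neg_ne_zero.2 hu)
  refine ⟨_, F.edgeDual_mem w hw, ?_⟩
  have := F.cone_dotProduct hw a b
  rw [← h, neg_dotProduct] at this
  omega

theorem coneMap_injective : Function.Injective F.coneMap := by
  rintro ⟨p, c⟩ ⟨p', c'⟩ h
  have h0 := fun i : Fin 2 => congrFun (congrArg Subtype.val h) i.castSucc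
  have h2 := congrFun (congrArg Subtype.val h) 2
  rcases p with ⟨⟩ | ⟨w, a, b⟩ <;> rcases p' with ⟨⟩ | ⟨w', a', b'⟩
  · rw [coneMap_inl_two, coneMap_inl_two] at h2
    have : c = c' := by exact_mod_cast h2
    rw [this]
  · exfalso
    refine F.cone_ne_zero w'.2 a' b' (funext fun i => ?_)
    rw [← F.coneMap_inr_castSucc w' a' b' c', ← h0 i, coneMap_inl_castSucc]
    rfl
  · exfalso
    refine F.cone_ne_zero w.2 a b (funext fun i => ?_)
    rw [← F.coneMap_inr_castSucc w a b c, h0 i, coneMap_inl_castSucc]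
    rfl
  · have h3 : (a + 1) • w.1 + b • σ w.1 = (a' + 1) • w'.1 + b' • σ w'.1 := funext fun i => by
      rw [← F.coneMap_inr_castSucc w a b c, h0 i, coneMap_inr_castSucc]
    obtain ⟨e, rfl, rfl⟩ := F.unique_cone w.2 w'.2 h3
    obtain rfl := Subtype.ext e
    rw [coneMap_inr_two, coneMap_inr_two] at h2
    have : c = c' := by omega
    rw [this]

theorem coneMap_surjective : Function.Surjective F.coneMap := by
  intro m
  have ext : ∀ x : dualMonoid V, (∀ i : Fin 2, x.1 i.castSucc = m.1 i.castSucc) →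
      x.1 2 = m.1 2 → x = m := by
    intro x h h2
    refine Subtype.ext (funext fun i => ?_)
    fin_cases i
    · exact h 0
    · exact h 1
    · exact h2
  have hdot : ∀ v, m.1 ⬝ᵥ ray v = (fun i : Fin 2 => m.1 i.castSucc) ⬝ᵥ v + m.1 2 := by
    intro v
    simp [ray, dotProduct, Fin.sum_univ_three, Fin.sum_univ_two]
  by_cases hu : (fun i : Fin 2 => m.1 i.castSucc) = 0
  · obtain ⟨v, hv, -⟩ := F.exists_one_le_dotProduct (u := ![1, 0]) (by
      intro h; simpa using congrFun h 0)
    have hm := m.2 v hv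
    rw [hdot, hu, zero_dotProduct, zero_add] at hm
    obtain ⟨c, hc⟩ := Int.eq_ofNat_of_zero_le hm
    refine ⟨(Sum.inl (), c), ext _ (fun i => ?_) ?_⟩
    · rw [coneMap_inl_castSucc]; exact (congrFun hu i).symm
    · rw [coneMap_inl_two, hc]
  · obtain ⟨w, hw, a, b, h⟩ := F.cover _ hu
    have hm := m.2 _ (F.edgeDual_mem w hw)
    rw [hdot, h, F.cone_dotProduct hw] at hm
    obtain ⟨c, hc⟩ := Int.eq_ofNat_of_zero_le hm
    refine ⟨(Sum.inr (⟨w, hw⟩, a, b), c), ext _ (fun i => ?_) ?_⟩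
    · rw [coneMap_inr_castSucc]; exact (congrFun h i).symm
    · rw [coneMap_inr_two]; linarith

theorem coneMap_bijective : Function.Bijective F.coneMap :=
  ⟨F.coneMap_injective, F.coneMap_surjective⟩

/-- The generating function of the lattice points of the dual cone. -/
theorem hasSum_cone (b : V → ℝ) (hb : ∀ w ∈ insert 0 Γ, 0 < pointWeight V b w) {s : ℝ}
    (hs : 0 < s) :
    HasSum (fun m : dualMonoid V => Real.exp (-s * weightHom V b m))
      ((1 + ∑ w : Γ, Real.exp (-s * pointWeight V b w) *
        ((1 - Real.exp (-s * pointWeight V b w))⁻¹ *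
          (1 - Real.exp (-s * pointWeight V b (σ w)))⁻¹)) *
        (1 - Real.exp (-s * pointWeight V b 0))⁻¹) := by
  refine (Equiv.ofBijective _ F.coneMap_bijective).hasSum_iff.1 ?_
  have hq : ∀ w : Γ, 0 < pointWeight V b w := fun w => hb w (Finset.mem_insert_of_mem w.2)
  have h1 : ∀ w : Γ, HasSum (fun t : ℕ × ℕ => Real.exp (-s * pointWeight V b w) *
      (Real.exp (-s * (t.1 * pointWeight V b w)) * Real.exp (-s * (t.2 * pointWeight V b (σ w)))))
      (Real.exp (-s * pointWeight V b w) * ((1 - Real.exp (-s * pointWeight V b w))⁻¹ *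
          (1 - Real.exp (-s * pointWeight V b (σ w)))⁻¹)) := fun w =>
    (hasSum_mul_of_nonneg (hasSum_exp_nsmul hs (hq w)) (hasSum_exp_nsmul hs (hq (F.next w)))
      (fun _ => (Real.exp_pos _).le) (fun _ => (Real.exp_pos _).le)).mul_left _
  have h2 := hasSum_prod_fintype h1 (fun w t => by positivity)
  set f : Unit ⊕ Γ × (ℕ × ℕ) → ℝ := Sum.elim (fun _ => 1) fun p =>
    Real.exp (-s * pointWeight V b p.1) * (Real.exp (-s * (p.2.1 * pointWeight V b p.1)) *
      Real.exp (-s * (p.2.2 * pointWeight V b (σ p.1)))) with hf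
  have h3 : HasSum f _ := HasSum.sum (f := f) (a := 1) (hasSum_unique _) h2
  have hf0 : ∀ i, 0 ≤ f i := by
    rintro (_ | ⟨w, t⟩) <;> simp only [hf, Sum.elim_inl, Sum.elim_inr] <;> positivity
  have h4 := hasSum_mul_of_nonneg h3 (hasSum_exp_nsmul hs (hb 0 (Finset.mem_insert_self _ _)))
    hf0 (fun _ => (Real.exp_pos _).le)
  convert h4 using 1
  funext ⟨p, c⟩
  simp only [Function.comp_apply, Equiv.ofBijective_apply]
  rcases p with ⟨⟩ | ⟨w, a, k⟩
  · rw [coneMap_inl, map_nsmul, weightHom_point]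
    simp [hf, orig]
  · rw [coneMap_inr, map_add, map_add, map_nsmul, map_nsmul, map_nsmul, weightHom_point,
      weightHom_point, weightHom_point]
    simp only [hf, Sum.elim_inr, orig, bdry, next, nsmul_eq_mul, ← Real.exp_add]
    push_cast
    ring_nf

theorem one_le_apply_two {m : dualMonoid V} (hm : m ≠ 0) : 1 ≤ m.1 2 := by
  obtain ⟨⟨p, c⟩, rfl⟩ := F.coneMap_surjective m
  rcases p with ⟨⟩ | ⟨w, a, b⟩
  · rw [coneMap_inl_two]
    rcases Nat.eq_zero_or_pos c with rfl | hc
    · rw [coneMap_inl, zero_nsmul] at hm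
      exact absurd rfl hm
    · exact_mod_cast hc
  · rw [coneMap_inr_two]
    omega

theorem point_ne_zero (w : (insert 0 Γ : Finset (Fin 2 → ℤ))) : F.point w ≠ 0 := by
  intro h
  have := congrFun (congrArg Subtype.val h) 2
  simp [point, ray_two] at this

/-- A lattice point of the dual polygon as a generator of the coordinate ring. -/
def pointGenerator (w : (insert 0 Γ : Finset (Fin 2 → ℤ))) : Generator V :=
  ⟨F.point w, F.point_ne_zero w, fun a b h => by
    by_contra hc
    push Not at hc
    have h1 := F.one_le_apply_two hc.1
    have h2 := F.one_le_apply_two hc.2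
    have := congrFun (congrArg Subtype.val h) 2
    simp only [point, ray_two, AddSubmonoid.coe_add, Pi.add_apply] at this
    omega⟩

/-- The cone decomposition splits a point `(w, 1)` off every nonzero element, and indecomposability
makes the remainder vanish. -/
theorem exists_eq_point (h : Generator V) :
    ∃ w : (insert 0 Γ : Finset (Fin 2 → ℤ)), h.1 = F.point w := by
  obtain ⟨⟨p, c⟩, hp⟩ := F.coneMap_surjective h.1
  have key : ∃ w m, h.1 = F.point w + m := by
    rcases p with ⟨⟩ | ⟨w, a, b⟩
    · rw [coneMap_inl] at hp
      cases c with
      | zero => exact absurd (by rw [← hp, zero_nsmul]) h.2.1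
      | succ c => exact ⟨orig, c • F.point orig, by rw [← hp, succ_nsmul']⟩
    · refine ⟨bdry w, a • F.point (bdry w) + (b • F.point (bdry (F.next w)) + c • F.point orig), ?_⟩
      rw [← hp, coneMap_inr, succ_nsmul']
      simp only [add_assoc]
  obtain ⟨w, m, hm⟩ := key
  refine ⟨w, ?_⟩
  rcases h.2.2 _ _ hm with h0 | h0
  · exact absurd h0 (F.point_ne_zero w)
  · rw [hm, h0, add_zero]

theorem exists_weight_eq (m : dualMonoid V) :
    ∃ α : Generator V →₀ ℕ, Finsupp.weight (fun h : Generator V => h.1) α = m := by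
  have hp : ∀ w, F.point w ∈
      AddMonoidHom.mrange (Finsupp.weight (R := ℕ) (fun h : Generator V => h.1)) := by
    intro w
    refine ⟨Finsupp.single (F.pointGenerator w) 1, ?_⟩
    rw [Finsupp.weight_single, one_nsmul]
    rfl
  have : m ∈ AddMonoidHom.mrange (Finsupp.weight (R := ℕ) (fun h : Generator V => h.1)) := by
    obtain ⟨⟨p, c⟩, rfl⟩ := F.coneMap_surjective m
    rcases p with ⟨⟩ | ⟨w, a, b⟩
    · rw [coneMap_inl]
      exact nsmul_mem (hp _) _
    · rw [coneMap_inr]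
      exact add_mem (add_mem (nsmul_mem (hp _) _) (nsmul_mem (hp _) _)) (nsmul_mem (hp _) _)
  exact this

/-- This makes `degreeHom` a legitimate cutoff for `peelCount`. -/
theorem degreeHom_ne_zero {m : dualMonoid V} (hm : m ≠ 0) : degreeHom V m ≠ 0 := by
  intro h0
  have h1 : ∀ v ∈ V, m.1 ⬝ᵥ ray v = 0 := by
    intro v hv
    have := (Finset.sum_eq_zero_iff.1 h0) ⟨v, hv⟩ (Finset.mem_univ _)
    have h2 := m.2 v hv
    simp only at this
    omega
  obtain ⟨⟨p, c⟩, rfl⟩ := F.coneMap_surjective m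
  have hdot : ∀ v, (F.coneMap (p, c)).1 ⬝ᵥ ray v =
      (fun i : Fin 2 => (F.coneMap (p, c)).1 i.castSucc) ⬝ᵥ v + (F.coneMap (p, c)).1 2 := by
    intro v
    simp [ray, dotProduct, Fin.sum_univ_three, Fin.sum_univ_two]
  have h2 := F.one_le_apply_two hm
  by_cases hu : (fun i : Fin 2 => (F.coneMap (p, c)).1 i.castSucc) = 0
  · obtain ⟨v, hv, -⟩ := F.exists_one_le_dotProduct (u := ![1, 0]) (by
      intro h; simpa using congrFun h 0)
    have := h1 v hv
    rw [hdot, hu, zero_dotProduct] at this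
    omega
  · obtain ⟨v, hv, h3⟩ := F.exists_one_le_dotProduct hu
    have := h1 v hv
    rw [hdot] at this
    omega

end IsFan

end Cone

/-! ### Hilbert series of the cone and of the central fibres -/

section Hilbert

open MvPolynomial

variable {V Γ : Finset (Fin 2 → ℤ)} {σ : (Fin 2 → ℤ) → Fin 2 → ℤ}

theorem weightHom_weight (b : V → ℝ) (α : Generator V →₀ ℕ) :
    weightHom V b (Finsupp.weight (fun h : Generator V => h.1) α) =
      Finsupp.weight (glsmWeight V b) α := by
  rw [Finsupp.weight_apply, Finsupp.weight_apply, map_finsuppSum]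
  simp only [map_nsmul]
  rfl

theorem aeval_eq_gradedMap (f : MvPolynomial (Generator V) ℂ) :
    (MvPolynomial.aeval (R := ℂ) (fun h : Generator V =>
      (AddMonoidAlgebra.single h.1 1 : AddMonoidAlgebra ℂ (dualMonoid V))) f).coeff =
      gradedMap (fun h : Generator V => h.1) 0 0 f := by
  induction f using induction_on' with
  | add p q hp hq => rw [map_add, map_add, ← hp, ← hq, AddMonoidAlgebra.coeff_add]
  | monomial α c =>
    have h0 : Finsupp.weight (0 : Generator V → ℕ) α =
        (0 : dualMonoid V → ℕ) (Finsupp.weight (fun h : Generator V => h.1) α) := by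
      simp [Finsupp.weight_apply]
    rw [gradedMap_monomial, if_pos h0, aeval_monomial]
    have h1 : (α.prod fun i k =>
        (AddMonoidAlgebra.single i.1 1 : AddMonoidAlgebra ℂ (dualMonoid V)) ^ k) =
        AddMonoidAlgebra.single (Finsupp.weight (fun h : Generator V => h.1) α) 1 := by
      have h2 : ∀ m : dualMonoid V, (AddMonoidAlgebra.single m 1 : AddMonoidAlgebra ℂ _) =
          AddMonoidAlgebra.of ℂ (dualMonoid V) (Multiplicative.ofAdd m) := fun m => rfl
      simp only [h2, ← map_pow, Finsupp.prod, ← map_prod, ← ofAdd_nsmul, ← ofAdd_sum]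
      rfl
    rw [h1]
    simp [AddMonoidAlgebra.coe_algebraMap, AddMonoidAlgebra.single_mul_single]

theorem mem_toricIdeal_iff (f : MvPolynomial (Generator V) ℂ) :
    f ∈ toricIdeal V ↔ gradedMap (fun h : Generator V => h.1) 0 0 f = 0 := by
  rw [← aeval_eq_gradedMap, toricIdeal, RingHom.mem_ker]
  exact (AddMonoidAlgebra.coeff_eq_zero).symm

theorem weight_testSymmetry {ι : Type} (h : ι) (α : ι →₀ ℕ) :
    Finsupp.weight (testSymmetry h) α = α h := by
  classical
  rw [Finsupp.weight_apply, Finsupp.sum]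
  simp only [testSymmetry, Pi.single_apply, smul_eq_mul, mul_ite, mul_one, mul_zero]
  rw [Finset.sum_ite_eq']
  split_ifs with h1
  · rfl
  · exact (Finsupp.notMem_support_iff.1 h1).symm

/-- The generating function of the lattice points of the dual cone, as a rational function of the
variables `exp (-s q)`. -/
def coneSeries (V Γ : Finset (Fin 2 → ℤ)) (σ : (Fin 2 → ℤ) → Fin 2 → ℤ) (b : V → ℝ) (s : ℝ) : ℝ :=
  (1 + ∑ w : Γ, Real.exp (-s * pointWeight V b w) *
    ((1 - Real.exp (-s * pointWeight V b w))⁻¹ *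
      (1 - Real.exp (-s * pointWeight V b (σ w)))⁻¹)) *
    (1 - Real.exp (-s * pointWeight V b 0))⁻¹

namespace IsFan

variable (F : IsFan V Γ σ)
include F

theorem hilbertSeries_toric {b : V → ℝ} (hb : ∀ w ∈ insert 0 Γ, 0 < pointWeight V b w) {s : ℝ}
    (hs : 0 < s) : hilbertSeries (toricIdeal V) (glsmWeight V b) s = coneSeries V Γ σ b s := by
  classical
  have hsum := F.hasSum_cone b hb hs
  rw [hilbertSeries_eq_tsum (gradedMap (fun h : Generator V => h.1) 0 0) mem_toricIdeal_iff
    (weightHom V b) ?_ ?_ hsum.summable, hsum.tsum_eq, coneSeries]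
  · intro α
    rw [gradedMap_monomial]
    split_ifs
    · exact Or.inr ⟨_, rfl, weightHom_weight b α⟩
    · exact Or.inl rfl
  · intro m
    obtain ⟨α, rfl⟩ := F.exists_weight_eq m
    refine ⟨α, ?_, weightHom_weight b α⟩
    rw [gradedMap_monomial, if_pos]
    simp [Finsupp.weight_apply]

/-- With `exists_weight_eq_peelCount`, this identifies `peelCount` as the maximal exponent of `x_h`
among the monomials of a given multidegree, as `mem_initialIdeal_iff` requires. -/
theorem weight_testSymmetry_le (h : Generator V) (α : Generator V →₀ ℕ) :
    Finsupp.weight (testSymmetry h) α ≤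
      peelCount (degreeHom V) h.1 (Finsupp.weight (fun h : Generator V => h.1) α) := by
  classical
  rw [weight_testSymmetry]
  conv_rhs => rw [← Finsupp.single_add_erase h α, map_add, Finsupp.weight_single]
  exact le_peelCount (F.degreeHom_ne_zero h.2.1) _ _

theorem exists_weight_eq_peelCount (h : Generator V) (m : dualMonoid V) :
    ∃ α : Generator V →₀ ℕ, Finsupp.weight (fun h : Generator V => h.1) α = m ∧
      Finsupp.weight (testSymmetry h) α = peelCount (degreeHom V) h.1 m := by
  obtain ⟨m', hm'⟩ := exists_eq_peelCount (degreeHom V) h.1 m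
  obtain ⟨α, hα⟩ := F.exists_weight_eq m'
  have e : Finsupp.weight (fun h : Generator V => h.1)
      (Finsupp.single h (peelCount (degreeHom V) h.1 m) + α) = m := by
    rw [map_add, Finsupp.weight_single, hα, ← hm']
  refine ⟨_, e, le_antisymm ?_ ?_⟩
  · conv_rhs => rw [← e]
    exact F.weight_testSymmetry_le h _
  · rw [weight_testSymmetry]
    simp

/-- The surviving monomial in multidegree `m` has weight `weightHom V b m + ε * peelCount`, so
`hasSum_add_peelCount` applies. -/
theorem hilbertSeries_initial {b : V → ℝ} (hb : ∀ w ∈ insert 0 Γ, 0 < pointWeight V b w)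
    (h : Generator V) {ε : ℝ} (hq : 0 < glsmWeight V b h) (hε : 0 < glsmWeight V b h + ε) {s : ℝ}
    (hs : 0 < s) :
    hilbertSeries (initialIdeal (toricIdeal V) (testSymmetry h))
      (fun i => glsmWeight V b i + ε * (testSymmetry h i : ℝ)) s =
      coneSeries V Γ σ b s * (1 - Real.exp (-s * glsmWeight V b h)) *
        (1 - Real.exp (-s * (glsmWeight V b h + ε)))⁻¹ := by
  classical
  have hsum := hasSum_add_peelCount (F.degreeHom_ne_zero h.2.1) hs (F.hasSum_cone b hb hs) hq hε
  have hw : ∀ α : Generator V →₀ ℕ,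
      Finsupp.weight (fun i => glsmWeight V b i + ε * (testSymmetry h i : ℝ)) α =
      weightHom V b (Finsupp.weight (fun h : Generator V => h.1) α) +
        ε * (Finsupp.weight (testSymmetry h) α : ℕ) := by
    intro α
    rw [weightHom_weight, Finsupp.weight_apply, Finsupp.weight_apply, Finsupp.weight_apply,
      Finsupp.sum, Finsupp.sum, Finsupp.sum]
    push_cast
    rw [Finset.mul_sum, ← Finset.sum_add_distrib]
    refine Finset.sum_congr rfl fun i _ => ?_
    simp only [nsmul_eq_mul]
    push_cast
    ring
  rw [hilbertSeries_eq_tsum (gradedMap (fun h : Generator V => h.1) (testSymmetry h)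
      (peelCount (degreeHom V) h.1))
    (mem_initialIdeal_iff mem_toricIdeal_iff (F.weight_testSymmetry_le h)
      (F.exists_weight_eq_peelCount h))
    (fun m => weightHom V b m + ε * peelCount (degreeHom V) h.1 m) ?_ ?_ hsum.summable,
    hsum.tsum_eq]
  · rfl
  · intro α
    rw [gradedMap_monomial]
    split_ifs with h1
    · exact Or.inr ⟨_, rfl, by rw [hw, h1]⟩
    · exact Or.inl rfl
  · intro m
    obtain ⟨α, h1, h2⟩ := F.exists_weight_eq_peelCount h m
    refine ⟨α, ?_, by rw [hw, h1, h2]⟩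
    rw [gradedMap_monomial, h1, h2, if_pos rfl]

/-- Injectivity on a finite set makes `σ` a permutation of `Γ`, so differences along the boundary
sum to zero. -/
theorem next_injective : Function.Injective F.next := by
  rintro ⟨w, hw⟩ ⟨w', hw'⟩ h
  have h1 : σ w = σ w' := congrArg Subtype.val h
  have key : ∀ {w w' : Fin 2 → ℤ}, w ∈ Γ → w' ∈ Γ → σ w = σ w' → det2 w w' ≤ 0 := by
    intro w w' hw hw' h
    have d1 := F.det_succ w hw
    have d2 := F.det_succ w' hw'
    have l := F.le hw' (F.edgeDual_mem w hw)
    rw [← h] at d2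
    simp only [det2, edgeDual, dotProduct, Fin.sum_univ_two, Matrix.cons_val_zero,
      Matrix.cons_val_one] at *
    linarith
  have d1 := F.det_succ w hw
  have d2 := F.det_succ w' hw'
  have l1 := key hw hw' h1
  have l2 := key hw' hw h1.symm
  rw [← h1] at d2
  simp only [det2] at d1 d2 l1 l2
  have h0 : w 0 * w' 1 - w 1 * w' 0 = 0 := by linarith
  refine Subtype.ext (funext fun i => ?_)
  fin_cases i
  · simp only [Fin.zero_eta]
    linear_combination w' 0 * d1 - w 0 * d2 - σ w 0 * h0
  · simp only [Fin.mk_one]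
    linear_combination w' 1 * d1 - w 1 * d2 - σ w 1 * h0

end IsFan

/-- The volume of the section of the dual cone, up to normalization. -/
def conePhi (V Γ : Finset (Fin 2 → ℤ)) (σ : (Fin 2 → ℤ) → Fin 2 → ℤ) (b : V → ℝ) : ℝ :=
  ∑ w : Γ, (pointWeight V b w)⁻¹ * (pointWeight V b (σ w))⁻¹

/-- Each two-dimensional cone contributes `(1/q - s/2)(1/q' + s/2)` to first order. The linear terms
`(1/q - 1/q') / 2` telescope around the boundary, so the only linear term left is the `s/2` from the
geometric series of the origin, multiplied by `conePhi`. -/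
theorem IsFan.hasExpansion_coneSeries (F : IsFan V Γ σ) {b : V → ℝ}
    (hb : ∀ w ∈ insert 0 Γ, 0 < pointWeight V b w) :
    HasExpansion (fun s => s ^ 3 * coneSeries V Γ σ b s)
      (conePhi V Γ σ b * (pointWeight V b 0)⁻¹) (conePhi V Γ σ b / 2) := by
  have hq : ∀ w : Γ, 0 < pointWeight V b w := fun w => hb w (Finset.mem_insert_of_mem w.2)
  have h0 := hasExpansion_geometric (hb 0 (Finset.mem_insert_self _ _)).ne'
  have hg := fun w : Γ => hasExpansion_geometric (hq w).ne'
  have h1 : ∀ w ∈ (Finset.univ : Finset Γ), HasExpansion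
      (fun s => (s * (1 - Real.exp (-s * pointWeight V b w))⁻¹ + -1 * s) *
        (s * (1 - Real.exp (-s * pointWeight V b (σ w)))⁻¹))
      ((pointWeight V b w)⁻¹ * (pointWeight V b (σ w))⁻¹)
      (1 / 2 * (pointWeight V b w)⁻¹ - 1 / 2 * (pointWeight V b (σ w))⁻¹) := by
    intro w _
    have := ((hg w).add ((HasExpansion.const (-1)).mul HasExpansion.id)).mul (hg (F.next w))
    have hn : ((F.next w : Γ) : Fin 2 → ℤ) = σ w := rfl
    rw [hn] at this
    convert this using 1 <;> ring
  have h2 := ((HasExpansion.id.mul HasExpansion.id).add (HasExpansion.sum _ h1)).mul h0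
  have h3 : ∑ w : Γ, (1 / 2 * (pointWeight V b w)⁻¹ - 1 / 2 * (pointWeight V b (σ w))⁻¹) = 0 := by
    rw [Finset.sum_sub_distrib, sub_eq_zero]
    have hbij := Finite.injective_iff_bijective.1 F.next_injective
    exact (hbij.sum_comp fun w : Γ => 1 / 2 * (pointWeight V b w)⁻¹).symm
  have h4 := h2.congr' (g := fun s => s ^ 3 * coneSeries V Γ σ b s) ?_
  · convert h4 using 1
    · simp [conePhi]
    · rw [h3]
      simp [conePhi]
      ring
  · filter_upwards [eventually_pos_nhdsGT] with s hs
    rw [coneSeries]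
    have : ∀ w : Γ, s * (1 - Real.exp (-s * pointWeight V b w))⁻¹ + -1 * s =
        s * (Real.exp (-s * pointWeight V b w) * (1 - Real.exp (-s * pointWeight V b w))⁻¹) := by
      intro w
      have := (sub_pos.2 (exp_neg_mul_lt_one hs (hq w))).ne'
      generalize Real.exp (-s * pointWeight V b w) = x at this
      field_simp
      ring
    simp only [this]
    have e : ∑ w : Γ, s * (Real.exp (-s * pointWeight V b w) *
        (1 - Real.exp (-s * pointWeight V b w))⁻¹) *
        (s * (1 - Real.exp (-s * pointWeight V b (σ w)))⁻¹) = s ^ 2 *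
        ∑ w : Γ, Real.exp (-s * pointWeight V b w) * ((1 - Real.exp (-s * pointWeight V b w))⁻¹ *
      (1 - Real.exp (-s * pointWeight V b (σ w)))⁻¹) := by
      rw [Finset.mul_sum]
      refine Finset.sum_congr rfl fun w _ => ?_
      ring
    rw [e]
    ring

end Hilbert

/-! ### The Futaki invariant and the volume of a toric 3-fold -/

section Futaki

variable {V Γ : Finset (Fin 2 → ℤ)} {σ : (Fin 2 → ℤ) → Fin 2 → ℤ}

theorem pointWeight_zero (b : V → ℝ) : pointWeight V b 0 = ∑ v : V, b v := by
  simp [pointWeight]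

theorem pointWeight_add (b b' : V → ℝ) (w : Fin 2 → ℤ) :
    pointWeight V (b + b') w = pointWeight V b w + pointWeight V b' w := by
  simp [pointWeight, add_mul, Finset.sum_add_distrib]

theorem pointWeight_smul (c : ℝ) (b : V → ℝ) (w : Fin 2 → ℤ) :
    pointWeight V (c • b) w = c * pointWeight V b w := by
  simp [pointWeight, Finset.mul_sum, mul_assoc]

theorem pointWeight_single (v : V) (t : ℝ) (w : Fin 2 → ℤ) :
    pointWeight V (Pi.single v t) w = t * ((w ⬝ᵥ v.1 + 1 : ℤ) : ℝ) := by
  simp [pointWeight, Pi.single_apply]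

theorem conePhi_smul (c : ℝ) (b : V → ℝ) :
    conePhi V Γ σ (c • b) = (c ^ 2)⁻¹ * conePhi V Γ σ b := by
  simp only [conePhi, pointWeight_smul, Finset.mul_sum]
  refine Finset.sum_congr rfl fun w _ => ?_
  rw [mul_inv, mul_inv, sq, mul_inv]
  ring

theorem glsmWeight_eq (b : V → ℝ) (h : Generator V) : glsmWeight V b h = weightHom V b h.1 := rfl

namespace IsFan

variable (F : IsFan V Γ σ)
include F

theorem glsmWeight_pointGenerator (b : V → ℝ) (w : (insert 0 Γ : Finset (Fin 2 → ℤ))) :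
    glsmWeight V b (F.pointGenerator w) = pointWeight V b w.1 :=
  F.weightHom_point b w

theorem exists_glsmWeight_eq (h : Generator V) :
    ∃ w ∈ insert 0 Γ, ∀ b : V → ℝ, glsmWeight V b h = pointWeight V b w := by
  obtain ⟨w, hw⟩ := F.exists_eq_point h
  refine ⟨w.1, w.2, fun b => ?_⟩
  rw [glsmWeight_eq, hw, F.weightHom_point]

theorem nonempty : Γ.Nonempty := by
  obtain ⟨w, hw, -⟩ := F.cover ![1, 0] (by intro h; simpa using congrFun h 0)
  exact ⟨w, hw⟩

theorem conePhi_pos {b : V → ℝ} (hb : ∀ w ∈ insert 0 Γ, 0 < pointWeight V b w) :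
    0 < conePhi V Γ σ b := by
  have : Nonempty Γ := F.nonempty.to_subtype
  refine Finset.sum_pos (fun w _ => mul_pos (inv_pos.2 ?_) (inv_pos.2 ?_)) Finset.univ_nonempty
  · exact hb w (Finset.mem_insert_of_mem w.2)
  · exact hb _ (Finset.mem_insert_of_mem (F.next w).2)

/-- The factor `(1 - exp (-s q)) / (1 - exp (-s (q + ε)))` expands as `q / (q + ε) · (1 + ε s / 2)`,
which turns `A₁ / A₀ = B` into `B + ε`. -/
theorem hasFutakiInvariant {b : V → ℝ} (hb : ∀ w ∈ insert 0 Γ, 0 < pointWeight V b w)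
    (h : Generator V) :
    HasFutakiInvariant (toricIdeal V) (glsmWeight V b) (testSymmetry h)
      (conePhi V Γ σ b / (4 * pointWeight V b 0) *
        (1 - pointWeight V b 0 / (3 * glsmWeight V b h))) := by
  have hB := hb 0 (Finset.mem_insert_self _ _)
  have hΦ := F.conePhi_pos hb
  have hq : 0 < glsmWeight V b h := by
    obtain ⟨w, hw, e⟩ := F.exists_glsmWeight_eq h
    rw [e]
    exact hb w hw
  have hexp := F.hasExpansion_coneSeries hb
  set Φ := conePhi V Γ σ b with hΦdef
  set B := pointWeight V b 0 with hBdef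
  set q := glsmWeight V b h with hqdef
  have hev : ∀ᶠ ε in 𝓝 (0 : ℝ), 0 < q + ε := by
    have : Tendsto (fun ε : ℝ => q + ε) (𝓝 0) (𝓝 (q + 0)) :=
      (continuous_const.add continuous_id).tendsto 0
    rw [add_zero] at this
    exact this.eventually (lt_mem_nhds hq)
  refine ⟨Φ / (2 * B), Φ / 2, fun ε => Φ / (2 * B) * (q * (q + ε)⁻¹),
    fun ε => q * (q + ε)⁻¹ * (Φ / 2 + Φ / (2 * B) * ε), -(Φ / (2 * B)) / q, 1, ?_, by positivity,
    ?_, ?_, ?_, ?_⟩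
  · refine HasExpansion.hasLaurentCoeffs ?_
    refine HasExpansion.congr' (f := fun s => s ^ 3 * coneSeries V Γ σ b s) ?_ ?_
    · convert hexp using 1
      field_simp
    · filter_upwards [eventually_pos_nhdsGT] with s hs
      rw [F.hilbertSeries_toric hb hs]
  · filter_upwards [hev] with ε hε
    refine ⟨by positivity, HasExpansion.hasLaurentCoeffs ?_⟩
    refine HasExpansion.congr' (f := fun s => s ^ 3 * coneSeries V Γ σ b s *
      ((1 - Real.exp (-s * q)) / s) * (s * (1 - Real.exp (-s * (q + ε)))⁻¹)) ?_ ?_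
    · convert (hexp.mul (hasExpansion_one_sub_exp q)).mul (hasExpansion_geometric hε.ne') using 1
      · field_simp
      · field_simp
        ring
    · filter_upwards [eventually_pos_nhdsGT] with s hs
      rw [F.hilbertSeries_initial hb h hq hε hs, ← hqdef]
      field_simp
  · have h1 : HasDerivAt (fun ε : ℝ => B + ε) 1 0 := (hasDerivAt_id 0).const_add B
    refine h1.congr_of_eventuallyEq ?_
    filter_upwards [hev] with ε hε
    field_simp
  · have h1 : HasDerivAt (fun ε : ℝ => q + ε) 1 0 := (hasDerivAt_id 0).const_add q
    have h2 := ((h1.inv (by simpa using hq.ne')).const_mul q).const_mul (Φ / (2 * B))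
    refine h2.congr_deriv ?_
    rw [add_zero]
    field_simp
  · field_simp
    ring

theorem hasVolume {b : V → ℝ} (hb : ∀ w ∈ insert 0 Γ, 0 < pointWeight V b w) :
    HasVolume V b (8 / 27 * (conePhi V Γ σ b * (pointWeight V b 0)⁻¹)) := by
  refine Tendsto.const_mul _ ((F.hasExpansion_coneSeries hb).tendsto.congr' ?_)
  filter_upwards [eventually_pos_nhdsGT] with s hs
  rw [F.hilbertSeries_toric hb hs]

theorem isReeb_iff {b : V → ℝ} :
    IsReeb V b ↔ (∀ w ∈ insert 0 Γ, 0 < pointWeight V b w) ∧ pointWeight V b 0 = 2 := by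
  rw [IsReeb, pointWeight_zero]
  refine and_congr_left fun _ => ⟨fun h w hw => ?_, fun h g => ?_⟩
  · rw [← F.glsmWeight_pointGenerator b ⟨w, hw⟩]
    exact h _
  · obtain ⟨w, hw, e⟩ := F.exists_glsmWeight_eq g
    rw [e]
    exact h w hw

/-- At total weight 2 the volume is a fixed positive multiple of `conePhi`. -/
theorem isRCharge_iff {r : V → ℝ} :
    IsRCharge V r ↔ IsReeb V r ∧ ∀ b, IsReeb V b → conePhi V Γ σ r ≤ conePhi V Γ σ b := by
  refine and_congr_right fun hr => ?_
  have hr' := F.isReeb_iff.1 hr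
  constructor
  · rintro ⟨vmin, h1, h2⟩ b hb
    have hb' := F.isReeb_iff.1 hb
    obtain ⟨vol, h3, h4⟩ := h2 b hb
    have e1 := tendsto_nhds_unique h1 (F.hasVolume hr'.1)
    have e2 := tendsto_nhds_unique h3 (F.hasVolume hb'.1)
    rw [e1, e2, hr'.2, hb'.2] at h4
    linarith
  · intro h
    refine ⟨_, F.hasVolume hr'.1, fun b hb => ?_⟩
    have hb' := F.isReeb_iff.1 hb
    refine ⟨_, F.hasVolume hb'.1, ?_⟩
    rw [hr'.2, hb'.2]
    linarith [h b hb]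

/-- The lattice points of the dual cone from which a fixed generator cannot be split off span a
union of facets, whose volume is monotone in the weights. -/
theorem pointWeight_mul_conePhi_le {b b' : V → ℝ} (hb : ∀ w ∈ insert 0 Γ, 0 < pointWeight V b w)
    (hle : b ≤ b') {w : Fin 2 → ℤ} (hw : w ∈ insert 0 Γ) :
    conePhi V Γ σ b' * (pointWeight V b' 0)⁻¹ * pointWeight V b' w ≤
      conePhi V Γ σ b * (pointWeight V b 0)⁻¹ * pointWeight V b w := by
  have hb' : ∀ w ∈ insert 0 Γ, 0 < pointWeight V b' w := by
    intro w hw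
    refine (hb w hw).trans_le (Finset.sum_le_sum fun v _ => mul_le_mul_of_nonneg_right (hle v) ?_)
    have := F.neg_one_le hw v.1 v.2
    exact_mod_cast (by linarith : (0 : ℤ) ≤ w ⬝ᵥ v.1 + 1)
  refine le_of_tendsto_of_tendsto
    ((F.hasExpansion_coneSeries hb').mul (hasExpansion_one_sub_exp (pointWeight V b' w))).tendsto
    ((F.hasExpansion_coneSeries hb).mul (hasExpansion_one_sub_exp (pointWeight V b w))).tendsto ?_
  filter_upwards [eventually_pos_nhdsGT] with s hs
  have key : coneSeries V Γ σ b' s * (1 - Real.exp (-s * pointWeight V b' w)) ≤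
      coneSeries V Γ σ b s * (1 - Real.exp (-s * pointWeight V b w)) := by
    have hd := F.degreeHom_ne_zero (F.point_ne_zero ⟨w, hw⟩)
    have h1 := hasSum_peel hd hs (F.hasSum_cone b hb hs) (by
      rw [F.weightHom_point]; exact hb w hw)
    have h2 := hasSum_peel hd hs (F.hasSum_cone b' hb' hs) (by
      rw [F.weightHom_point]; exact hb' w hw)
    rw [F.weightHom_point] at h1 h2
    -- Both series run over the same index set, which does not depend on the weights; only the
    -- exponents grow.
    refine hasSum_le (fun m => Real.exp_le_exp.2 ?_) h2 h1
    rw [neg_mul, neg_mul, neg_le_neg_iff]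
    refine mul_le_mul_of_nonneg_left ?_ hs.le
    refine Finset.sum_le_sum fun v _ => mul_le_mul_of_nonneg_right (hle v) ?_
    exact_mod_cast m.1.2 v.1 v.2
  have e : ∀ x y : ℝ, s ^ 3 * x * (y / s) = s ^ 2 * (x * y) := fun x y => by
    field_simp
  rw [e, e]
  exact mul_le_mul_of_nonneg_left key (by positivity)

/-- The unitarity bound: at the minimum of the volume, a generator whose exponent of some GLSM field
is `p` has `R`-charge at least `2 p / 3`. -/
theorem le_pointWeight_of_isRCharge {r : V → ℝ} (hr : IsRCharge V r) {w : Fin 2 → ℤ}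
    (hw : w ∈ insert 0 Γ) (v : V) :
    2 / 3 * ((w ⬝ᵥ v.1 + 1 : ℤ) : ℝ) ≤ pointWeight V r w := by
  obtain ⟨hreeb, hmin⟩ := F.isRCharge_iff.1 hr
  obtain ⟨hpos, htwo⟩ := F.isReeb_iff.1 hreeb
  have hq := hpos w hw
  have hΦ := F.conePhi_pos hpos
  set q := pointWeight V r w
  set P : ℝ := ((w ⬝ᵥ v.1 + 1 : ℤ) : ℝ) with hP
  -- Raise the weight of `v` by `t` and rescale by `c = 1 + t / 2` to restore the total 2.
  -- Minimality gives `Φ(r) ≤ c² Φ(r + t)`, monotonicity gives `Φ(r + t) (q + t P) ≤ Φ(r) q c`, and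
  -- together they bound `q + t P` by `q c³`. To first order in `t` this is `P ≤ 3q / 2`.
  have key : ∀ t : ℝ, 0 < t → q + t * P ≤ q * (1 + t / 2) ^ 3 := by
    intro t ht
    set c := 1 + t / 2 with hc
    have hc0 : 0 < c := by positivity
    have hle : r ≤ r + Pi.single v t := by
      intro v'
      simp only [Pi.add_apply]
      have : (0 : V → ℝ) ≤ Pi.single v t := Pi.single_nonneg.2 ht.le
      linarith [this v', show (0 : V → ℝ) v' = 0 from rfl]
    have hpw : ∀ x, pointWeight V (r + Pi.single v t) x =
        pointWeight V r x + t * ((x ⬝ᵥ v.1 + 1 : ℤ) : ℝ) := fun x => by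
      rw [pointWeight_add, pointWeight_single]
    have hpos' : ∀ x ∈ insert 0 Γ, 0 < pointWeight V (r + Pi.single v t) x := by
      intro x hx
      have := F.neg_one_le hx v.1 v.2
      have h0 : (0 : ℝ) ≤ ((x ⬝ᵥ v.1 + 1 : ℤ) : ℝ) := by
        exact_mod_cast (by linarith : (0 : ℤ) ≤ x ⬝ᵥ v.1 + 1)
      rw [hpw]
      have := hpos x hx
      positivity
    have h0 : pointWeight V (r + Pi.single v t) 0 = 2 * c := by
      rw [hpw, htwo, zero_dotProduct, hc]
      push_cast
      ring
    have hreeb' : IsReeb V (c⁻¹ • (r + Pi.single v t)) := by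
      rw [F.isReeb_iff]
      refine ⟨fun x hx => ?_, ?_⟩
      · rw [pointWeight_smul]
        exact mul_pos (inv_pos.2 hc0) (hpos' x hx)
      · rw [pointWeight_smul, h0]
        field_simp
    have h1 := hmin _ hreeb'
    rw [conePhi_smul] at h1
    have h2 := F.pointWeight_mul_conePhi_le hpos hle hw
    rw [h0, htwo, hpw] at h2
    have h3 : conePhi V Γ σ r ≤ c ^ 2 * conePhi V Γ σ (r + Pi.single v t) := by
      rwa [inv_pow, inv_inv] at h1
    have h4 : 0 < q + t * P := by
      have := hpos' w hw
      rwa [hpw] at this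
    have h5 : conePhi V Γ σ (r + Pi.single v t) * (q + t * P) ≤
        conePhi V Γ σ r * (q * c) := by
      have e1 : conePhi V Γ σ (r + Pi.single v t) * (2 * c)⁻¹ * (q + t * P) =
        conePhi V Γ σ (r + Pi.single v t) * (q + t * P) / (2 * c) := by ring
      rw [e1, div_le_iff₀ (by positivity)] at h2
      linarith
    have h6 := mul_le_mul_of_nonneg_right h3 h4.le
    have h7 := mul_le_mul_of_nonneg_left h5 (sq_nonneg c)
    have h8 : conePhi V Γ σ r * (q + t * P) ≤ conePhi V Γ σ r * (q * c ^ 3) := by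
      calc _ ≤ _ := h6
        _ = c ^ 2 * (conePhi V Γ σ (r + Pi.single v t) * (q + t * P)) := by ring
        _ ≤ _ := h7
        _ = _ := by ring
    exact le_of_mul_le_mul_left h8 hΦ
  by_contra hcon
  push Not at hcon
  set δ := P - 3 / 2 * q with hδ
  have hδ0 : 0 < δ := by linarith
  -- This value of `t` is at most 1 and satisfies `q t < δ`, so the higher order terms, at most `7/8
  -- · q t`, cannot make up for `δ`.
  have ht : 0 < δ / (q + δ) := by positivity
  have ht1 : δ / (q + δ) ≤ 1 := by rw [div_le_one (by positivity)]; linarith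
  have ht2 : q * (δ / (q + δ)) < δ := by
    rw [← mul_div_assoc, div_lt_iff₀ (by positivity)]
    nlinarith
  have := key _ ht
  set t := δ / (q + δ)
  have h9 : t * P ≤ t * (q * (3 / 2 + 3 / 4 * t + t ^ 2 / 8)) := by linarith [this, (by ring :
    q * (1 + t / 2) ^ 3 = q + t * (q * (3 / 2 + 3 / 4 * t + t ^ 2 / 8)))]
  have h10 := le_of_mul_le_mul_left h9 ht
  have h11 : q * t ^ 2 ≤ q * t := by
    have : t ^ 2 ≤ t := by nlinarith
    exact mul_le_mul_of_nonneg_left this hq.le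
  nlinarith

end IsFan

end Futaki

/-! ### The fan of a reflexive polygon -/

section Polygon

theorem toPlane_dotProduct (w v : Fin 2 → ℤ) : toPlane w ⬝ᵥ toPlane v = ((w ⬝ᵥ v : ℤ) : ℝ) := by
  simp [toPlane, dotProduct, Fin.sum_univ_two]

theorem toPlane_injective : Function.Injective toPlane := fun v w h => by
  funext i
  have := congrFun h i
  simpa only [toPlane, Int.cast_inj] using this

theorem toPlane_zero : toPlane 0 = 0 := by
  funext i
  simp [toPlane]

theorem mem_polygon_iff {V : Finset (Fin 2 → ℤ)} {z : Fin 2 → ℝ} :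
    z ∈ polygon V ↔ ∃ l : (Fin 2 → ℤ) → ℝ, (∀ v ∈ V, 0 ≤ l v) ∧ ∑ v ∈ V, l v = 1 ∧
      ∑ v ∈ V, l v • toPlane v = z := by
  classical
  have e : toPlane '' (V : Set (Fin 2 → ℤ)) = ((V.image toPlane : Finset (Fin 2 → ℝ)) : Set _) := by
    simp
  have hs {M : Type} [AddCommMonoid M] (f : (Fin 2 → ℝ) → M) :
      ∑ y ∈ V.image toPlane, f y = ∑ v ∈ V, f (toPlane v) :=
    Finset.sum_image fun _ _ _ _ h => toPlane_injective h
  rw [polygon, e, Finset.mem_convexHull']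
  constructor
  · rintro ⟨l, h0, h1, h2⟩
    rw [hs] at h1 h2
    exact ⟨fun v => l (toPlane v), fun v hv => h0 _ (Finset.mem_image_of_mem _ hv), h1, h2⟩
  · rintro ⟨l, h0, h1, h2⟩
    have hi : ∀ v, l (Function.invFun toPlane (toPlane v)) = l v := fun v => by
      rw [Function.leftInverse_invFun toPlane_injective]
    refine ⟨fun y => l (Function.invFun toPlane y), fun y hy => ?_, ?_, ?_⟩
    · obtain ⟨v, hv, rfl⟩ := Finset.mem_image.1 hy
      simpa only [hi] using h0 v hv
    · rw [hs]
      simpa only [hi] using h1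
    · rw [hs]
      simpa only [hi] using h2

theorem le_dotProduct_of_mem_polygon {V : Finset (Fin 2 → ℤ)} {a z : Fin 2 → ℝ} {c : ℝ}
    (hz : z ∈ polygon V) (h : ∀ v ∈ V, c ≤ a ⬝ᵥ toPlane v) : c ≤ a ⬝ᵥ z := by
  obtain ⟨l, h0, h1, rfl⟩ := mem_polygon_iff.1 hz
  rw [dotProduct_sum]
  calc c = ∑ v ∈ V, l v * c := by rw [← Finset.sum_mul, h1, one_mul]
    _ ≤ _ := Finset.sum_le_sum fun v hv => by
      rw [dotProduct_smul, smul_eq_mul]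
      exact mul_le_mul_of_nonneg_left (h v hv) (h0 v hv)

theorem toPlane_mem_polygon {V : Finset (Fin 2 → ℤ)} {v : Fin 2 → ℤ} (hv : v ∈ V) :
    toPlane v ∈ polygon V :=
  subset_convexHull ℝ _ (Set.mem_image_of_mem _ hv)

theorem mem_polarDual_polygon {V : Finset (Fin 2 → ℤ)} {u : Fin 2 → ℝ} :
    u ∈ polarDual (polygon V) ↔ ∀ v ∈ V, -1 ≤ u ⬝ᵥ toPlane v :=
  ⟨fun h _ hv => h _ (toPlane_mem_polygon hv), fun h _ hz => le_dotProduct_of_mem_polygon hz h⟩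

theorem exists_clm_eq_dotProduct (f : (Fin 2 → ℝ) →L[ℝ] ℝ) : ∃ a : Fin 2 → ℝ, ∀ x, f x = a ⬝ᵥ x := by
  refine ⟨fun i => f (Pi.single i 1), fun x => ?_⟩
  have e : x = x 0 • Pi.single 0 1 + x 1 • Pi.single 1 1 := by
    funext i
    fin_cases i <;> simp
  conv_lhs => rw [e]
  simp only [map_add, map_smul, smul_eq_mul, dotProduct, Fin.sum_univ_two]
  ring

theorem dotProduct_self_pos {a : Fin 2 → ℝ} (ha : a ≠ 0) : 0 < a ⬝ᵥ a := by
  have := dotProduct_self_eq_zero (v := a)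
  have h0 : 0 ≤ a ⬝ᵥ a := Finset.sum_nonneg fun i _ => mul_self_nonneg _
  exact lt_of_le_of_ne h0 fun h => ha (this.1 h.symm)

theorem exists_smul_mem_of_mem_interior {P : Set (Fin 2 → ℝ)} (h0 : 0 ∈ interior P)
    (a : Fin 2 → ℝ) : ∃ δ > (0 : ℝ), δ • a ∈ P := by
  have hc : Tendsto (fun δ : ℝ => δ • a) (𝓝[>] 0) (𝓝 0) := by
    have : Continuous fun δ : ℝ => δ • a := by fun_prop
    simpa using (this.tendsto 0).mono_left nhdsWithin_le_nhds
  obtain ⟨δ, h, hδ⟩ := ((hc.eventually (mem_interior_iff_mem_nhds.1 h0)).and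
    self_mem_nhdsWithin).exists
  exact ⟨δ, hδ, h⟩

theorem exists_dotProduct_neg {V : Finset (Fin 2 → ℤ)} (h0 : 0 ∈ interior (polygon V))
    {a : Fin 2 → ℝ} (ha : a ≠ 0) : ∃ v ∈ V, a ⬝ᵥ toPlane v < 0 := by
  by_contra! hcon
  obtain ⟨δ, hδ, h⟩ := exists_smul_mem_of_mem_interior h0 (-a)
  have h1 := le_dotProduct_of_mem_polygon h hcon
  rw [dotProduct_smul, dotProduct_neg, smul_eq_mul] at h1
  nlinarith [dotProduct_self_pos ha, mul_pos hδ (dotProduct_self_pos ha)]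

/-- A point of the polar dual may be moved slightly in a direction that does not decrease the
pairing with any tight constraint. -/
theorem exists_pos_forall_neg_one_le {ι : Type*} (s : Finset ι) (α β : ι → ℝ)
    (h : ∀ i ∈ s, -1 < α i ∨ -1 ≤ α i ∧ 0 ≤ β i) : ∃ ε > 0, ∀ i ∈ s, -1 ≤ α i + ε * β i := by
  have key : ∀ᶠ ε in 𝓝[>] (0 : ℝ), ∀ i ∈ s, -1 ≤ α i + ε * β i := by
    rw [Finset.eventually_all]
    intro i hi
    rcases h i hi with h | ⟨h1, h2⟩
    · have hc : Continuous fun ε : ℝ => α i + ε * β i := by fun_prop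
      have ht : Tendsto (fun ε : ℝ => α i + ε * β i) (𝓝[>] 0) (𝓝 (α i)) := by
        simpa using (hc.tendsto 0).mono_left nhdsWithin_le_nhds
      exact (ht.eventually (lt_mem_nhds h)).mono fun _ h => h.le
    · filter_upwards [self_mem_nhdsWithin] with ε hε
      have : 0 ≤ ε * β i := mul_nonneg (le_of_lt hε) h2
      linarith
  obtain ⟨ε, h, hε⟩ := (key.and self_mem_nhdsWithin).exists
  exact ⟨ε, hε, h⟩

/-! ### Polar pairs of lattice polygons and the edges of the dual polygon. -/

/-- `Γ` is the set of nonzero lattice points of the polar dual of the polygon with vertices `V`, and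
both polygons are lattice polygons with the origin in the interior. -/
structure IsPolarPair (V Γ : Finset (Fin 2 → ℤ)) : Prop where
  mem_iff : ∀ w, w ∈ Γ ↔ w ≠ 0 ∧ ∀ v ∈ V, -1 ≤ w ⬝ᵥ v
  mem_polygon : ∀ z : Fin 2 → ℝ, (∀ v ∈ V, -1 ≤ z ⬝ᵥ toPlane v) → z ∈ polygon (insert 0 Γ)
  zero_mem_interior : 0 ∈ interior (polygon V)
  notMem_erase : ∀ v ∈ V, toPlane v ∉ polygon (V.erase v)

theorem IsReflexivePolygon.exists_isPolarPair {V : Finset (Fin 2 → ℤ)}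
    (hV : IsReflexivePolygon V) : ∃ Γ, IsPolarPair V Γ := by
  classical
  obtain ⟨W, hW⟩ := hV.dual_isLattice
  -- `M` bounds every coordinate on the dual polygon, so that its lattice points form a finite set.
  set M : ℤ := ∑ w ∈ W, ∑ i, |w i| with hM
  have hb : ∀ z ∈ polygon W, ∀ i, -(M : ℝ) ≤ z i ∧ z i ≤ M := by
    intro z hz i
    have hw : ∀ w ∈ W, |w i| ≤ M := fun w hw =>
      (Finset.single_le_sum (f := fun i => |w i|) (fun _ _ => abs_nonneg _)
        (Finset.mem_univ i)).trans (Finset.single_le_sum (f := fun w => ∑ i, |w i|)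
          (fun _ _ => Finset.sum_nonneg fun _ _ => abs_nonneg _) hw)
    have e : ∀ c : ℝ, ∀ x : Fin 2 → ℝ, Pi.single i c ⬝ᵥ x = c * x i := fun c x =>
      single_dotProduct x c i
    have h1 := le_dotProduct_of_mem_polygon (a := Pi.single i 1) (c := -(M : ℝ)) hz fun w hw' => by
      rw [e, one_mul]
      rw [toPlane]
      exact_mod_cast (abs_le.1 (hw w hw')).1
    have h2 := le_dotProduct_of_mem_polygon (a := Pi.single i (-1)) (c := -(M : ℝ)) hz
      fun w hw' => by
        rw [e, neg_one_mul, neg_le_neg_iff]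
        rw [toPlane]
        exact_mod_cast (abs_le.1 (hw w hw')).2
    rw [e] at h1 h2
    constructor <;> linarith
  have hmem : ∀ w : Fin 2 → ℤ, toPlane w ∈ polygon W ↔ ∀ v ∈ V, -1 ≤ w ⬝ᵥ v := fun w => by
    rw [← hW, mem_polarDual_polygon]
    refine forall₂_congr fun v _ => ?_
    rw [toPlane_dotProduct]
    exact_mod_cast Iff.rfl
  refine ⟨((Fintype.piFinset fun _ => Finset.Icc (-M) M).filter fun w => w ≠ 0 ∧
    ∀ v ∈ V, -1 ≤ w ⬝ᵥ v), fun w => ?_, fun z hz => ?_, hV.zero_mem_interior, fun v hv h => ?_⟩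
  · rw [Finset.mem_filter, and_iff_right_iff_imp]
    rintro ⟨-, h⟩
    rw [Fintype.mem_piFinset]
    intro i
    have := hb _ ((hmem w).2 h) i
    rw [Finset.mem_Icc]
    rw [toPlane] at this
    exact_mod_cast this
  · have hz' : z ∈ polygon W := by
      rw [← hW, mem_polarDual_polygon]
      exact hz
    refine convexHull_mono (Set.image_mono ?_) hz'
    intro w hw
    have h1 := toPlane_mem_polygon hw
    rw [Finset.mem_coe, Finset.mem_insert, or_iff_not_imp_left]
    intro h0
    rw [Finset.mem_filter, Fintype.mem_piFinset]
    refine ⟨fun i => ?_, h0, (hmem w).1 h1⟩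
    have := hb _ h1 i
    rw [Finset.mem_Icc]
    rw [toPlane] at this
    exact_mod_cast this
  · have h1 : toPlane v ∈ (polygon V).extremePoints ℝ := by
      rw [hV.extremePoints_eq]
      exact Set.mem_image_of_mem _ hv
    have hc : Convex ℝ (polygon V) := convex_convexHull ℝ _
    rw [hc.mem_extremePoints_iff_mem_sdiff_convexHull_sdiff] at h1
    refine h1.2 (convexHull_mono ?_ h)
    rintro _ ⟨w, hw, rfl⟩
    rw [Finset.mem_coe, Finset.mem_erase] at hw
    exact ⟨toPlane_mem_polygon hw.2, fun h => hw.1 (toPlane_injective h)⟩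

/-- The primitive vector along the edge dual to `v`. -/
def edgeVector (v : Fin 2 → ℤ) : Fin 2 → ℤ := ![v 1, -v 0]

theorem edgeVector_dotProduct (v v' : Fin 2 → ℤ) : edgeVector v ⬝ᵥ v' = -det2 v v' := by
  simp [edgeVector, det2, dotProduct, Fin.sum_univ_two]
  ring

theorem det2_add_edgeVector (w v : Fin 2 → ℤ) : det2 w (w + edgeVector v) = -(w ⬝ᵥ v) := by
  simp [edgeVector, det2, dotProduct, Fin.sum_univ_two]
  ring

theorem edgeDual_add_edgeVector (w v : Fin 2 → ℤ) : edgeDual w (w + edgeVector v) = v := by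
  funext i
  fin_cases i <;> simp [edgeDual, edgeVector]

theorem eq_add_det2_smul {w w' v : Fin 2 → ℤ} (h : w ⬝ᵥ v = -1) (h' : w' ⬝ᵥ v = -1) :
    w' = w + det2 w w' • edgeVector v := by
  simp only [dotProduct, Fin.sum_univ_two] at h h'
  funext i
  fin_cases i <;> simp [edgeVector, det2]
  · linear_combination w' 0 * h - w 0 * h'
  · linear_combination w' 1 * h - w 1 * h'

theorem det2_self (w : Fin 2 → ℤ) : det2 w w = 0 := by
  simp [det2]
  ring

theorem det2_swap (w w' : Fin 2 → ℤ) : det2 w' w = -det2 w w' := by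
  simp [det2]
  ring

/-- A vector in the polygon of all `v` with `w · v ≥ -1` for all `w ∈ Γ` is determined by the edge
of the dual polygon on which it is constant. -/
theorem eq_of_add_edgeVector_mem {w v v' : Fin 2 → ℤ} (hv : w ⬝ᵥ v = -1) (hv' : w ⬝ᵥ v' = -1)
    (h : -1 ≤ (w + edgeVector v) ⬝ᵥ v') (h' : -1 ≤ (w + edgeVector v') ⬝ᵥ v) : v = v' := by
  rw [add_dotProduct, edgeVector_dotProduct, hv'] at h
  rw [add_dotProduct, edgeVector_dotProduct, hv, det2_swap] at h'
  have h0 : det2 v v' = 0 := by omega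
  have e := eq_add_det2_smul (w := v) (w' := v') (v := w) (by rw [dotProduct_comm]; exact hv)
    (by rw [dotProduct_comm]; exact hv')
  rw [e, h0]
  simp

namespace IsPolarPair

variable {V Γ : Finset (Fin 2 → ℤ)} (P : IsPolarPair V Γ)
include P

theorem le {w v : Fin 2 → ℤ} (hw : w ∈ Γ) (hv : v ∈ V) : -1 ≤ w ⬝ᵥ v := ((P.mem_iff w).1 hw).2 v hv

/-- Some vertex pairs negatively with `w`, and an integer that is negative and at least `-1` equals
`-1`: a nonzero dual lattice point is on the boundary. -/
theorem exists_tight {w : Fin 2 → ℤ} (hw : w ∈ Γ) : ∃ v ∈ V, w ⬝ᵥ v = -1 := by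
  obtain ⟨v, hv, h⟩ := exists_dotProduct_neg P.zero_mem_interior (a := toPlane w) fun h =>
    ((P.mem_iff w).1 hw).1 (toPlane_injective (h.trans toPlane_zero.symm))
  rw [toPlane_dotProduct] at h
  have h' : w ⬝ᵥ v < 0 := by exact_mod_cast h
  exact ⟨v, hv, le_antisymm (by omega) (P.le hw hv)⟩

/-- On the edge of the dual polygon cut out by `v`, every linear functional takes at a lattice point
a value that is at most the one at a given point. -/
theorem exists_tight_le {z : Fin 2 → ℝ} (hz : ∀ v ∈ V, -1 ≤ z ⬝ᵥ toPlane v) {v : Fin 2 → ℤ}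
    (hv : v ∈ V) (hzv : z ⬝ᵥ toPlane v = -1) (c : Fin 2 → ℝ) :
    ∃ w ∈ Γ, w ⬝ᵥ v = -1 ∧ c ⬝ᵥ toPlane w ≤ c ⬝ᵥ z := by
  obtain ⟨l, h0, h1, h2⟩ := mem_polygon_iff.1 (P.mem_polygon z hz)
  by_contra! hcon
  have hle : ∀ w ∈ insert 0 Γ, -1 ≤ w ⬝ᵥ v := by
    intro w hw
    rcases Finset.mem_insert.1 hw with rfl | hw
    · simp
    · exact P.le hw hv
  -- The functional of `v` attains its minimum `-1` at `z`, so in a convex representation of `z`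
  -- only points with value `-1` carry weight.
  have hsum : ∑ w ∈ insert 0 Γ, l w * ((w ⬝ᵥ v + 1 : ℤ) : ℝ) = 0 := by
    have : ∑ w ∈ insert 0 Γ, l w * ((w ⬝ᵥ v : ℤ) : ℝ) = -1 := by
      rw [← hzv, ← h2, sum_dotProduct]
      refine Finset.sum_congr rfl fun w _ => ?_
      rw [smul_dotProduct, toPlane_dotProduct, smul_eq_mul]
    push_cast
    simp only [mul_add, mul_one, Finset.sum_add_distrib]
    rw [h1, this]
    norm_num
  rw [Finset.sum_eq_zero_iff_of_nonneg fun w hw => mul_nonneg (h0 w hw) (by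
    exact_mod_cast (by have := hle w hw; omega : (0 : ℤ) ≤ w ⬝ᵥ v + 1))] at hsum
  have hcase : ∀ w ∈ insert 0 Γ, l w = 0 ∨ c ⬝ᵥ z < c ⬝ᵥ toPlane w := by
    intro w hw
    rcases mul_eq_zero.1 (hsum w hw) with h | h
    · exact Or.inl h
    · right
      have h' : w ⬝ᵥ v + 1 = 0 := by exact_mod_cast h
      have hw0 : w ≠ 0 := by
        rintro rfl
        simp at h'
      exact hcon w (Finset.mem_of_mem_insert_of_ne hw hw0) (by omega)
  have hlt : ∑ w ∈ insert 0 Γ, l w * (c ⬝ᵥ z) < ∑ w ∈ insert 0 Γ, l w * (c ⬝ᵥ toPlane w) := by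
    refine Finset.sum_lt_sum (fun w hw => ?_) ?_
    · rcases hcase w hw with h | h
      · simp [h]
      · exact mul_le_mul_of_nonneg_left h.le (h0 w hw)
    · by_contra! hc
      have : ∑ w ∈ insert 0 Γ, l w = 0 := Finset.sum_eq_zero fun w hw => by
        rcases hcase w hw with h | h
        · exact h
        · have := hc w hw
          have := h0 w hw
          nlinarith
      rw [h1] at this
      exact one_ne_zero this
  rw [← Finset.sum_mul, h1, one_mul] at hlt
  refine hlt.ne ?_
  conv_lhs => rw [← h2, dotProduct_sum]
  refine Finset.sum_congr rfl fun w _ => ?_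
  rw [dotProduct_smul, smul_eq_mul]

theorem add_edgeVector_smul_mem {w v : Fin 2 → ℤ} {m n : ℤ} (hw : w ⬝ᵥ v = -1)
    (hm : ∀ v' ∈ V, -1 ≤ (w + m • edgeVector v) ⬝ᵥ v')
    (hn : ∀ v' ∈ V, -1 ≤ (w + n • edgeVector v) ⬝ᵥ v') {t : ℤ} (hmt : m ≤ t) (htn : t ≤ n) :
    w + t • edgeVector v ∈ Γ := by
  rw [P.mem_iff]
  constructor
  · intro h
    have h' : (w + t • edgeVector v) ⬝ᵥ v = -1 := by
      rw [add_dotProduct, smul_dotProduct, edgeVector_dotProduct, det2_self, hw]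
      simp
    rw [h, zero_dotProduct] at h'
    omega
  · intro v' hv'
    have h1 := hm v' hv'
    have h2 := hn v' hv'
    rw [add_dotProduct, smul_dotProduct, smul_eq_mul] at *
    rcases le_total 0 (edgeVector v ⬝ᵥ v') with h | h <;> nlinarith

theorem add_edgeVector_mem {w w' v : Fin 2 → ℤ} (hw : w ∈ Γ) (hwv : w ⬝ᵥ v = -1) (hw' : w' ∈ Γ)
    (hwv' : w' ⬝ᵥ v = -1) (h : 1 ≤ det2 w w') : w + edgeVector v ∈ Γ := by
  have e := eq_add_det2_smul hwv hwv'
  have := P.add_edgeVector_smul_mem (m := 0) (n := det2 w w') (t := 1) hwv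
    (by simpa using fun v' hv' => P.le hw hv') (by rw [← e]; exact fun v' hv' => P.le hw' hv')
    (by norm_num) h
  simpa using this

/-- Among the constraints tight at `w`, take the one furthest in the direction of `edgeVector w`.
Moving `w` slightly along its edge then stays in the dual polygon, so that edge has a lattice point
beyond `w`, and by convexity `w + edgeVector v` is one. -/
theorem exists_succ {w : Fin 2 → ℤ} (hw : w ∈ Γ) :
    ∃ v ∈ V, w ⬝ᵥ v = -1 ∧ w + edgeVector v ∈ Γ := by
  classical
  obtain ⟨v, hv, hmax⟩ := (V.filter fun v => w ⬝ᵥ v = -1).exists_max_image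
    (fun v => edgeVector w ⬝ᵥ v) (by
      obtain ⟨v, hv, h⟩ := P.exists_tight hw
      exact ⟨v, Finset.mem_filter.2 ⟨hv, h⟩⟩)
  rw [Finset.mem_filter] at hv
  have hdet : ∀ v' ∈ V, w ⬝ᵥ v' = -1 → det2 v v' ≤ 0 := by
    intro v' hv' h
    have h1 := hmax v' (Finset.mem_filter.2 ⟨hv', h⟩)
    have e := eq_add_det2_smul (w := v) (w' := v') (v := w) (by rw [dotProduct_comm]; exact hv.2)
      (by rw [dotProduct_comm]; exact h)
    have h2 : edgeVector w ⬝ᵥ v' = edgeVector w ⬝ᵥ v + det2 v v' * (w ⬝ᵥ w) := by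
      conv_lhs => rw [e]
      rw [dotProduct_add, dotProduct_smul, smul_eq_mul]
      simp [edgeVector, dotProduct, Fin.sum_univ_two]
      left
      ring
    have h3 : 0 < w ⬝ᵥ w := by
      refine lt_of_le_of_ne (Finset.sum_nonneg fun i _ => mul_self_nonneg _) fun h => ?_
      exact ((P.mem_iff w).1 hw).1 (dotProduct_self_eq_zero.1 h.symm)
    by_contra! hpos
    nlinarith [mul_pos hpos h3]
  obtain ⟨ε, hε, hle⟩ := exists_pos_forall_neg_one_le V (fun v' => toPlane w ⬝ᵥ toPlane v')
    (fun v' => toPlane (edgeVector v) ⬝ᵥ toPlane v') (by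
      intro v' hv'
      rw [toPlane_dotProduct, toPlane_dotProduct, edgeVector_dotProduct]
      rcases (P.le hw hv').lt_or_eq with h | h
      · exact Or.inl (by exact_mod_cast h)
      · refine Or.inr ⟨by exact_mod_cast h.le, ?_⟩
        have := hdet v' hv' h.symm
        exact_mod_cast (by omega : (0 : ℤ) ≤ -det2 v v'))
  have e : ∀ x, (toPlane w + ε • toPlane (edgeVector v)) ⬝ᵥ x =
      toPlane w ⬝ᵥ x + ε * (toPlane (edgeVector v) ⬝ᵥ x) := fun x => by
    rw [add_dotProduct, smul_dotProduct, smul_eq_mul]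
  obtain ⟨w', hw', hwv', h⟩ := P.exists_tight_le (fun v' hv' => by rw [e]; exact hle v' hv') hv.1
    (by
      rw [e, toPlane_dotProduct, toPlane_dotProduct, hv.2, edgeVector_dotProduct, det2_self]
      norm_num) (toPlane (edgeVector w))
  have hneg : ∀ x, toPlane (edgeVector w) ⬝ᵥ toPlane x = -((det2 w x : ℤ) : ℝ) := fun x => by
    rw [toPlane_dotProduct, edgeVector_dotProduct]
    push_cast
    rfl
  rw [dotProduct_add, dotProduct_smul, hneg, hneg, hneg, det2_self] at h
  have h1 : det2 w (edgeVector v) = 1 := by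
    have := det2_add_edgeVector w v
    rw [hv.2] at this
    simp only [det2, Pi.add_apply] at this ⊢
    linarith
  rw [h1] at h
  have h2 : 0 < det2 w w' := by
    have : (0 : ℝ) < det2 w w' := by
      simp at h
      linarith
    exact_mod_cast this
  exact ⟨v, hv.1, hv.2, P.add_edgeVector_mem hw hv.2 hw' hwv' h2⟩

/-- A functional separating the extremal vertex `v` from the others, scaled to be `-1` at `v`, is a
point of the dual polygon where only `v` is tight. It can be moved both ways along the dual edge,
which therefore has lattice points on both sides of it. -/
theorem exists_edge {v : Fin 2 → ℤ} (hv : v ∈ V) :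
    ∃ w ∈ Γ, w ⬝ᵥ v = -1 ∧ w + edgeVector v ∈ Γ := by
  have hclosed : IsClosed (polygon (V.erase v)) :=
    (((V.erase v).finite_toSet.image toPlane).isCompact_convexHull (𝕜 := ℝ)).isClosed
  obtain ⟨f, s, h1, h2⟩ := geometric_hahn_banach_point_closed (convex_convexHull ℝ _) hclosed
    (P.notMem_erase v hv)
  obtain ⟨a, ha⟩ := exists_clm_eq_dotProduct f
  have hlt : ∀ v' ∈ V, v' ≠ v → a ⬝ᵥ toPlane v < a ⬝ᵥ toPlane v' := fun v' hv' hne => by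
    rw [← ha, ← ha]
    exact h1.trans (h2 _ (toPlane_mem_polygon (Finset.mem_erase.2 ⟨hne, hv'⟩)))
  have hv0 : toPlane v ≠ 0 := by
    intro h0
    obtain ⟨v', hv', h⟩ := exists_dotProduct_neg P.zero_mem_interior (a := ![1, 0]) (by
      intro h; simpa using congrFun h 0)
    refine P.notMem_erase v hv ?_
    rw [h0]
    by_contra hcon
    rw [← h0] at hcon
    rw [h0] at hlt
    by_cases ha0 : a = 0
    · have := hlt v' hv' (by rintro rfl; rw [h0] at h; simp at h)
      simp [ha0] at this
    · obtain ⟨u, hu, hu'⟩ := exists_dotProduct_neg P.zero_mem_interior ha0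
      have := hlt u hu (by rintro rfl; rw [h0] at hu'; simp at hu')
      rw [dotProduct_zero] at this
      linarith
  have hav : a ⬝ᵥ toPlane v < 0 := by
    by_cases ha0 : a = 0
    · obtain ⟨v', hv', h⟩ := exists_dotProduct_neg P.zero_mem_interior hv0
      have hne : v' ≠ v := by
        rintro rfl
        exact absurd h (dotProduct_self_pos hv0).le.not_gt
      simpa [ha0] using hlt v' hv' hne
    · obtain ⟨u, hu, hu'⟩ := exists_dotProduct_neg P.zero_mem_interior ha0
      by_cases h : u = v
      · rwa [h] at hu'
      · exact (hlt u hu h).trans hu'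
  set z : Fin 2 → ℝ := (-(a ⬝ᵥ toPlane v))⁻¹ • a with hz
  have hzv : z ⬝ᵥ toPlane v = -1 := by
    rw [hz, smul_dotProduct, smul_eq_mul, inv_neg, neg_mul, inv_mul_cancel₀ hav.ne]
  have hzv' : ∀ v' ∈ V, v' ≠ v → -1 < z ⬝ᵥ toPlane v' := by
    intro v' hv' hne
    rw [← hzv, hz, smul_dotProduct, smul_dotProduct, smul_eq_mul, smul_eq_mul]
    exact mul_lt_mul_of_pos_left (hlt v' hv' hne) (inv_pos.2 (neg_pos.2 hav))
  clear_value z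
  have hself : toPlane (edgeVector v) ⬝ᵥ toPlane v = 0 := by
    rw [toPlane_dotProduct, edgeVector_dotProduct, det2_self]
    simp
  have key : ∀ t : ℝ, t ≠ 0 → ∃ w ∈ Γ, w ⬝ᵥ v = -1 ∧
      t * (toPlane (edgeVector v) ⬝ᵥ toPlane w) < t * (toPlane (edgeVector v) ⬝ᵥ z) := by
    intro t ht
    obtain ⟨ε, hε, hle⟩ := exists_pos_forall_neg_one_le V (fun v' => z ⬝ᵥ toPlane v')
      (fun v' => -t * (toPlane (edgeVector v) ⬝ᵥ toPlane v')) (by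
        intro v' hv'
        by_cases h : v' = v
        · subst h
          exact Or.inr ⟨hzv.ge, by rw [hself, mul_zero]⟩
        · exact Or.inl (hzv' v' hv' h))
    have e : ∀ x, (z + (ε * -t) • toPlane (edgeVector v)) ⬝ᵥ x =
      z ⬝ᵥ x + ε * (-t * (toPlane (edgeVector v) ⬝ᵥ x)) := fun x => by
      rw [add_dotProduct, smul_dotProduct, smul_eq_mul, mul_assoc]
    obtain ⟨w, hw, hwv, h⟩ := P.exists_tight_le (fun v' hv' => by rw [e]; exact hle v' hv') hv
      (by rw [e, hself, hzv]; simp) (t • toPlane (edgeVector v))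
    refine ⟨w, hw, hwv, ?_⟩
    have hne : toPlane (edgeVector v) ≠ 0 := by
      intro h
      refine hv0 ?_
      have h0 := congrFun h 0
      have h1 := congrFun h 1
      simp [toPlane, edgeVector] at h0 h1
      funext i
      fin_cases i <;> simp [toPlane, h0, h1]
    rw [smul_dotProduct, smul_dotProduct, dotProduct_add, dotProduct_smul] at h
    simp only [smul_eq_mul] at h
    generalize toPlane (edgeVector v) ⬝ᵥ toPlane w = A at h ⊢
    have := mul_pos (mul_pos hε (sq_pos_of_ne_zero ht)) (dotProduct_self_pos hne)
    nlinarith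
  obtain ⟨w, hw, hwv, h⟩ := key 1 one_ne_zero
  obtain ⟨w', hw', hwv', h'⟩ := key (-1) (by norm_num)
  refine ⟨w, hw, hwv, P.add_edgeVector_mem hw hwv hw' hwv' ?_⟩
  have h3 : (0 : ℝ) < toPlane (edgeVector v) ⬝ᵥ toPlane w' -
    toPlane (edgeVector v) ⬝ᵥ toPlane w := by linarith
  rw [toPlane_dotProduct, toPlane_dotProduct] at h3
  have h4 : 0 < edgeVector v ⬝ᵥ w' - edgeVector v ⬝ᵥ w := by exact_mod_cast h3
  rw [← dotProduct_sub] at h4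
  have e := eq_add_det2_smul hwv hwv'
  rw [show w' - w = det2 w w' • edgeVector v by rw [sub_eq_iff_eq_add']; exact e,
    dotProduct_smul, smul_eq_mul] at h4
  have h5 : 0 ≤ edgeVector v ⬝ᵥ edgeVector v := Finset.sum_nonneg fun i _ => mul_self_nonneg _
  by_contra! hcon
  nlinarith

/-- The vertex `v` minimizing the pairing with `u` selects the edge met by the ray through `u`, and
division with remainder selects the primitive segment of this edge. -/
theorem cover {u : Fin 2 → ℤ} (hu : u ≠ 0) : ∃ w ∈ Γ, ∃ a b : ℕ,
    (b = 0 ∨ ∃ v ∈ V, w ⬝ᵥ v = -1 ∧ w + edgeVector v ∈ Γ ∧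
      u = (a + 1) • w + b • (w + edgeVector v)) ∧ (b = 0 → u = (a + 1) • w) := by
  obtain ⟨v₁, hv₁, hneg⟩ := exists_dotProduct_neg P.zero_mem_interior (a := toPlane u) fun h =>
    hu (toPlane_injective (h.trans toPlane_zero.symm))
  obtain ⟨v, hv, hmin⟩ := V.exists_min_image (fun v => u ⬝ᵥ v) ⟨v₁, hv₁⟩
  obtain ⟨k, hk⟩ : ∃ k : ℤ, u ⬝ᵥ v = -k := ⟨-(u ⬝ᵥ v), by ring⟩
  rw [toPlane_dotProduct] at hneg
  have hneg' : u ⬝ᵥ v₁ < 0 := by exact_mod_cast hneg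
  have hk0 : 0 < k := by have := hmin v₁ hv₁; omega
  have hkR : (0 : ℝ) < k := by exact_mod_cast hk0
  set z : Fin 2 → ℝ := (k : ℝ)⁻¹ • toPlane u with hz
  have hz1 : ∀ v' ∈ V, -1 ≤ z ⬝ᵥ toPlane v' := by
    intro v' hv'
    have : -(k : ℝ) ≤ ((u ⬝ᵥ v' : ℤ) : ℝ) := by
      have := hmin v' hv'
      rw [hk] at this
      exact_mod_cast this
    rw [hz, smul_dotProduct, toPlane_dotProduct, smul_eq_mul, inv_mul_eq_div, le_div_iff₀ hkR]
    linarith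
  have hz2 : z ⬝ᵥ toPlane v = -1 := by
    rw [hz, smul_dotProduct, toPlane_dotProduct, smul_eq_mul, hk]
    push_cast
    field_simp
  obtain ⟨w₁, hw₁, hwv₁, h₁⟩ := P.exists_tight_le hz1 hv hz2 0
  have hdet : ∀ x, toPlane (edgeVector w₁) ⬝ᵥ toPlane x = -((det2 w₁ x : ℤ) : ℝ) := fun x => by
    rw [toPlane_dotProduct, edgeVector_dotProduct]
    push_cast
    rfl
  obtain ⟨w₂, hw₂, hwv₂, h₂⟩ := P.exists_tight_le hz1 hv hz2 (toPlane (edgeVector w₁))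
  obtain ⟨w₃, hw₃, hwv₃, h₃⟩ := P.exists_tight_le hz1 hv hz2 (-toPlane (edgeVector w₁))
  rw [neg_dotProduct, neg_dotProduct] at h₃
  rw [hz, dotProduct_smul, smul_eq_mul, hdet, hdet] at h₂ h₃
  rw [neg_neg, mul_neg, neg_neg] at h₃
  set T := det2 w₁ u with hT
  have h₂' : T ≤ k * det2 w₁ w₂ := by
    have : (T : ℝ) ≤ k * det2 w₁ w₂ := by
      have := mul_le_mul_of_nonneg_left h₂ hkR.le
      rw [← mul_assoc, mul_inv_cancel₀ hkR.ne'] at this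
      linarith
    exact_mod_cast this
  have h₃' : k * det2 w₁ w₃ ≤ T := by
    have : (k : ℝ) * det2 w₁ w₃ ≤ T := by
      have := mul_le_mul_of_nonneg_left h₃ hkR.le
      rw [← mul_assoc, mul_inv_cancel₀ hkR.ne'] at this
      linarith
    exact_mod_cast this
  have hu' : u = k • w₁ + T • edgeVector v := by
    simp only [dotProduct, Fin.sum_univ_two] at hwv₁ hk
    funext i
    fin_cases i <;> simp [edgeVector, hT, det2]
    · linear_combination u 0 * hwv₁ - w₁ 0 * hk
    · linear_combination u 1 * hwv₁ - w₁ 1 * hk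
  have hdm := Int.mul_ediv_add_emod T k
  have hr0 := Int.emod_nonneg T hk0.ne'
  have hrk := Int.emod_lt_of_pos T hk0
  have hle₂ : ∀ v' ∈ V, -1 ≤ (w₁ + det2 w₁ w₂ • edgeVector v) ⬝ᵥ v' := by
    rw [← eq_add_det2_smul hwv₁ hwv₂]
    exact fun v' hv' => P.le hw₂ hv'
  have hle₃ : ∀ v' ∈ V, -1 ≤ (w₁ + det2 w₁ w₃ • edgeVector v) ⬝ᵥ v' := by
    rw [← eq_add_det2_smul hwv₁ hwv₃]
    exact fun v' hv' => P.le hw₃ hv'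
  have hf₃ : det2 w₁ w₃ ≤ T / k := by
    rw [Int.le_ediv_iff_mul_le hk0]
    linarith
  have hf₂ : T / k ≤ det2 w₁ w₂ := by
    have : k * (T / k) ≤ k * det2 w₁ w₂ := by linarith
    exact le_of_mul_le_mul_left this hk0
  have hmem := P.add_edgeVector_smul_mem hwv₁ hle₃ hle₂ hf₃ hf₂
  -- From `u = k w₁ + T e` and `T = k (T / k) + r`, where `e = edgeVector v`, one gets `u = (k - r)
  -- w + r (w + e)` with `w = w₁ + (T / k) e`. Since `r < k`, the first coefficient is positive.
  obtain ⟨a, ha⟩ : ∃ a : ℕ, k - T % k = a + 1 := ⟨(k - T % k - 1).toNat, by omega⟩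
  obtain ⟨b, hb⟩ : ∃ b : ℕ, T % k = b := ⟨(T % k).toNat, by omega⟩
  have hfin : u = (a + 1) • (w₁ + (T / k) • edgeVector v) +
      b • (w₁ + (T / k) • edgeVector v + edgeVector v) := by
    rw [hu']
    have ha' : (a : ℤ) = k - T % k - 1 := by omega
    funext i
    simp only [Pi.add_apply, Pi.smul_apply, smul_eq_mul, ← natCast_zsmul]
    push_cast
    rw [ha', ← hb]
    linear_combination (-edgeVector v i) * hdm
  refine ⟨_, hmem, a, b, ?_, fun hb0 => ?_⟩
  · rw [or_iff_not_imp_left]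
    intro hb0
    refine ⟨v, hv, ?_, ?_, hfin⟩
    · rw [add_dotProduct, smul_dotProduct, edgeVector_dotProduct, det2_self, hwv₁]
      simp
    · have hlt : T / k + 1 ≤ det2 w₁ w₂ := by
        have : k * (T / k) < k * det2 w₁ w₂ := by omega
        exact lt_of_mul_lt_mul_left this hk0.le
      have := P.add_edgeVector_smul_mem hwv₁ hle₃ hle₂ (t := T / k + 1) (by omega) hlt
      rwa [add_smul, one_smul, ← add_assoc] at this
  · rw [hb0, zero_smul, add_zero] at hfin
    exact hfin

theorem exists_isFan : ∃ σ, IsFan V Γ σ := by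
  classical
  have h := fun w : Γ => P.exists_succ w.2
  choose ν hν htight hmem using h
  refine ⟨fun w => if hw : w ∈ Γ then w + edgeVector (ν ⟨w, hw⟩) else 0, P.mem_iff, fun w hw => ?_,
    fun w hw => ?_, fun w hw => ?_, fun v hv => ?_, fun u hu => ?_⟩
  · rw [dif_pos hw]
    exact hmem ⟨w, hw⟩
  · rw [dif_pos hw, det2_add_edgeVector, htight ⟨w, hw⟩]
    norm_num
  · rw [dif_pos hw, edgeDual_add_edgeVector]
    exact hν ⟨w, hw⟩
  · obtain ⟨w, hw, h1, h2⟩ := P.exists_edge hv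
    refine ⟨w, hw, ?_⟩
    rw [dif_pos hw, edgeDual_add_edgeVector]
    -- At most one edge leaves `w` counterclockwise, so the chosen `ν` agrees with any other
    -- witness.
    exact eq_of_add_edgeVector_mem h1 (htight ⟨w, hw⟩) (P.le h2 (hν ⟨w, hw⟩))
      (P.le (hmem ⟨w, hw⟩) hv)
  · obtain ⟨w, hw, a, b, h1, h2⟩ := P.cover hu
    refine ⟨w, hw, a, b, ?_⟩
    rcases h1 with hb | ⟨v, hv, h3, h4, h5⟩
    · rw [h2 hb, hb]
      simp
    · rw [dif_pos hw, ← eq_of_add_edgeVector_mem h3 (htight ⟨w, hw⟩) (P.le h4 (hν ⟨w, hw⟩))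
        (P.le (hmem ⟨w, hw⟩) hv)]
      exact h5

/-- The bipolar theorem. -/
theorem mem_polygon_of_forall_le {z : Fin 2 → ℝ} (hz : ∀ w ∈ Γ, -1 ≤ toPlane w ⬝ᵥ z) :
    z ∈ polygon V := by
  by_contra hcon
  have hclosed : IsClosed (polygon V) :=
    ((V.finite_toSet.image toPlane).isCompact_convexHull (𝕜 := ℝ)).isClosed
  obtain ⟨f, s, h1, h2⟩ := geometric_hahn_banach_point_closed (convex_convexHull ℝ _) hclosed hcon
  obtain ⟨a, ha⟩ := exists_clm_eq_dotProduct f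
  have hs : s < 0 := by
    have := h2 0 (interior_subset P.zero_mem_interior)
    rwa [map_zero] at this
  have hmem := P.mem_polygon ((-s)⁻¹ • a) fun v hv => by
    have := h2 _ (toPlane_mem_polygon hv)
    rw [ha] at this
    rw [smul_dotProduct, smul_eq_mul, inv_mul_eq_div, le_div_iff₀ (by linarith)]
    linarith
  have h3 := le_dotProduct_of_mem_polygon (a := z) (c := -1) hmem fun w hw => by
    rcases Finset.mem_insert.1 hw with rfl | hw
    · rw [toPlane_zero, dotProduct_zero]
      norm_num
    · rw [dotProduct_comm]
      exact hz w hw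
  rw [dotProduct_smul, dotProduct_comm, smul_eq_mul, inv_mul_eq_div,
    le_div_iff₀ (by linarith)] at h3
  rw [ha] at h1
  linarith

theorem exists_dual_dotProduct_neg {a : Fin 2 → ℤ} (ha : a ≠ 0) : ∃ w ∈ Γ, w ⬝ᵥ a < 0 := by
  by_contra! hcon
  obtain ⟨ε, hε, hle⟩ := exists_pos_forall_neg_one_le V (fun _ => 0)
    (fun v => -toPlane a ⬝ᵥ toPlane v) fun v _ => Or.inl (by norm_num)
  have hmem := P.mem_polygon (ε • -toPlane a) fun v hv => by
    rw [smul_dotProduct, smul_eq_mul]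
    simpa using hle v hv
  have h1 := le_dotProduct_of_mem_polygon (a := toPlane a) (c := 0) hmem fun w hw => by
    rcases Finset.mem_insert.1 hw with rfl | hw
    · rw [toPlane_zero, dotProduct_zero]
    · rw [dotProduct_comm, toPlane_dotProduct]
      exact_mod_cast hcon w hw
  have h2 : toPlane a ≠ 0 := fun h => ha (toPlane_injective (h.trans toPlane_zero.symm))
  rw [dotProduct_smul, dotProduct_neg, smul_eq_mul] at h1
  nlinarith [mul_pos hε (dotProduct_self_pos h2)]

end IsPolarPair

end Polygon

/-! ### Volume minimization -/

section Minimization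

theorem toPlane_neg (w : Fin 2 → ℤ) : toPlane (-w) = -toPlane w := by
  funext i
  simp [toPlane]

theorem toPlane_smul_add_smul (a b : ℕ) (w w' : Fin 2 → ℤ) :
    toPlane (a • w + b • w') = (a : ℝ) • toPlane w + (b : ℝ) • toPlane w' := by
  funext i
  simp [toPlane]

variable {V Γ : Finset (Fin 2 → ℤ)} {σ : (Fin 2 → ℤ) → Fin 2 → ℤ}

/-- The weights with total `∑ b_v = 2` in terms of the affine functions they define. -/
theorem exists_pointWeight_eq (h0 : 0 ∈ interior (polygon V)) (β : Fin 2 → ℝ) :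
    ∃ b : V → ℝ, ∀ w, pointWeight V b w = 2 + β ⬝ᵥ toPlane w := by
  obtain ⟨δ, hδ, h⟩ := exists_smul_mem_of_mem_interior h0 β
  obtain ⟨l, -, hl, hlβ⟩ := mem_polygon_iff.1 h
  obtain ⟨m, -, hm, hm0⟩ := mem_polygon_iff.1 (interior_subset h0)
  have key : ∀ (l : (Fin 2 → ℤ) → ℝ) (z : Fin 2 → ℝ), ∑ v ∈ V, l v = 1 →
      ∑ v ∈ V, l v • toPlane v = z → ∀ w, pointWeight V (fun v => l v) w = 1 + z ⬝ᵥ toPlane w := by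
    rintro l _ hl rfl w
    rw [pointWeight, ← hl, sum_dotProduct, ← Finset.sum_add_distrib,
      Finset.sum_coe_sort V (fun v => l v * ((w ⬝ᵥ v + 1 : ℤ) : ℝ))]
    refine Finset.sum_congr rfl fun v _ => ?_
    rw [smul_dotProduct, toPlane_dotProduct, smul_eq_mul, dotProduct_comm v w]
    push_cast
    ring
  -- `l` represents `δ • β` and `m` represents the origin; `m` corrects the total weight to 2
  -- without changing the linear part.
  refine ⟨δ⁻¹ • (fun v : V => l v) + (2 - δ⁻¹) • (fun v : V => m v), fun w => ?_⟩
  rw [pointWeight_add, pointWeight_smul, pointWeight_smul, key l _ hl hlβ, key m _ hm hm0,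
    smul_dotProduct, zero_dotProduct, smul_eq_mul]
  field_simp
  ring

theorem exists_eq_pointWeight (b : V → ℝ) :
    ∃ β : Fin 2 → ℝ, ∀ w, pointWeight V b w = pointWeight V b 0 + β ⬝ᵥ toPlane w := by
  refine ⟨∑ v : V, b v • toPlane v, fun w => ?_⟩
  rw [pointWeight_zero, sum_dotProduct, ← Finset.sum_add_distrib, pointWeight]
  refine Finset.sum_congr rfl fun v _ => ?_
  rw [smul_dotProduct, toPlane_dotProduct, smul_eq_mul, dotProduct_comm v.1 w]
  push_cast
  ring

namespace IsFan

variable (F : IsFan V Γ σ)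
include F

/-- Every `u` is a nonnegative combination of two points of `Γ`; applied to suitable `u`, this makes
the region of admissible weights bounded. -/
theorem exists_neg_le_dotProduct (u : Fin 2 → ℤ) : ∃ C : ℝ, ∀ β : Fin 2 → ℝ,
    (∀ w ∈ Γ, 0 ≤ 2 + β ⬝ᵥ toPlane w) → -C ≤ β ⬝ᵥ toPlane u := by
  by_cases hu : u = 0
  · refine ⟨0, fun β _ => ?_⟩
    rw [hu, toPlane_zero, dotProduct_zero, neg_zero]
  · obtain ⟨w, hw, a, b, rfl⟩ := F.cover u hu
    refine ⟨2 * (a + 1 + b), fun β hβ => ?_⟩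
    rw [toPlane_smul_add_smul, dotProduct_add, dotProduct_smul, dotProduct_smul, smul_eq_mul,
      smul_eq_mul]
    push_cast
    have h1 := mul_nonneg (by positivity : (0 : ℝ) ≤ a + 1) (hβ w hw)
    have h2 := mul_nonneg (Nat.cast_nonneg b : (0 : ℝ) ≤ b) (hβ _ (F.succ_mem w hw))
    linarith

/-- The volume depends only on the linear part `β` of the weights, which ranges over a bounded open
polygon, and it blows up at the boundary; so it suffices to minimize over a compact part of the
interior. -/
theorem exists_isRCharge (h0 : 0 ∈ interior (polygon V)) : ∃ r : V → ℝ, IsRCharge V r := by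
  set q : (Fin 2 → ℝ) → (Fin 2 → ℤ) → ℝ := fun β w => 2 + β ⬝ᵥ toPlane w with hq
  set φ : (Fin 2 → ℝ) → ℝ := fun β => ∑ w : Γ, (q β w)⁻¹ * (q β (σ w))⁻¹ with hφ
  have hqc : ∀ w, Continuous fun β => q β w := fun w => by
    simp only [hq, dotProduct]
    fun_prop
  choose C hC using F.exists_neg_le_dotProduct
  obtain ⟨M, hM0, hM⟩ : ∃ M : ℝ, 0 < M ∧ ∀ β, (∀ w ∈ Γ, 0 ≤ q β w) → ∀ w ∈ Γ, q β w ≤ M := by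
    refine ⟨2 + ∑ w ∈ Γ, |C (-w)|, by positivity, fun β hβ w hw => ?_⟩
    have h1 := hC (-w) β hβ
    rw [toPlane_neg, dotProduct_neg] at h1
    have h2 := Finset.single_le_sum (f := fun w => |C (-w)|) (fun _ _ => abs_nonneg _) hw
    have h3 := le_abs_self (C (-w))
    simp only [hq]
    linarith
  have hq0 : ∀ w, q 0 w = 2 := fun w => by simp [hq]
  have hφ0 : 0 < φ 0 := by
    have : Nonempty Γ := F.nonempty.to_subtype
    refine Finset.sum_pos (fun w _ => ?_) Finset.univ_nonempty
    rw [hq0, hq0]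
    norm_num
  -- If some `q β w < (φ 0 * M)⁻¹`, then the bound `M` on the next weight makes a single summand of
  -- `φ β` exceed `φ 0`. The cap 2 keeps `0` in `K`.
  set δ := min (φ 0 * M)⁻¹ 2 with hδ
  have hδ0 : 0 < δ := lt_min (by positivity) two_pos
  set K : Set (Fin 2 → ℝ) := {β | ∀ w ∈ Γ, δ ≤ q β w} with hK
  have hKpos : ∀ β ∈ K, ∀ w ∈ Γ, 0 < q β w := fun β hβ w hw => hδ0.trans_le (hβ w hw)
  have hKc : IsCompact K := by
    refine Metric.isCompact_of_isClosed_isBounded ?_ ?_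
    · have : K = ⋂ w ∈ Γ, {β | δ ≤ q β w} := by
        ext β
        simp [hK]
      rw [this]
      exact isClosed_biInter fun w _ => isClosed_le continuous_const (hqc w)
    · refine (Metric.isBounded_Icc (fun i : Fin 2 => -C (Pi.single i 1))
        (fun i => C (-Pi.single i 1))).subset fun β hβ => ?_
      have hnn : ∀ w ∈ Γ, 0 ≤ q β w := fun w hw => (hKpos β hβ w hw).le
      have e : ∀ i, β ⬝ᵥ toPlane (Pi.single i 1) = β i := fun i => by
        have : toPlane (Pi.single i 1) = Pi.single i 1 := by
          funext j
          by_cases h : j = i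
          · subst h
            simp [toPlane]
          · simp [toPlane, h]
        rw [this, dotProduct_single, mul_one]
      refine ⟨fun i => ?_, fun i => ?_⟩
      · have := hC (Pi.single i 1) β hnn
        rwa [e] at this
      · have := hC (-Pi.single i 1) β hnn
        rw [toPlane_neg, dotProduct_neg, e] at this
        linarith
  have h0K : (0 : Fin 2 → ℝ) ∈ K := fun w _ => by
    rw [hq0]
    exact min_le_right _ _
  have hcont : ContinuousOn φ K := by
    refine continuousOn_finsetSum _ fun w _ => ContinuousOn.mul ?_ ?_
    · exact (hqc w).continuousOn.inv₀ fun β hβ => (hKpos β hβ w w.2).ne'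
    · exact (hqc _).continuousOn.inv₀ fun β hβ => (hKpos β hβ _ (F.succ_mem w w.2)).ne'
  obtain ⟨β₀, hβ₀, hmin⟩ := hKc.exists_isMinOn ⟨0, h0K⟩ hcont
  have hmin' : ∀ β, (∀ w ∈ Γ, 0 < q β w) → φ β₀ ≤ φ β := by
    intro β hβ
    by_cases hβK : β ∈ K
    · exact hmin hβK
    refine (hmin h0K).trans ?_
    by_contra! hlt
    refine hβK fun w hw => (min_le_left _ _).trans ?_
    have h1 := hβ w hw
    have h2 := hβ _ (F.succ_mem w hw)
    have h3 := hM β (fun w hw => (hβ w hw).le) _ (F.succ_mem w hw)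
    have h4 : (q β w)⁻¹ * (q β (σ w))⁻¹ ≤ φ β :=
      Finset.single_le_sum (f := fun w : Γ => (q β w)⁻¹ * (q β (σ w))⁻¹)
        (fun x _ => mul_nonneg (inv_nonneg.2 (hβ x x.2).le)
          (inv_nonneg.2 (hβ _ (F.succ_mem x x.2)).le)) (Finset.mem_univ (⟨w, hw⟩ : Γ))
    rw [inv_le_comm₀ (by positivity) h1]
    calc (q β w)⁻¹ = (q β w)⁻¹ * (q β (σ w))⁻¹ * q β (σ w) := by field_simp
      _ ≤ φ 0 * M := mul_le_mul (h4.trans hlt.le) h3 h2.le hφ0.le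
  obtain ⟨r, hr⟩ := exists_pointWeight_eq h0 β₀
  have hr0 : pointWeight V r 0 = 2 := by rw [hr, toPlane_zero, dotProduct_zero, add_zero]
  refine ⟨r, F.isRCharge_iff.2 ⟨F.isReeb_iff.2 ⟨fun w hw => ?_, hr0⟩, fun b hb => ?_⟩⟩
  · rcases Finset.mem_insert.1 hw with rfl | hw
    · rw [hr0]
      norm_num
    · rw [hr]
      exact hKpos β₀ hβ₀ w hw
  · obtain ⟨hpos, hb0⟩ := F.isReeb_iff.1 hb
    obtain ⟨β, hβ⟩ := exists_eq_pointWeight b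
    rw [hb0] at hβ
    have := hmin' β fun w hw => by
      have := hpos w (Finset.mem_insert_of_mem hw)
      rwa [hβ] at this
    simpa only [conePhi, hr, hβ] using this

end IsFan

/-! ### Tangent plane bounds for the volume. -/

/-- The inequality between the arithmetic and the harmonic mean behind the tangent plane bound. -/
theorem three_sub_sub_le {a b : ℝ} (ha : 0 < a) (hb : 0 < b) : 3 - a - b ≤ a⁻¹ * b⁻¹ := by
  rw [← mul_inv, ← one_div, le_div_iff₀ (by positivity)]
  nlinarith [mul_nonneg (by positivity : 0 ≤ a + b + 1) (sq_nonneg (a + b - 2)),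
    mul_nonneg (by positivity : 0 ≤ a + b) (sq_nonneg (a - b)), sq_nonneg (a - b),
    mul_pos ha hb]

theorem eq_one_of_inv_mul_inv_le {a b : ℝ} (ha : 0 < a) (hb : 0 < b)
    (h : a⁻¹ * b⁻¹ ≤ 3 - a - b) : a = 1 ∧ b = 1 := by
  rw [← mul_inv, ← one_div, div_le_iff₀ (by positivity)] at h
  have h3 : a + b < 3 := by
    by_contra! hcon
    nlinarith [mul_pos ha hb]
  have h1 : (a + b + 1) * (a + b - 2) ^ 2 ≤ 0 := by
    nlinarith [mul_nonneg (by linarith : 0 ≤ 3 - (a + b)) (sq_nonneg (a - b))]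
  have h2 : a + b = 2 := by
    have : (a + b - 2) ^ 2 = 0 := by
      have := sq_nonneg (a + b - 2)
      by_contra hne
      have h4 : 0 < (a + b - 2) ^ 2 := lt_of_le_of_ne this (Ne.symm hne)
      have : 0 < (a + b + 1) * (a + b - 2) ^ 2 := by positivity
      linarith
    have := pow_eq_zero_iff (two_ne_zero) |>.1 this
    linarith
  have hb' : b = 2 - a := by linarith
  subst hb'
  have : (a - 1) ^ 2 ≤ 0 := by nlinarith
  have h5 : a - 1 = 0 := pow_eq_zero_iff (two_ne_zero) |>.1 (le_antisymm this (sq_nonneg _))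
  constructor <;> linarith

/-- The value at the extremal vertex `v` of the tangent plane to the volume function at `y`. -/
def tangentValue (Γ : Finset (Fin 2 → ℤ)) (σ : (Fin 2 → ℤ) → Fin 2 → ℤ) (y : (Fin 2 → ℤ) → ℝ)
    (v : Fin 2 → ℤ) : ℝ :=
  ∑ w : Γ, (y w)⁻¹ * (y (σ w))⁻¹ * (3 - 2 * (((w.1 ⬝ᵥ v + 1 : ℤ) : ℝ) * (y w)⁻¹ +
    ((σ w ⬝ᵥ v + 1 : ℤ) : ℝ) * (y (σ w))⁻¹))

/-- The graph of `1 / (x x')` lies above its tangent plane at `(y, y')`, by scaling from the point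
`(1, 1)`. -/
theorem inv_mul_inv_ge {x x' y y' : ℝ} (hx : 0 < x) (hx' : 0 < x') (hy : 0 < y) (hy' : 0 < y') :
    y⁻¹ * y'⁻¹ * (3 - x * y⁻¹ - x' * y'⁻¹) ≤ x⁻¹ * x'⁻¹ := by
  have h := three_sub_sub_le (mul_pos hx (inv_pos.2 hy)) (mul_pos hx' (inv_pos.2 hy'))
  have h' := mul_le_mul_of_nonneg_left h (mul_pos (inv_pos.2 hy) (inv_pos.2 hy')).le
  refine h'.trans_eq ?_
  field_simp

/-- Entries of `b` may be negative, but positivity on `Γ` and the bipolar theorem put half of the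
Reeb vector into the polygon. The point weights are thus an average of those with total weight 2
concentrated at a single vertex. -/
theorem exists_sum_mul_eq_pointWeight (P : IsPolarPair V Γ) {b : V → ℝ}
    (hb : ∀ w ∈ Γ, 0 < pointWeight V b w) (hb0 : pointWeight V b 0 = 2) :
    ∃ l : (Fin 2 → ℤ) → ℝ, (∀ v ∈ V, 0 ≤ l v) ∧ ∑ v ∈ V, l v = 1 ∧
      ∀ w, pointWeight V b w = ∑ v ∈ V, l v * (2 * ((w ⬝ᵥ v + 1 : ℤ) : ℝ)) := by
  obtain ⟨β, hβ⟩ := exists_eq_pointWeight b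
  rw [hb0] at hβ
  have hmem : (2 : ℝ)⁻¹ • β ∈ polygon V := P.mem_polygon_of_forall_le fun w hw => by
    have := hb w hw
    rw [hβ, dotProduct_comm] at this
    rw [dotProduct_smul, smul_eq_mul]
    linarith
  obtain ⟨l, h0, h1, h2⟩ := mem_polygon_iff.1 hmem
  refine ⟨l, h0, h1, fun w => ?_⟩
  have e : β ⬝ᵥ toPlane w = 2 * (((2 : ℝ)⁻¹ • β) ⬝ᵥ toPlane w) := by
    rw [smul_dotProduct, smul_eq_mul]
    ring
  rw [hβ, e, ← h2, sum_dotProduct, Finset.mul_sum,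
    show (2 : ℝ) = ∑ v ∈ V, l v * 2 by rw [← Finset.sum_mul, h1, one_mul],
    ← Finset.sum_add_distrib]
  refine Finset.sum_congr rfl fun v _ => ?_
  rw [← Finset.sum_mul, h1, smul_dotProduct, toPlane_dotProduct, smul_eq_mul, dotProduct_comm v w]
  push_cast
  ring

theorem sum_tangent_eq {l : (Fin 2 → ℤ) → ℝ} (hl : ∑ v ∈ V, l v = 1) {b : V → ℝ}
    (hb : ∀ w, pointWeight V b w = ∑ v ∈ V, l v * (2 * ((w ⬝ᵥ v + 1 : ℤ) : ℝ)))
    (y : (Fin 2 → ℤ) → ℝ) :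
    ∑ v ∈ V, l v * tangentValue Γ σ y v = ∑ w : Γ, (y w)⁻¹ * (y (σ w))⁻¹ *
      (3 - pointWeight V b w * (y w)⁻¹ - pointWeight V b (σ w) * (y (σ w))⁻¹) := by
  simp only [tangentValue, Finset.mul_sum]
  rw [Finset.sum_comm]
  refine Finset.sum_congr rfl fun w _ => ?_
  have e : (3 : ℝ) = ∑ v ∈ V, l v * 3 := by rw [← Finset.sum_mul, hl, one_mul]
  rw [hb, hb, Finset.sum_mul, Finset.sum_mul]
  conv_rhs => rw [e]
  rw [← Finset.sum_sub_distrib, ← Finset.sum_sub_distrib, Finset.mul_sum]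
  refine Finset.sum_congr rfl fun v _ => ?_
  ring

/-- A tangent plane to the volume function with values at the extremal vertices that are large
compared to the volume of the grading by GLSM field degree. -/
structure IsGoodTangent (V Γ : Finset (Fin 2 → ℤ)) (σ : (Fin 2 → ℤ) → Fin 2 → ℤ)
    (y : (Fin 2 → ℤ) → ℝ) : Prop where
  pos : ∀ w ∈ Γ, 0 < y w
  eq_of_card : V.card = 3 → ∀ w ∈ Γ, y w = 2 / 3 * pointWeight V (fun _ => 1) w
  -- This bound serves the generator at the origin, the next one the boundary generators, whose
  -- `R`-weight is at least `4/3`.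
  le : ∀ v ∈ V, 27 / (4 * (V.card : ℝ)) * conePhi V Γ σ (fun _ => 1) ≤ tangentValue Γ σ y v
  le_of_card : V.card ≠ 3 → ∀ v ∈ V, ∀ w ∈ Γ, 27 / (2 * (V.card : ℝ)) *
    conePhi V Γ σ (fun _ => 1) * (1 - V.card / (3 * pointWeight V (fun _ => 1) w)) ≤
      tangentValue Γ σ y v

/-- An affine function on a polygon is at least the minimum of its values at the vertices, and
`conePhi` lies above its tangent plane. -/
theorem le_conePhi (P : IsPolarPair V Γ) (F : IsFan V Γ σ) {y : (Fin 2 → ℤ) → ℝ}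
    (hy : ∀ w ∈ Γ, 0 < y w) {c : ℝ} (hc : ∀ v ∈ V, c ≤ tangentValue Γ σ y v) {b : V → ℝ}
    (hb : IsReeb V b) : c ≤ conePhi V Γ σ b := by
  obtain ⟨hpos, hb0⟩ := F.isReeb_iff.1 hb
  have hpos' : ∀ w ∈ Γ, 0 < pointWeight V b w := fun w hw => hpos w (Finset.mem_insert_of_mem hw)
  obtain ⟨l, h0, h1, h2⟩ := exists_sum_mul_eq_pointWeight P hpos' hb0
  calc c = ∑ v ∈ V, l v * c := by rw [← Finset.sum_mul, h1, one_mul]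
    _ ≤ ∑ v ∈ V, l v * tangentValue Γ σ y v :=
      Finset.sum_le_sum fun v hv => mul_le_mul_of_nonneg_left (hc v hv) (h0 v hv)
    _ = _ := sum_tangent_eq h1 h2 y
    _ ≤ _ := Finset.sum_le_sum fun w _ => inv_mul_inv_ge (hpos' w w.2)
      (hpos' _ (F.succ_mem w w.2)) (hy w w.2) (hy _ (F.succ_mem w w.2))

/-- Equality must hold in each summand of the tangent plane bound, and a tangent plane of `1 / (x
x')` touches the graph only at the point of tangency. -/
theorem pointWeight_eq_of_conePhi_le (P : IsPolarPair V Γ) (F : IsFan V Γ σ)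
    {y : (Fin 2 → ℤ) → ℝ} (hy : ∀ w ∈ Γ, 0 < y w) {c : ℝ}
    (hc : ∀ v ∈ V, c ≤ tangentValue Γ σ y v) {b : V → ℝ} (hb : IsReeb V b)
    (hle : conePhi V Γ σ b ≤ c) {w : Fin 2 → ℤ} (hw : w ∈ Γ) : pointWeight V b w = y w := by
  obtain ⟨hpos, hb0⟩ := F.isReeb_iff.1 hb
  have hpos' : ∀ w ∈ Γ, 0 < pointWeight V b w := fun w hw => hpos w (Finset.mem_insert_of_mem hw)
  obtain ⟨l, h0, h1, h2⟩ := exists_sum_mul_eq_pointWeight P hpos' hb0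
  have hle' : ∑ w : Γ, (pointWeight V b w)⁻¹ * (pointWeight V b (σ w))⁻¹ ≤
      ∑ w : Γ, (y w)⁻¹ * (y (σ w))⁻¹ *
        (3 - pointWeight V b w * (y w)⁻¹ - pointWeight V b (σ w) * (y (σ w))⁻¹) := by
    rw [← sum_tangent_eq h1 h2 y]
    calc _ ≤ c := hle
      _ = ∑ v ∈ V, l v * c := by rw [← Finset.sum_mul, h1, one_mul]
      _ ≤ _ := Finset.sum_le_sum fun v hv => mul_le_mul_of_nonneg_left (hc v hv) (h0 v hv)
  have hterm : ∀ w : Γ, (y w)⁻¹ * (y (σ w))⁻¹ *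
        (3 - pointWeight V b w * (y w)⁻¹ - pointWeight V b (σ w) * (y (σ w))⁻¹) ≤
      (pointWeight V b w)⁻¹ * (pointWeight V b (σ w))⁻¹ := fun w => inv_mul_inv_ge (hpos' w w.2)
      (hpos' _ (F.succ_mem w w.2)) (hy w w.2) (hy _ (F.succ_mem w w.2))
  have heq := (Finset.sum_eq_sum_iff_of_le fun w _ => hterm w).1
    (le_antisymm (Finset.sum_le_sum fun w _ => hterm w) hle') ⟨w, hw⟩ (Finset.mem_univ _)
  have hyw := hy w hw
  have hyw' := hy _ (F.succ_mem w hw)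
  have hq := hpos' w hw
  have hq' := hpos' _ (F.succ_mem w hw)
  have h3 := (eq_one_of_inv_mul_inv_le (mul_pos hq (inv_pos.2 hyw))
    (mul_pos hq' (inv_pos.2 hyw')) (by
      refine le_of_mul_le_mul_left ?_ (mul_pos (inv_pos.2 hyw) (inv_pos.2 hyw'))
      rw [heq]
      refine le_of_eq ?_
      field_simp)).1
  rwa [mul_inv_eq_one₀ hyw.ne'] at h3

theorem futaki_le_of_isGoodTangent (P : IsPolarPair V Γ) (F : IsFan V Γ σ)
    {y : (Fin 2 → ℤ) → ℝ} (hy : IsGoodTangent V Γ σ y) {r : V → ℝ} (hr : IsRCharge V r)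
    (h : Generator V) :
    ∃ Fp FR : ℝ,
      HasFutakiInvariant (toricIdeal V) (glsmWeight V fun _ => 1) (testSymmetry h) Fp ∧
      HasFutakiInvariant (toricIdeal V) (glsmWeight V r) (testSymmetry h) FR ∧
      Fp ≤ 8 / 27 * FR ∧ (V.card = 3 → Fp = 8 / 27 * FR) := by
  obtain ⟨hreeb, hmin⟩ := F.isRCharge_iff.1 hr
  obtain ⟨hpos, hr0⟩ := F.isReeb_iff.1 hreeb
  have hcard : pointWeight V (fun _ => 1) 0 = V.card := by simp [pointWeight_zero]
  have hVne : V.Nonempty := by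
    obtain ⟨w, hw⟩ := F.nonempty
    exact ⟨_, F.edgeDual_mem w hw⟩
  have hd : (0 : ℝ) < V.card := by exact_mod_cast hVne.card_pos
  have hone : ∀ w ∈ insert 0 Γ, 0 < pointWeight V (fun _ => 1) w := by
    intro w hw
    rcases Finset.mem_insert.1 hw with rfl | hw'
    · rwa [hcard]
    obtain ⟨v, hv, h1⟩ := F.exists_one_le_dotProduct ((F.mem_iff w).1 hw').1
    refine Finset.sum_pos' (fun v _ => ?_) ⟨⟨v, hv⟩, Finset.mem_univ _, ?_⟩
    · have := F.neg_one_le hw v.1 v.2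
      rw [one_mul]
      exact_mod_cast (by omega : (0 : ℤ) ≤ w ⬝ᵥ v.1 + 1)
    · rw [one_mul]
      exact_mod_cast (by omega : (0 : ℤ) < w ⬝ᵥ v + 1)
  have hΦ := F.conePhi_pos hone
  have hΦr := F.conePhi_pos hpos
  refine ⟨_, _, F.hasFutakiInvariant hone h, F.hasFutakiInvariant hpos h, ?_⟩
  obtain ⟨w, hw, e⟩ := F.exists_glsmWeight_eq h
  have hle := le_conePhi P F hy.pos hy.le hreeb
  rw [e, e, hcard, hr0]
  set Φp := conePhi V Γ σ (fun _ => 1) with hΦp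
  set Φr := conePhi V Γ σ r with hΦr'
  set d : ℝ := (V.card : ℝ) with hd'
  have hQ := hone w hw
  have hq := hpos w hw
  by_cases h3 : V.card = 3
  · have hd3 : d = 3 := by rw [hd', h3]; norm_num
    -- For three vertices the weights `2/3` have total 2 and volume coefficient `9/4 · Φp`, which is
    -- exactly the lower bound; so the minimizer must agree with them on the generators.
    have hreeb' : IsReeb V ((2 / 3 : ℝ) • fun _ => 1) := by
      refine F.isReeb_iff.2 ⟨fun x hx => ?_, ?_⟩
      · rw [pointWeight_smul]
        exact mul_pos (by norm_num) (hone x hx)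
      · rw [pointWeight_smul, hcard, hd3]
        norm_num
    have h1 := hmin _ hreeb'
    rw [conePhi_smul, ← hΦp] at h1
    rw [hd3] at hle
    have hΦeq : Φr = 9 / 4 * Φp := by
      norm_num at h1 hle
      linarith
    have hqw : pointWeight V r w = 2 / 3 * pointWeight V (fun _ => 1) w := by
      rcases Finset.mem_insert.1 hw with rfl | hw'
      · rw [hr0, hcard, hd3]
        norm_num
      · rw [← hy.eq_of_card h3 w hw']
        refine pointWeight_eq_of_conePhi_le P F hy.pos hy.le hreeb ?_ hw'
        rw [← hΦp, ← hd', ← hΦr', hd3, hΦeq]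
        norm_num
    have key : Φp / (4 * d) * (1 - d / (3 * pointWeight V (fun _ => 1) w)) =
        8 / 27 * (Φr / (4 * 2) * (1 - 2 / (3 * pointWeight V r w))) := by
      rw [hqw, hΦeq, hd3]
      field_simp
      ring
    exact ⟨key.le, fun _ => key⟩
  · refine ⟨?_, fun h => absurd h h3⟩
    have e1 : 8 / 27 * (Φr / (4 * 2) * (1 - 2 / (3 * pointWeight V r w))) =
        Φr / 27 * (1 - 2 / (3 * pointWeight V r w)) := by ring
    rw [e1]
    rcases Finset.mem_insert.1 hw with rfl | hw'
    · rw [hr0, hcard]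
      have e2 : d / (3 * d) = 1 / 3 := by field_simp
      have e3 : 27 / (4 * d) * Φp = 27 * (Φp / (4 * d)) := by ring
      rw [e3] at hle
      rw [e2]
      norm_num
      linarith
    · have h1 := le_conePhi P F hy.pos (fun v hv => hy.le_of_card h3 v hv w hw') hreeb
      obtain ⟨v, hv, h2⟩ := F.exists_one_le_dotProduct ((F.mem_iff w).1 hw').1
      have h4 := F.le_pointWeight_of_isRCharge hr hw ⟨v, hv⟩
      have h5 : (2 : ℝ) ≤ ((w ⬝ᵥ v + 1 : ℤ) : ℝ) := by exact_mod_cast (by omega : 2 ≤ w ⬝ᵥ v + 1)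
      have h6 : 4 / 3 ≤ pointWeight V r w := by
        refine le_trans ?_ h4
        linarith
      -- A boundary point has exponent at least 2 for some GLSM field, so its `R`-weight is at least
      -- `4/3`.
      have h7 : 1 / 2 ≤ 1 - 2 / (3 * pointWeight V r w) := by
        have : 2 / (3 * pointWeight V r w) ≤ 1 / 2 := by
          rw [div_le_div_iff₀ (by positivity) (by norm_num)]
          linarith
        linarith
      have h8 := mul_le_mul_of_nonneg_left h7 (by positivity : 0 ≤ Φr / 27)
      refine le_trans ?_ h8
      rw [← hΦp, ← hd', ← hΦr'] at h1
      have e3 : 27 / (2 * d) * Φp * (1 - d / (3 * pointWeight V (fun _ => 1) w)) =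
        54 * (Φp / (4 * d) * (1 - d / (3 * pointWeight V (fun _ => 1) w))) := by
        field_simp
        ring
      rw [e3] at h1
      linarith

end Minimization

/-! ### Tangent planes in coordinates -/

section Coordinates

/-- The pairing of the plane with its dual, in coordinates. -/
def pair (v x : ℤ × ℤ) : ℤ := v.1 * x.1 + v.2 * x.2

/-- The determinant of two vectors in coordinates. -/
def crossing (a b : ℤ × ℤ) : ℤ := a.1 * b.2 - a.2 * b.1

/-- The dual vector that is `-1` on both ends of an edge `e`, if these have determinant `1`. -/
def edgeNormal (e : (ℤ × ℤ) × (ℤ × ℤ)) : ℤ × ℤ := (e.1.2 - e.2.2, e.2.1 - e.1.1)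

/-- The primitive boundary segments of the polygon spanned by the set `G` of its nonzero points. -/
def boundaryEdges (G : Finset (ℤ × ℤ)) : Finset ((ℤ × ℤ) × (ℤ × ℤ)) :=
  (G ×ˢ G).filter fun e => crossing e.1 e.2 = 1 ∧ ∀ x ∈ G, -1 ≤ pair (edgeNormal e) x

/-- The degree of the lattice point `x` in the GLSM fields of the vertices `U`. -/
def totalDegree (U : Finset (ℤ × ℤ)) (x : ℤ × ℤ) : ℤ := ∑ v ∈ U, (pair v x + 1)

/-- The leading coefficient of the Hilbert series in coordinates. -/
def edgePhi (E : Finset ((ℤ × ℤ) × (ℤ × ℤ))) (y : ℤ × ℤ → ℚ) : ℚ :=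
  ∑ e ∈ E, (y e.1)⁻¹ * (y e.2)⁻¹

/-- The value of a tangent plane in coordinates. -/
def edgeTangent (E : Finset ((ℤ × ℤ) × (ℤ × ℤ))) (y : ℤ × ℤ → ℚ) (v : ℤ × ℤ) : ℚ :=
  ∑ e ∈ E, (y e.1)⁻¹ * (y e.2)⁻¹ *
    (3 - 2 * ((pair v e.1 + 1 : ℤ) * (y e.1)⁻¹ + (pair v e.2 + 1 : ℤ) * (y e.2)⁻¹))

/-- The inequalities between a tangent plane and the volume of the grading by degree. -/
def TangentBound (E : Finset ((ℤ × ℤ) × (ℤ × ℤ))) (U G : Finset (ℤ × ℤ)) (y : ℤ × ℤ → ℚ) : Prop :=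
  (∀ g ∈ G, 0 < y g) ∧ ∀ v ∈ U,
    27 / (4 * U.card) * edgePhi E (fun x => totalDegree U x) ≤ edgeTangent E y v ∧
    (U.card ≠ 3 → ∀ g ∈ G, 27 / (2 * U.card) * edgePhi E (fun x => totalDegree U x) *
      (1 - U.card / (3 * totalDegree U g)) ≤ edgeTangent E y v)

instance (E : Finset ((ℤ × ℤ) × (ℤ × ℤ))) (U G : Finset (ℤ × ℤ)) (y : ℤ × ℤ → ℚ) :
    Decidable (TangentBound E U G y) := by
  unfold TangentBound
  infer_instance

/-- Gradients for the tangent planes. -/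
def slopes : List (ℤ × ℤ) :=
  [(0, 0), (-2, 2), (2, -2), (-2, -2), (1, 0), (-1, 0), (0, 2), (1, 1), (-2, 1), (3, -1), (-3, -1),
    (4, -2), (-4, 2)]

/-- There is a good tangent plane if `G` is the set of nonzero points of a reflexive polygon. -/
def HasTangent (G : Finset (ℤ × ℤ)) : Prop :=
  -- The enumeration below also produces sets that do not come from a reflexive polygon; this
  -- condition discards sets with a point that starts no boundary edge.
  (∀ g ∈ G, ∃ e ∈ boundaryEdges G, e.1 = g) →
    if ((boundaryEdges G).image edgeNormal).card = 3 then
      TangentBound (boundaryEdges G) ((boundaryEdges G).image edgeNormal) G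
        (fun x => 2 / 3 * totalDegree ((boundaryEdges G).image edgeNormal) x)
    else ∃ k ∈ slopes, TangentBound (boundaryEdges G) ((boundaryEdges G).image edgeNormal) G
      -- The rational value `2 + (k / 4) · x`: an affine function with value 2 at the origin, like
      -- the weights of a Reeb vector.
      (fun x => (8 + pair k x : ℤ) / 4)

instance (G : Finset (ℤ × ℤ)) : Decidable (HasTangent G) := by
  unfold HasTangent
  infer_instance

/-- The sets of points with first coordinate `-1`, `0` or `1` that are convex in each column. -/
def strip (u l u' : ℤ) (s t : Bool) : Finset (ℤ × ℤ) :=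
  (Finset.Icc (-1) u).image (fun q => ((-1 : ℤ), q)) ∪
    (Finset.Icc l u').image (fun q => ((1 : ℤ), q)) ∪
    (if s then {(0, 1)} else ∅) ∪ (if t then {(0, -1)} else ∅)

/-- The nonzero points of the largest reflexive triangle. -/
def triangle : Finset (ℤ × ℤ) :=
  {(-1, -1), (-1, 0), (-1, 1), (-1, 2), (0, -1), (0, 1), (1, -1), (1, 0), (2, -1)}

set_option maxRecDepth 100000 in
theorem hasTangent_triangle : HasTangent triangle := by decide +kernel

set_option maxRecDepth 100000 in
theorem hasTangent_strip : ∀ u ∈ Finset.Icc (-1 : ℤ) 3, ∀ u' ∈ Finset.Icc (-1 : ℤ) (2 - u),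
    ∀ l ∈ Finset.Icc (-1 : ℤ) u', ∀ s t, HasTangent (strip u l u' s t) := by decide +kernel

/-- The coordinates of a dual vector with respect to the basis `e`, `f`. -/
def dualCoord (e f w : Fin 2 → ℤ) : ℤ × ℤ := (w ⬝ᵥ e, w ⬝ᵥ f)

/-- The coordinates of a vector with respect to the basis `e`, `f`. -/
def coord (e f v : Fin 2 → ℤ) : ℤ × ℤ := (det2 v f, det2 e v)

variable {e f : Fin 2 → ℤ}

theorem pair_coord (hef : det2 e f = 1) (w v : Fin 2 → ℤ) :
    pair (coord e f v) (dualCoord e f w) = w ⬝ᵥ v := by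
  simp only [pair, coord, dualCoord, det2, dotProduct, Fin.sum_univ_two] at hef ⊢
  linear_combination (w 0 * v 0 + w 1 * v 1) * hef

theorem crossing_dualCoord (hef : det2 e f = 1) (w w' : Fin 2 → ℤ) :
    crossing (dualCoord e f w) (dualCoord e f w') = det2 w w' := by
  simp only [crossing, dualCoord, det2, dotProduct, Fin.sum_univ_two] at hef ⊢
  linear_combination (w 0 * w' 1 - w 1 * w' 0) * hef

theorem edgeNormal_dualCoord (w w' : Fin 2 → ℤ) :
    edgeNormal (dualCoord e f w, dualCoord e f w') = coord e f (edgeDual w w') := by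
  simp only [edgeNormal, coord, edgeDual, dualCoord, det2, dotProduct, Fin.sum_univ_two]
  ext <;> simp <;> ring

theorem dualCoord_injective (hef : det2 e f = 1) : Function.Injective (dualCoord e f) := by
  intro w w' h
  have h1 := congrArg Prod.fst h
  have h2 := congrArg Prod.snd h
  simp only [dualCoord, det2, dotProduct, Fin.sum_univ_two] at hef h1 h2
  funext i
  fin_cases i
  · simp only [Fin.zero_eta]
    linear_combination f 1 * h1 - e 1 * h2 - (w 0 - w' 0) * hef
  · simp only [Fin.mk_one]
    linear_combination e 0 * h2 - f 0 * h1 - (w 1 - w' 1) * hef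

theorem coord_injective (hef : det2 e f = 1) : Function.Injective (coord e f) := by
  intro v v' h
  have h1 := congrArg Prod.fst h
  have h2 := congrArg Prod.snd h
  simp only [coord, det2] at hef h1 h2
  funext i
  fin_cases i
  · simp only [Fin.zero_eta]
    linear_combination e 0 * h1 + f 0 * h2 - (v 0 - v' 0) * hef
  · simp only [Fin.mk_one]
    linear_combination e 1 * h1 + f 1 * h2 - (v 1 - v' 1) * hef

theorem add_edgeVector_edgeDual (w w' : Fin 2 → ℤ) : w + edgeVector (edgeDual w w') = w' := by
  funext i
  fin_cases i <;> simp [edgeDual, edgeVector]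

theorem totalDegree_dualCoord (V : Finset (Fin 2 → ℤ)) (hef : det2 e f = 1) (w : Fin 2 → ℤ) :
    ((totalDegree (V.image (coord e f)) (dualCoord e f w) : ℤ) : ℝ) =
      pointWeight V (fun _ => 1) w := by
  rw [totalDegree, Finset.sum_image fun v _ v' _ h => coord_injective hef h, pointWeight]
  simp only [pair_coord hef, one_mul]
  rw [Int.cast_sum]
  exact (Finset.sum_coe_sort V fun v => ((w ⬝ᵥ v + 1 : ℤ) : ℝ)).symm

namespace IsFan

variable {V Γ : Finset (Fin 2 → ℤ)} {σ : (Fin 2 → ℤ) → Fin 2 → ℤ} (F : IsFan V Γ σ)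
include F

/-- The successor is determined by `Γ` alone, so `boundaryEdges` recovers `σ` from the set of
points. -/
theorem eq_succ {w w' : Fin 2 → ℤ} (hw : w ∈ Γ) (hw' : w' ∈ Γ) (hdet : det2 w w' = 1)
    (h : ∀ x ∈ Γ, -1 ≤ x ⬝ᵥ edgeDual w w') : w' = σ w := by
  have e : edgeDual w (σ w) = edgeDual w w' := by
    refine eq_of_add_edgeVector_mem (w := w) ?_ ?_ ?_ ?_
    · rw [dotProduct_edgeDual_left, F.det_succ w hw]
    · rw [dotProduct_edgeDual_left, hdet]
    · rw [add_edgeVector_edgeDual]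
      exact h _ (F.succ_mem w hw)
    · rw [add_edgeVector_edgeDual]
      exact F.le hw' (F.edgeDual_mem w hw)
  rw [← add_edgeVector_edgeDual w w', ← e, add_edgeVector_edgeDual]

theorem boundaryEdges_eq (hef : det2 e f = 1) : boundaryEdges (Γ.image (dualCoord e f)) =
    Γ.image fun w => (dualCoord e f w, dualCoord e f (σ w)) := by
  ext ⟨g, g'⟩
  simp only [boundaryEdges, Finset.mem_filter, Finset.mem_product, Finset.mem_image,
    Prod.mk.injEq]
  constructor
  · rintro ⟨⟨⟨w, hw, rfl⟩, w', hw', rfl⟩, hdet, hle⟩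
    rw [crossing_dualCoord hef] at hdet
    have hle' : ∀ x ∈ Γ, -1 ≤ x ⬝ᵥ edgeDual w w' := fun x hx => by
      have := hle _ ⟨x, hx, rfl⟩
      rwa [edgeNormal_dualCoord, pair_coord hef] at this
    exact ⟨w, hw, rfl, by rw [F.eq_succ hw hw' hdet hle']⟩
  · rintro ⟨w, hw, rfl, rfl⟩
    refine ⟨⟨⟨w, hw, rfl⟩, σ w, F.succ_mem w hw, rfl⟩, ?_, ?_⟩
    · rw [crossing_dualCoord hef, F.det_succ w hw]
    · rintro _ ⟨x, hx, rfl⟩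
      rw [edgeNormal_dualCoord, pair_coord hef]
      exact F.le hx (F.edgeDual_mem w hw)

theorem image_edgeNormal (hef : det2 e f = 1) :
    (boundaryEdges (Γ.image (dualCoord e f))).image edgeNormal = V.image (coord e f) := by
  rw [F.boundaryEdges_eq hef, Finset.image_image]
  ext x
  simp only [Finset.mem_image, Function.comp_apply, edgeNormal_dualCoord]
  constructor
  · rintro ⟨w, hw, rfl⟩
    exact ⟨_, F.edgeDual_mem w hw, rfl⟩
  · rintro ⟨v, hv, rfl⟩
    obtain ⟨w, hw, rfl⟩ := F.exists_edge v hv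
    exact ⟨w, hw, rfl⟩

theorem sum_boundaryEdges (hef : det2 e f = 1) (φ : (ℤ × ℤ) × (ℤ × ℤ) → ℚ) :
    ∑ x ∈ boundaryEdges (Γ.image (dualCoord e f)), φ x =
      ∑ w : Γ, φ (dualCoord e f w, dualCoord e f (σ w)) := by
  rw [F.boundaryEdges_eq hef, Finset.sum_image fun w _ w' _ h =>
    dualCoord_injective hef (congrArg Prod.fst h)]
  exact (Finset.sum_coe_sort Γ fun w => φ (dualCoord e f w, dualCoord e f (σ w))).symm

theorem exists_isGoodTangent (hef : det2 e f = 1)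
    (h : HasTangent (Γ.image (dualCoord e f))) : ∃ y, IsGoodTangent V Γ σ y := by
  have hvalid : ∀ g ∈ Γ.image (dualCoord e f),
      ∃ x ∈ boundaryEdges (Γ.image (dualCoord e f)), x.1 = g := by
    rw [Finset.forall_mem_image]
    intro w hw
    rw [F.boundaryEdges_eq hef]
    exact ⟨_, Finset.mem_image_of_mem _ hw, rfl⟩
  have hcard : (V.image (coord e f)).card = V.card :=
    Finset.card_image_of_injective _ (coord_injective hef)
  have h' := h hvalid
  rw [F.image_edgeNormal hef, hcard] at h'
  have hφ : ((edgePhi (boundaryEdges (Γ.image (dualCoord e f)))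
      (fun x => totalDegree (V.image (coord e f)) x) : ℚ) : ℝ) = conePhi V Γ σ (fun _ => 1) := by
    rw [edgePhi, F.sum_boundaryEdges hef, conePhi]
    push_cast
    simp only [totalDegree_dualCoord V hef]
  have hψ : ∀ (y : ℤ × ℤ → ℚ) (v : Fin 2 → ℤ),
      ((edgeTangent (boundaryEdges (Γ.image (dualCoord e f))) y (coord e f v) : ℚ) : ℝ) =
        tangentValue Γ σ (fun w => y (dualCoord e f w)) v := by
    intro y v
    rw [edgeTangent, F.sum_boundaryEdges hef, tangentValue]
    simp only [pair_coord hef]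
    push_cast
    rfl
  have key : ∀ y : ℤ × ℤ → ℚ, TangentBound (boundaryEdges (Γ.image (dualCoord e f)))
      (V.image (coord e f)) (Γ.image (dualCoord e f)) y →
      (V.card = 3 → ∀ w ∈ Γ, (y (dualCoord e f w) : ℝ) = 2 / 3 * pointWeight V (fun _ => 1) w) →
      IsGoodTangent V Γ σ fun w => y (dualCoord e f w) := by
    rintro y ⟨h1, h2⟩ h3
    refine ⟨fun w hw => ?_, h3, fun v hv => ?_, fun hc v hv w hw => ?_⟩
    · exact_mod_cast h1 _ (Finset.mem_image_of_mem _ hw)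
    · have := (h2 _ (Finset.mem_image_of_mem _ hv)).1
      rw [← Rat.cast_le (K := ℝ), hψ, Rat.cast_mul, hφ, hcard] at this
      push_cast at this
      exact this
    · have := (h2 _ (Finset.mem_image_of_mem _ hv)).2 (by rwa [hcard]) _
        (Finset.mem_image_of_mem _ hw)
      rw [← Rat.cast_le (K := ℝ), hψ, Rat.cast_mul, Rat.cast_mul, hφ, hcard] at this
      push_cast at this
      rw [totalDegree_dualCoord V hef] at this
      exact this
  split_ifs at h' with h3
  · refine ⟨_, key _ h' fun _ w _ => ?_⟩
    push_cast
    rw [totalDegree_dualCoord V hef]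
  · obtain ⟨k, -, hk⟩ := h'
    exact ⟨_, key _ hk fun h => absurd h h3⟩

end IsFan

end Coordinates

/-! ### Classification of reflexive polygons -/

section Classification

/-- The lattice points `D` of a polygon and the nonzero lattice points `E` of its polar dual, both
with the origin in the interior, in coordinates. -/
structure IsDual (D E : ℤ → ℤ → Prop) : Prop where
  mem_iff : ∀ x y, D x y ↔ ∀ p q, E p q → -1 ≤ x * p + y * q
  dual_mem_iff : ∀ p q, E p q ↔ ¬(p = 0 ∧ q = 0) ∧ ∀ x y, D x y → -1 ≤ x * p + y * q
  exists_neg : ∀ p q, ¬(p = 0 ∧ q = 0) → ∃ x y, D x y ∧ x * p + y * q ≤ -1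
  exists_dual_neg : ∀ x y, ¬(x = 0 ∧ y = 0) → ∃ p q, E p q ∧ x * p + y * q ≤ -1

/-- A pair of opposite lattice points. -/
def HasOpposite (D : ℤ → ℤ → Prop) : Prop := ∃ x y, ¬(x = 0 ∧ y = 0) ∧ D x y ∧ D (-x) (-y)

namespace IsDual

variable {D E : ℤ → ℤ → Prop} (h : IsDual D E)
include h

theorem swap : IsDual (fun x y => D y x) fun p q => E q p where
  mem_iff x y := by
    rw [h.mem_iff y x]
    constructor
    · intro h p q hE
      have := h q p hE
      linarith
    · intro h p q hE
      have := h q p hE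
      linarith
  dual_mem_iff p q := by
    rw [h.dual_mem_iff q p, and_comm (a := q = 0)]
    refine and_congr_right fun _ => ⟨fun h x y hD => ?_, fun h x y hD => ?_⟩
    · have := h y x hD
      linarith
    · have := h y x hD
      linarith
  exists_neg p q hpq := by
    obtain ⟨x, y, h1, h2⟩ := h.exists_neg q p fun h => hpq h.symm
    exact ⟨y, x, h1, by linarith⟩
  exists_dual_neg x y hxy := by
    obtain ⟨p, q, h1, h2⟩ := h.exists_dual_neg y x fun h => hxy h.symm
    exact ⟨q, p, h1, by linarith⟩

theorem le {x y p q : ℤ} (hD : D x y) (hE : E p q) : -1 ≤ x * p + y * q :=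
  (h.mem_iff x y).1 hD p q hE

theorem exists_tight {x y : ℤ} (hD : D x y) (hxy : ¬(x = 0 ∧ y = 0)) :
    ∃ p q, E p q ∧ x * p + y * q = -1 := by
  obtain ⟨p, q, h1, h2⟩ := h.exists_dual_neg x y hxy
  exact ⟨p, q, h1, le_antisymm h2 (h.le hD h1)⟩

/-- A dual point violating `(-1, -1)` has `p + q ≥ 2`. Without opposite points both coordinates must
be positive: otherwise `(-a, -b)` would be so steep that `(0, -1)` or `(-1, 0)` lies in `D`. Then
`(-a, -b)` is violated as well. -/
theorem mem_neg_one_neg_one (h10 : D 1 0) (h01 : D 0 1) (hno : ¬HasOpposite D) {a b : ℤ}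
    (ha : 1 ≤ a) (hb : 1 ≤ b) (hD : D (-a) (-b)) : D (-1) (-1) := by
  have key : ∀ {D E : ℤ → ℤ → Prop}, IsDual D E → D 1 0 → D 0 1 → ¬HasOpposite D →
      ∀ {a b : ℤ}, 1 ≤ a → 1 ≤ b → D (-a) (-b) → ∀ p q, E p q → 1 - p < q → 1 ≤ q := by
    intro D E h h10 h01 hno a b ha hb hD p q hE hpq
    by_contra! hq
    have h1 := h.le h10 hE
    have h2 := h.le h01 hE
    have h3 := h.le hD hE
    refine hno ⟨0, 1, by simp, h01, ?_⟩
    rw [neg_zero, h.mem_iff]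
    intro p' q' hE'
    have h1' := h.le h10 hE'
    have h3' := h.le hD hE'
    by_contra! hcon
    have hb3 : 3 * a - 1 ≤ b := by
      rcases (by omega : q = 0 ∨ q = -1) with rfl | rfl
      · nlinarith
      · nlinarith
    nlinarith
  rw [h.mem_iff]
  intro p q hE
  by_contra! hcon
  have h1 := key h h10 h01 hno ha hb hD p q hE (by linarith)
  have h2 := key h.swap h01 h10 (fun ⟨x, y, h1, h2, h3⟩ => hno ⟨y, x, fun h => h1 h.symm, h2, h3⟩)
    hb ha hD q p hE (by linarith)
  have h3 := h.le hD hE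
  nlinarith

/-- The three given points confine `E` to the triangle. Conversely, any further point of `D` either
excludes the corner `(2, -1)` or `(-1, 2)` from `E`, which puts `(-1, 0)` or `(0, -1)` into `D`, or
lies on an axis or the diagonal and is not primitive; so `D` has only four points. -/
theorem eq_triangle (h10 : D 1 0) (h01 : D 0 1) (hE : E (-1) (-1)) (hno : ¬HasOpposite D)
    (hD : D (-1) (-1)) (p q : ℤ) : E p q ↔ (p, q) ∈ triangle := by
  have hbox : ∀ p q, E p q → -1 ≤ p ∧ -1 ≤ q ∧ p + q ≤ 1 := fun p q hE => by
    have h1 := h.le h10 hE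
    have h2 := h.le h01 hE
    have h3 := h.le hD hE
    omega
  have hfour : ∀ x y, D x y → x = 0 ∧ y = 0 ∨ x = 1 ∧ y = 0 ∨ x = 0 ∧ y = 1 ∨ x = -1 ∧ y = -1 := by
    intro x y hxy
    have h1 := h.le hxy hE
    by_cases hx1 : x ≤ -1 ∧ x + 1 ≤ y
    · exfalso
      refine hno ⟨1, 0, by simp, h10, ?_⟩
      rw [neg_zero, h.mem_iff]
      intro p q hpq
      by_contra! hcon
      obtain ⟨-, h3, h4⟩ := hbox p q hpq
      have hp : p = 2 := by omega
      have hq : q = -1 := by omega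
      have := h.le hxy hpq
      subst hp hq
      omega
    by_cases hy1 : y ≤ -1 ∧ y + 1 ≤ x
    · exfalso
      refine hno ⟨0, 1, by simp, h01, ?_⟩
      rw [neg_zero, h.mem_iff]
      intro p q hpq
      by_contra! hcon
      obtain ⟨h3, -, h4⟩ := hbox p q hpq
      have hp : p = -1 := by omega
      have hq : q = 2 := by omega
      have := h.le hxy hpq
      subst hp hq
      omega
    by_cases h0 : x = 0 ∧ y = 0
    · exact Or.inl h0
    obtain ⟨p, q, -, h2⟩ := h.exists_tight hxy h0
    by_cases hxy' : x = y
    · subst hxy'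
      have h4 : x * (p + q) = -1 := by linarith
      rcases Int.eq_one_or_neg_one_of_mul_eq_neg_one h4 with h | h <;> omega
    by_cases hy0 : y = 0
    · subst hy0
      have h4 : x * p = -1 := by linarith
      rcases Int.eq_one_or_neg_one_of_mul_eq_neg_one h4 with h | h <;> omega
    · have hx0 : x = 0 := by omega
      subst hx0
      have h4 : y * q = -1 := by linarith
      rcases Int.eq_one_or_neg_one_of_mul_eq_neg_one h4 with h | h <;> omega
  constructor
  · intro hpq
    obtain ⟨h1, h2, h3⟩ := hbox p q hpq
    have h4 := ((h.dual_mem_iff p q).1 hpq).1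
    have hp : p ≤ 2 := by omega
    have hq : q ≤ 2 := by omega
    interval_cases p <;> interval_cases q <;> simp [triangle] at h3 h4 ⊢
  · intro hpq
    have hb : ¬(p = 0 ∧ q = 0) ∧ -1 ≤ p ∧ -1 ≤ q ∧ p + q ≤ 1 := by
      simp only [triangle, Finset.mem_insert, Finset.mem_singleton, Prod.mk.injEq] at hpq
      omega
    rw [h.dual_mem_iff]
    refine ⟨hb.1, fun x y hxy => ?_⟩
    rcases hfour x y hxy with ⟨rfl, rfl⟩ | ⟨rfl, rfl⟩ | ⟨rfl, rfl⟩ | ⟨rfl, rfl⟩ <;> omega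

/-- Take `x = ⌈a / b⌉`. Then `b (x, -1) = (a, -b) + (b x - a) (1, 0)` with `b x - a ≤ b - 1`, so `b`
times each pairing is at least `-b`. -/
theorem exists_mem_neg_one (h10 : D 1 0) {a b : ℤ} (ha : 0 ≤ a) (hb : 1 ≤ b) (hab : a ≤ 1 + b)
    (hD : D a (-b)) : ∃ x, 0 ≤ x ∧ x ≤ 2 ∧ a ≤ b * x ∧ b * x ≤ a + b - 1 ∧ D x (-1) := by
  have h1 := Int.mul_ediv_add_emod (a + b - 1) b
  have h2 := Int.emod_nonneg (a + b - 1) (by omega : b ≠ 0)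
  have h3 := Int.emod_lt_of_pos (a + b - 1) (by omega : 0 < b)
  set x := (a + b - 1) / b
  refine ⟨x, by nlinarith, by nlinarith, by linarith, by linarith, ?_⟩
  rw [h.mem_iff]
  intro p q hE
  have h4 := h.le h10 hE
  have h5 := h.le hD hE
  have h6 : 0 ≤ (b * x - a) * (p + 1) := mul_nonneg (by linarith) (by linarith)
  by_contra! hcon
  nlinarith

/-- For `a > 0` the rounding gives `(1, -1)`, opposite to `(-1, 1)`. If `y = 2`, a tight dual point
at `(1, -1)` forces `a = 1`, and then `(1, -2)` lies in `D`. -/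
theorem hasOpposite_of_lt (h10 : D 1 0) (h01 : D 0 1) {a b y : ℤ} (ha : 0 ≤ a) (hab : a < b)
    (hD : D a (-b)) (hy : y = 1 ∨ y = 2) (hg : D (-1) y) : HasOpposite D := by
  rcases ha.eq_or_lt with rfl | ha'
  · refine ⟨0, 1, by simp, h01, ?_⟩
    rw [neg_zero, h.mem_iff]
    intro p q hE
    have := h.le hD hE
    by_contra! hcon
    nlinarith
  obtain ⟨x, hx0, hx2, hx3, hx4, hf⟩ := h.exists_mem_neg_one h10 ha (by omega) (by omega) hD
  have hx : x = 1 := by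
    apply le_antisymm
    · by_contra! hcon
      nlinarith
    · by_contra! hcon
      have : x = 0 := by omega
      subst this
      omega
  subst hx
  rcases hy with rfl | rfl
  · exact ⟨1, -1, by simp, hf, hg⟩
  refine ⟨1, -2, by simp, ?_, by simpa using hg⟩
  obtain ⟨p₀, q₀, hE₀, h₀⟩ := h.exists_tight hf (by simp)
  have h1 := h.le hD hE₀
  have h2 := h.le h10 hE₀
  have hp₀ : p₀ = q₀ - 1 := by linarith
  subst hp₀
  have h3 : (b - a) * q₀ ≤ 1 - a := by linarith
  have h4 : q₀ = 0 := by
    apply le_antisymm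
    · by_contra! hcon
      nlinarith
    · linarith
  subst h4
  have ha1 : a = 1 := by omega
  subst ha1
  rw [h.mem_iff]
  intro p q hE
  have h5 := h.le hD hE
  have h6 := h.le h10 hE
  have h7 := h.le h01 hE
  rcases (by omega : q = -1 ∨ 0 ≤ q) with rfl | hq
  · linarith
  · nlinarith

/-- Points on the negative sides of `(1, 0)` and `(0, 1)` yield some `(-1, y)` and `(x, -1)` in `D`.
A point on the negative side of `(1, 1)` must lie in the second or fourth quadrant and satisfies the
hypothesis of `hasOpposite_of_lt` up to a swap. -/
theorem hasOpposite_of_not_mem (h10 : D 1 0) (h01 : D 0 1) (hE : E (-1) (-1))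
    (hno : ∀ a b, 1 ≤ a → 1 ≤ b → ¬D (-a) (-b)) : HasOpposite D := by
  have hno' : ∀ x y, D x y → 0 ≤ x ∨ 0 ≤ y := fun x y hxy => by
    by_contra! hcon
    refine hno (-x) (-y) (by omega) (by omega) ?_
    simpa using hxy
  obtain ⟨x₁, y₁, hD₁, h₁⟩ := h.exists_neg 1 0 (by simp)
  obtain ⟨x₂, y₂, hD₂, h₂⟩ := h.exists_neg 0 1 (by simp)
  obtain ⟨x₃, y₃, hD₃, h₃⟩ := h.exists_neg 1 1 (by simp)
  have hs₁ := h.le hD₁ hE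
  have hs₂ := h.le hD₂ hE
  obtain ⟨x, hx0, hx2, -, -, hf⟩ := h.exists_mem_neg_one (a := x₂) (b := -y₂) h10
    (by have := hno' _ _ hD₂; omega) (by omega) (by omega) (by rwa [neg_neg])
  obtain ⟨y, hy0, hy2, -, -, hg⟩ := h.swap.exists_mem_neg_one (a := y₁) (b := -x₁) h01
    (by have := hno' _ _ hD₁; omega) (by omega) (by omega) (by rwa [neg_neg])
  rcases hx0.eq_or_lt with rfl | hx1
  · exact ⟨0, 1, by simp, h01, hf⟩
  rcases hy0.eq_or_lt with rfl | hy1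
  · exact ⟨1, 0, by simp, h10, hg⟩
  rcases hno' _ _ hD₃ with h3 | h3
  · exact h.hasOpposite_of_lt h10 h01 (a := x₃) (b := -y₃) h3 (by omega) (by rwa [neg_neg])
      (by omega) hg
  · obtain ⟨x, y, h1, h2, h3⟩ := h.swap.hasOpposite_of_lt h01 h10 (a := y₃) (b := -x₃) h3 (by omega)
      (by rwa [neg_neg]) (by omega) hf
    exact ⟨y, x, fun h => h1 h.symm, h2, h3⟩

theorem hasOpposite_or_eq_triangle (h10 : D 1 0) (h01 : D 0 1) (hE : E (-1) (-1)) :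
    HasOpposite D ∨ ∀ p q, E p q ↔ (p, q) ∈ triangle := by
  rw [or_iff_not_imp_left]
  intro hno
  refine h.eq_triangle h10 h01 hE hno ?_
  by_contra hD
  refine hno (h.hasOpposite_of_not_mem h10 h01 hE fun a b ha hb hab => ?_)
  exact hD (h.mem_neg_one_neg_one h10 h01 hno ha hb hab)

/-- The sum of the two dual points is `(0, a + b)`, which pairs to at least `-2` with a point of `D`
of negative second coordinate. -/
theorem add_le_two {a b : ℤ} (ha : E (-1) a) (hb : E 1 b) : a + b ≤ 2 := by
  by_contra! hcon
  obtain ⟨x, y, hD, hy⟩ := h.exists_neg 0 1 (by simp)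
  have h1 := h.le hD ha
  have h2 := h.le hD hb
  nlinarith

theorem neg_two_le_add {a b : ℤ} (ha : E (-1) a) (hb : E 1 b) : -2 ≤ a + b := by
  by_contra! hcon
  obtain ⟨x, y, hD, hy⟩ := h.exists_neg 0 (-1) (by simp)
  have h1 := h.le hD ha
  have h2 := h.le hD hb
  nlinarith

theorem column_convex {p a b q : ℤ} (hp : p ≠ 0) (ha : E p a) (hb : E p b) (haq : a ≤ q)
    (hqb : q ≤ b) : E p q := by
  rw [h.dual_mem_iff]
  refine ⟨fun h => hp h.1, fun x y hD => ?_⟩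
  have h1 := h.le hD ha
  have h2 := h.le hD hb
  rcases le_total 0 y with hy | hy <;> nlinarith

/-- The opposite points `(±1, 0)` force `|p| ≤ 1`, the outer columns are intervals by convexity, and
a point `(0, q)` is tight only if `q = ±1`. The ranges of `u`, `u'`, `l` come from `add_le_two` and
`neg_two_le_add`. -/
theorem exists_eq_strip (h10 : D 1 0) (hm10 : D (-1) 0) (hE : E (-1) (-1))
    (hmin : ∀ q, E (-1) q → -1 ≤ q) {G : Finset (ℤ × ℤ)} (hG : ∀ p q, (p, q) ∈ G ↔ E p q) :
    ∃ u ∈ Finset.Icc (-1 : ℤ) 3, ∃ u' ∈ Finset.Icc (-1 : ℤ) (2 - u),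
      ∃ l ∈ Finset.Icc (-1 : ℤ) u', ∃ s t, G = strip u l u' s t := by
  classical
  have hcol : ∀ p q, E p q → ∃ u l, E p u ∧ E p l ∧ ∀ q, E p q → l ≤ q ∧ q ≤ u := by
    intro p q hpq
    have hmem : ∀ q, q ∈ (G.filter fun x => x.1 = p).image Prod.snd ↔ E p q := fun q => by
      simp only [Finset.mem_image, Finset.mem_filter, Prod.exists, ← hG]
      constructor
      · rintro ⟨p', q', ⟨h1, rfl⟩, rfl⟩
        exact h1
      · intro h1
        exact ⟨p, q, ⟨h1, rfl⟩, rfl⟩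
    have hne : ((G.filter fun x => x.1 = p).image Prod.snd).Nonempty := ⟨q, (hmem q).2 hpq⟩
    refine ⟨Finset.max' _ hne, Finset.min' _ hne, (hmem _).1 (Finset.max'_mem _ _),
      (hmem _).1 (Finset.min'_mem _ _), fun q hq => ⟨Finset.min'_le _ _ ((hmem q).2 hq),
        Finset.le_max' _ _ ((hmem q).2 hq)⟩⟩
  obtain ⟨p₁, q₁, hE₁, h₁⟩ := h.exists_tight hm10 (by simp)
  have hp₁ : p₁ = 1 := by linarith
  subst hp₁
  obtain ⟨u, l₀, hu, -, hu'⟩ := hcol _ _ hE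
  obtain ⟨v, l, hv, hl, hv'⟩ := hcol _ _ hE₁
  have h1 := h.add_le_two hu hv
  have h2 := h.neg_two_le_add hE hl
  have h3 := (hu' _ hE).2
  have h4 := (hv' _ hl).2
  refine ⟨u, ?_, v, ?_, l, ?_, decide (E 0 1), decide (E 0 (-1)), ?_⟩
  · rw [Finset.mem_Icc]
    omega
  · rw [Finset.mem_Icc]
    omega
  · rw [Finset.mem_Icc]
    omega
  ext ⟨p, q⟩
  have hs : (p, q) ∈ (if decide (E 0 1) = true then ({(0, 1)} : Finset (ℤ × ℤ)) else ∅) ↔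
      E 0 1 ∧ p = 0 ∧ q = 1 := by
    by_cases h : E 0 1 <;> simp [h]
  have ht : (p, q) ∈ (if decide (E 0 (-1)) = true then ({(0, -1)} : Finset (ℤ × ℤ)) else ∅) ↔
      E 0 (-1) ∧ p = 0 ∧ q = -1 := by
    by_cases h : E 0 (-1) <;> simp [h]
  rw [hG, strip, Finset.mem_union, Finset.mem_union, Finset.mem_union, hs, ht]
  simp only [Finset.mem_image, Finset.mem_Icc, Prod.mk.injEq]
  constructor
  · intro hpq
    have h5 := h.le h10 hpq
    have h6 := h.le hm10 hpq
    rcases (by omega : p = -1 ∨ p = 0 ∨ p = 1) with rfl | rfl | rfl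
    · exact Or.inl (Or.inl (Or.inl ⟨q, ⟨hmin q hpq, (hu' q hpq).2⟩, rfl, rfl⟩))
    · obtain ⟨x, y, hD, hy⟩ := h.exists_neg 0 q ((h.dual_mem_iff 0 q).1 hpq).1
      have h7 := h.le hD hpq
      have h8 : q * y = -1 := by linarith
      rcases Int.eq_one_or_neg_one_of_mul_eq_neg_one h8 with rfl | rfl
      · exact Or.inl (Or.inr ⟨hpq, rfl, rfl⟩)
      · exact Or.inr ⟨hpq, rfl, rfl⟩
    · exact Or.inl (Or.inl (Or.inr ⟨q, hv' q hpq, rfl, rfl⟩))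
  · rintro (((⟨q', ⟨h5, h6⟩, rfl, rfl⟩ | ⟨q', ⟨h5, h6⟩, rfl, rfl⟩) | ⟨h5, rfl, rfl⟩) | ⟨h5, rfl, rfl⟩)
    · exact h.column_convex (by norm_num) hE hu h5 h6
    · exact h.column_convex one_ne_zero hl hv h5 h6
    · exact h5
    · exact h5

end IsDual

/-! ### Choice of coordinates adapted to a reflexive polygon. -/

namespace IsPolarPair

variable {V Γ : Finset (Fin 2 → ℤ)} (P : IsPolarPair V Γ) {e f : Fin 2 → ℤ}
include P

theorem isDual (hef : det2 e f = 1) :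
    IsDual (fun x y => ∀ w ∈ Γ, -1 ≤ w ⬝ᵥ (x • e + y • f))
      fun p q => (p, q) ∈ Γ.image (dualCoord e f) := by
  have hdot : ∀ (w : Fin 2 → ℤ) (x y : ℤ),
      w ⬝ᵥ (x • e + y • f) = x * (dualCoord e f w).1 + y * (dualCoord e f w).2 := fun w x y => by
    rw [dotProduct_add, dotProduct_smul, dotProduct_smul]
    rfl
  have hV : ∀ v, v = (coord e f v).1 • e + (coord e f v).2 • f := fun v => by
    simp only [coord, det2] at hef ⊢
    funext i
    fin_cases i
    · simp
      linear_combination (-v 0) * hef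
    · simp
      linear_combination (-v 1) * hef
  have hsurj : ∀ p q : ℤ, ∃ w, dualCoord e f w = (p, q) := fun p q => by
    refine ⟨![p * f 1 - q * e 1, q * e 0 - p * f 0], ?_⟩
    simp only [det2] at hef
    ext
    · simp [dualCoord, dotProduct, Fin.sum_univ_two]
      linear_combination p * hef
    · simp [dualCoord, dotProduct, Fin.sum_univ_two]
      linear_combination q * hef
  have hmem : ∀ w, dualCoord e f w ∈ Γ.image (dualCoord e f) ↔ w ∈ Γ := fun w =>
    (dualCoord_injective hef).mem_finset_image
  have hzero : ∀ w, (dualCoord e f w).1 = 0 ∧ (dualCoord e f w).2 = 0 ↔ w = 0 := fun w => by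
    constructor
    · rintro ⟨h1, h2⟩
      refine dualCoord_injective hef ?_
      ext
      · simpa [dualCoord] using h1
      · simpa [dualCoord] using h2
    · rintro rfl
      simp [dualCoord]
  have hneg : ∀ w, w ≠ 0 → ∃ v ∈ V, w ⬝ᵥ v ≤ -1 := fun w hw => by
    obtain ⟨v, hv, h⟩ := exists_dotProduct_neg P.zero_mem_interior (a := toPlane w) fun h =>
      hw (toPlane_injective (h.trans toPlane_zero.symm))
    rw [toPlane_dotProduct] at h
    have h' : w ⬝ᵥ v < 0 := by exact_mod_cast h
    exact ⟨v, hv, by omega⟩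
  refine ⟨fun x y => ⟨fun h p q hpq => ?_, fun h w hw => ?_⟩, fun p q => ?_, fun p q hpq => ?_,
    fun x y hxy => ?_⟩
  · obtain ⟨w, hw, e⟩ := Finset.mem_image.1 hpq
    have := h w hw
    rwa [hdot, e] at this
  · rw [hdot]
    exact h _ _ (Finset.mem_image_of_mem _ hw)
  · obtain ⟨w, hw⟩ := hsurj p q
    obtain ⟨rfl, rfl⟩ := Prod.mk.inj hw
    refine Iff.trans (hmem w) ?_
    rw [P.mem_iff]
    refine and_congr (not_congr (hzero w).symm) ⟨fun h x y hxy => ?_, fun h v hv => ?_⟩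
    · by_cases hw0 : w = 0
      · subst hw0
        simp
      · have := hxy w ((P.mem_iff w).2 ⟨hw0, h⟩)
        rwa [hdot] at this
    · rw [hV v, hdot]
      refine h _ _ fun w hw => ?_
      rw [← hV]
      exact P.le hw hv
  · obtain ⟨w, hw⟩ := hsurj p q
    obtain ⟨rfl, rfl⟩ := Prod.mk.inj hw
    obtain ⟨v, hv, h⟩ := hneg w fun h => hpq ((hzero w).2 h)
    refine ⟨(coord e f v).1, (coord e f v).2, fun w hw => ?_, ?_⟩
    · rw [← hV]
      exact P.le hw hv
    · have := hdot w (coord e f v).1 (coord e f v).2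
      rw [← hV] at this
      exact this.symm.trans_le h
  · have hne : x • e + y • f ≠ 0 := by
      intro h0
      refine hxy ?_
      have h1 := congrFun h0 0
      have h2 := congrFun h0 1
      simp only [det2, Pi.add_apply, Pi.smul_apply, smul_eq_mul, Pi.zero_apply] at hef h1 h2
      constructor
      · linear_combination f 1 * h1 - f 0 * h2 - x * hef
      · linear_combination e 0 * h2 - e 1 * h1 - y * hef
    obtain ⟨w, hw, h⟩ := P.exists_dual_dotProduct_neg hne
    rw [hdot] at h
    exact ⟨_, _, Finset.mem_image_of_mem _ hw, Int.le_sub_one_of_lt h⟩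

/-- The last lattice point `w` of a dual edge is a corner, so two distinct vertices are tight there.
The edge joining them contains consecutive lattice points, which form a basis on which `w` is `-1`.
-/
theorem exists_basis : ∃ e f w : Fin 2 → ℤ, det2 e f = 1 ∧ (∀ x ∈ Γ, -1 ≤ x ⬝ᵥ e) ∧
    (∀ x ∈ Γ, -1 ≤ x ⬝ᵥ f) ∧ w ∈ Γ ∧ w ⬝ᵥ e = -1 ∧ w ⬝ᵥ f = -1 := by
  classical
  obtain ⟨v, hv, -⟩ := exists_dotProduct_neg P.zero_mem_interior (a := ![1, 0]) (by
    intro h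
    simpa using congrFun h 0)
  obtain ⟨w₀, hw₀, hwv₀, -⟩ := P.exists_edge hv
  obtain ⟨w, hw, hmax⟩ := (Γ.filter fun w => w ⬝ᵥ v = -1).exists_max_image
    (fun w => edgeVector v ⬝ᵥ w) ⟨w₀, Finset.mem_filter.2 ⟨hw₀, hwv₀⟩⟩
  obtain ⟨hw, hwv⟩ := Finset.mem_filter.1 hw
  obtain ⟨v', hv', hwv', hmem⟩ := P.exists_succ hw
  have hne : v' ≠ v := by
    rintro rfl
    have h1 := hmax _ (Finset.mem_filter.2 ⟨hmem, by
      rw [add_dotProduct, edgeVector_dotProduct, det2_self, hwv, neg_zero, add_zero]⟩)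
    rw [dotProduct_add] at h1
    have h2 : edgeVector v' ≠ 0 := by
      intro h
      have h3 := congrFun h 0
      have h4 := congrFun h 1
      simp [edgeVector] at h3 h4
      simp [dotProduct, Fin.sum_univ_two, h3, h4] at hwv
    have h3 : 0 < edgeVector v' ⬝ᵥ edgeVector v' :=
      lt_of_le_of_ne (Finset.sum_nonneg fun i _ => mul_self_nonneg _) fun h =>
        h2 (dotProduct_self_eq_zero.1 h.symm)
    omega
  have key : ∀ v v' : Fin 2 → ℤ, v ∈ V → v' ∈ V → w ⬝ᵥ v = -1 → w ⬝ᵥ v' = -1 → 1 ≤ det2 v v' →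
      ∃ e f w : Fin 2 → ℤ, det2 e f = 1 ∧ (∀ x ∈ Γ, -1 ≤ x ⬝ᵥ e) ∧
        (∀ x ∈ Γ, -1 ≤ x ⬝ᵥ f) ∧ w ∈ Γ ∧ w ⬝ᵥ e = -1 ∧ w ⬝ᵥ f = -1 := by
    intro v v' hv hv' h h' hdet
    rw [dotProduct_comm] at h h'
    have e' := eq_add_det2_smul h h'
    refine ⟨v, v + edgeVector w, w, ?_, fun x hx => P.le hx hv, fun x hx => ?_, hw, ?_, ?_⟩
    · rw [det2_add_edgeVector, h, neg_neg]
    · have h1 := P.le hx hv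
      have h2 := P.le hx hv'
      rw [e', dotProduct_add, dotProduct_smul, smul_eq_mul] at h2
      rw [dotProduct_add]
      rcases le_total 0 (x ⬝ᵥ edgeVector w) with h | h <;> nlinarith
    · rw [dotProduct_comm, h]
    · rw [dotProduct_add, dotProduct_comm w v, h, dotProduct_comm, edgeVector_dotProduct, det2_self,
        neg_zero, add_zero]
  rcases lt_trichotomy (det2 v v') 0 with h | h | h
  · exact key v' v hv' hv hwv' hwv (by rw [det2_swap]; omega)
  · have e' := eq_add_det2_smul (w := v) (w' := v') (v := w) (by rw [dotProduct_comm, hwv])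
      (by rw [dotProduct_comm, hwv'])
    rw [h, zero_smul, add_zero] at e'
    exact absurd e' hne
  · exact key v v' hv hv' hwv hwv' h

theorem exists_hasTangent_of_opposite (he0 : e ≠ 0) (he : ∀ w ∈ Γ, -1 ≤ w ⬝ᵥ e)
    (he' : ∀ w ∈ Γ, -1 ≤ w ⬝ᵥ -e) :
    ∃ f, det2 e f = 1 ∧ HasTangent (Γ.image (dualCoord e f)) := by
  classical
  obtain ⟨w₀, hw₀, h₀⟩ := P.exists_dual_dotProduct_neg he0
  have hwe₀ : w₀ ⬝ᵥ e = -1 := le_antisymm (by omega) (he w₀ hw₀)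
  obtain ⟨w, hw, hmin⟩ := (Γ.filter fun w => w ⬝ᵥ e = -1).exists_min_image
    (fun w => w ⬝ᵥ edgeVector w₀) ⟨w₀, Finset.mem_filter.2 ⟨hw₀, hwe₀⟩⟩
  obtain ⟨hw, hwe⟩ := Finset.mem_filter.1 hw
  -- A shear fixing `e` moves the lowest point of the column `-1` to `(-1, -1)`.
  set t := w ⬝ᵥ edgeVector w₀ + 1 with ht
  set f := edgeVector w₀ + t • e with hf
  have hef : det2 e f = 1 := by
    have h1 := det2_add_edgeVector e w₀
    rw [dotProduct_comm, hwe₀] at h1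
    simp only [det2, hf, Pi.add_apply, Pi.smul_apply, smul_eq_mul] at h1 ⊢
    linarith
  have hfx : ∀ x, x ⬝ᵥ e = -1 → x ⬝ᵥ f = x ⬝ᵥ edgeVector w₀ - t := fun x hx => by
    rw [hf, dotProduct_add, dotProduct_smul, hx, smul_eq_mul]
    ring
  refine ⟨f, hef, ?_⟩
  have hdual := P.isDual hef
  obtain ⟨u, hu, u', hu', l, hl, s, t, hG⟩ := hdual.exists_eq_strip
    (by simpa using he) (by simpa using he')
    (by
      rw [Finset.mem_image]
      refine ⟨w, hw, ?_⟩
      rw [dualCoord, hwe, hfx w hwe, ht]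
      simp)
    (fun q hq => by
      obtain ⟨x, hx, hxq⟩ := Finset.mem_image.1 hq
      obtain ⟨h1, rfl⟩ := Prod.mk.inj hxq
      have := hmin x (Finset.mem_filter.2 ⟨hx, h1⟩)
      rw [hfx x h1]
      omega)
    (fun p q => Iff.rfl)
  rw [hG]
  exact hasTangent_strip u hu u' hu' l hl s t

theorem exists_hasTangent : ∃ e f, det2 e f = 1 ∧ HasTangent (Γ.image (dualCoord e f)) := by
  obtain ⟨e, f, w, hef, he, hf, hw, hwe, hwf⟩ := P.exists_basis
  rcases (P.isDual hef).hasOpposite_or_eq_triangle (by simpa using he) (by simpa using hf) (by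
      rw [Finset.mem_image]
      exact ⟨w, hw, by rw [dualCoord, hwe, hwf]⟩) with ⟨x, y, hxy, h1, h2⟩ | h
  · obtain ⟨f', h⟩ := P.exists_hasTangent_of_opposite (e := x • e + y • f) (fun h0 => hxy (by
      have h1 := congrFun h0 0
      have h2 := congrFun h0 1
      simp only [det2, Pi.add_apply, Pi.smul_apply, smul_eq_mul, Pi.zero_apply] at hef h1 h2
      constructor
      · linear_combination f 1 * h1 - f 0 * h2 - x * hef
      · linear_combination e 0 * h2 - e 1 * h1 - y * hef)) h1 (by
        intro w hw
        have := h2 w hw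
        rwa [neg_smul, neg_smul, ← neg_add] at this)
    exact ⟨_, f', h⟩
  · refine ⟨e, f, hef, ?_⟩
    have : Γ.image (dualCoord e f) = triangle := by
      ext ⟨p, q⟩
      exact h p q
    rw [this]
    exact hasTangent_triangle

end IsPolarPair

end Classification

end ToricFutaki

end

open ToricFutaki in
theorem mainTheorem3 (V : Finset (Fin 2 → ℤ)) (hV : IsReflexivePolygon V) :
    (∃ r : V → ℝ, IsRCharge V r) ∧
    ∀ r : V → ℝ, IsRCharge V r → ∀ h : Generator V,
      ∃ Fp FR : ℝ,
        HasFutakiInvariant (toricIdeal V) (glsmWeight V fun _ => 1) (testSymmetry h) Fp ∧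
        HasFutakiInvariant (toricIdeal V) (glsmWeight V r) (testSymmetry h) FR ∧
        Fp ≤ 8 / 27 * FR ∧
        (V.card = 3 → Fp = 8 / 27 * FR) := by
  obtain ⟨Γ, P⟩ := hV.exists_isPolarPair
  obtain ⟨σ, F⟩ := P.exists_isFan
  obtain ⟨e, f, hef, hT⟩ := P.exists_hasTangent
  obtain ⟨y, hy⟩ := F.exists_isGoodTangent hef hT
  exact ⟨F.exists_isRCharge P.zero_mem_interior,
    fun r hr h => futaki_le_of_isGoodTangent P F hy hr h⟩
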